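/- Let $K$ be a field of characteristic $0$ and let $(L,[\cdot,\cdot,\cdot])$ be a Lie triple system over $K$: the bracket is trilinear with $[x,x,z]=0$, $[x,y,z]+[y,z,x]+[z,x,y]=0$ and $[x,y,[z,t,e]]=[[x,y,z],t,e]+[z,[x,y,t],e]+[z,t,[x,y,e]]$. Let $\theta:L\otimes L\to\mathrm{End}(M)$ be a representation of $L$ on a vector space $M$, i.e., with $D(x,y)=\theta(y,x)-\theta(x,y)$, $$\theta(z,t)\theta(x,y)-\theta(y,t)\theta(x,z)-\theta(x,[y,z,t])+D(y,z)\theta(x,t)=0,$$ $$\theta(z,t)D(x,y)-D(x,y)\theta(z,t)+\theta([x,y,z],t)+\theta(z,[x,y,t])=0.$$ Let $\mathcal H:L\times L\times L\to M$ be a $3$-cocycle: a trilinear map with $\mathcal H(x,x,z)=0$, $\mathcal H(x,y,z)+\mathcal H(y,z,x)+\mathcal H(z,x,y)=0$ and $$\mathcal H(x_1,x_2,[y_1,y_2,y_3])+D(x_1,x_2)\mathcal H(y_1,y_2,y_3)-\mathcal H([x_1,x_2,y_1],y_2,y_3)-\mathcal H(y_1,[x_1,x_2,y_2],y_3)$$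 $$=\mathcal H(y_1,y_2,[x_1,x_2,y_3])+\theta(y_2,y_3)\mathcal H(x_1,x_2,y_1)-\theta(y_1,y_3)\mathcal H(x_1,x_2,y_2)+D(y_1,y_2)\mathcal H(x_1,x_2,y_3).$$ A linear map $T:M\to L$ is a generalized Reynolds operator if for all $u,v,w\in M$ $$[Tu,Tv,Tw]=T\big(D(Tu,Tv)w+\theta(Tv,Tw)u-\theta(Tu,Tw)v+\mathcal H(Tu,Tv,Tw)\big).$$ For vector spaces $V,W$ let $C^n(V,W)$ $(n\ge 0)$ be the space of linear maps $f:(\wedge^2V)^{\otimes n}\otimes V\to W$ such that, if $n\ge1$, the cyclic sum over $x,y,z$ of $f(\mathfrak X_1,\dots,\mathfrak X_{n-1},x\wedge y,z)$ vanishes, and let $C^*(V,W)=\bigoplus_{n\ge0}C^n(V,W)$, with $C^n(V,W)$ in degree $n$. On $C^*(V,V)$ use the graded Lie bracket $[P,Q]=P\circ Q-(-1)^{pq}Q\circ P$ for $P\in C^p(V,V)$ and $Q\in C^q(V,V)$. Here, for $\mathfrak X_i=x_i\wedge y_i$ and $z\in V$, $$(P\circ Q)(\mathfrak X_1,\dots,\mathfrak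 X_{p+q},z)=\sum_{k=1}^{p}(-1)^{(k-1)q}\sum_{\sigma}(-1)^{\sigma}P\big(\mathfrak X_{\sigma(1)},\dots,\mathfrak X_{\sigma(k-1)},\,Q_\sigma x_{k+q}\wedge y_{k+q}+x_{k+q}\wedge Q_\sigma y_{k+q},\,\mathfrak X_{k+q+1},\dots,\mathfrak X_{p+q},z\big)$$ $$+(-1)^{pq}\sum_{\tau}(-1)^{\tau}P\big(\mathfrak X_{\tau(1)},\dots,\mathfrak X_{\tau(p)},Q(\mathfrak X_{\tau(p+1)},\dots,\mathfrak X_{\tau(p+q)},z)\big),$$ where $\sigma$ runs over the $(k-1,q)$-shuffles, $Q_\sigma=Q(\mathfrak X_{\sigma(k)},\dots,\mathfrak X_{\sigma(k+q-1)},\cdot)$, and $\tau$ runs over the $(p,q)$-shuffles. Regard $C^*(M,L)$ as a subspace of $C^*(L\oplus M,L\oplus M)$ (extension by zero), and regard $\pi+\theta$ and $\mathcal H$ as the elements of $C^1(L\oplus M,L\oplus M)$ sending $(x+u,y+v,z+w)$, where $x,y,z\in L$ and $u,v,w\in M$, to $[x,y,z]+\theta(y,z)u-\theta(x,z)v+D(x,y)w$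 and to $\mathcal H(x,y,z)$ respectively. For $P,Q,R,S\in C^*(M,L)$ put $$l_3(P,Q,R)=[[[\pi+\theta,P],Q],R],\qquad l_4(P,Q,R,S)=[[[[\mathcal H,P],Q],R],S],$$ which lie in $C^*(M,L)$, and $l_k=0$ for $k\ne3,4$. An $L_\infty$-algebra is a $\mathbb Z$-graded vector space with multilinear maps $l_k$ $(k\ge1)$ of $k$ arguments and of degree $1$ that are graded symmetric, $l_n(x_{\sigma(1)},\dots,x_{\sigma(n)})=\varepsilon(\sigma)l_n(x_1,\dots,x_n)$ with the Koszul sign $\varepsilon(\sigma)$, and satisfy for all $n\ge1$ and homogeneous $x_1,\dots,x_n$ $$\sum_{i=1}^n\sum_{\sigma}\varepsilon(\sigma)\,l_{n-i+1}\big(l_i(x_{\sigma(1)},\dots,x_{\sigma(i)}),x_{\sigma(i+1)},\dots,x_{\sigma(n)}\big)=0,$$ where $\sigma$ runs over the $(i,n-i)$-shuffles. A Maurer–Cartan element is an element $\alpha$ of degree $0$ with $\sum_{n\ge1}\frac1{n!}l_n(\alpha,\dots,\alpha)=0$ (a sum with finitely many nonzero terms). **Proposition.** Let $T:M\to L$ be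 a generalized Reynolds operator, viewed as an element of $C^0(M,L)$. The twisted maps $l_k^T(x_1,\dots,x_k)=\sum_{n\ge0}\frac1{n!}l_{n+k}(T,\dots,T,x_1,\dots,x_k)$ ($n$ copies of $T$; $k\ge1$) make $C^*(M,L)$ an $L_\infty$-algebra, and they are given by $$l_1^T(P)=\tfrac12l_3(T,T,P)+\tfrac16l_4(T,T,T,P),\qquad l_2^T(P,Q)=l_3(T,P,Q)+\tfrac12l_4(T,T,P,Q),$$ $$l_3^T(P,Q,R)=l_3(P,Q,R)+l_4(T,P,Q,R),\qquad l_4^T(P,Q,R,S)=l_4(P,Q,R,S),\qquad l_k^T=0\quad(k\ge5).$$ Moreover, for every linear map $T':M\to L$, the sum $T+T'$ is a generalized Reynolds operator if and only if $T'$ is a Maurer–Cartan element of this twisted $L_\infty$-algebra, i.e., if and only if $$l_1^T(T')+\tfrac1{2!}l_2^T(T',T')+\tfrac1{3!}l_3^T(T',T',T')+\tfrac1{4!}l_4^T(T',T',T',T')=0.$$ -/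

import Mathlib

namespace LieTriple

open Equiv

set_option linter.unusedSectionVars false

/-! ### Lie triple systems, representations, cocycles, generalized Reynolds operators -/

section Basic

variable (K L M : Type*) [Field K] [AddCommGroup L] [Module K L] [AddCommGroup M] [Module K M]

/-- A Lie triple system structure on the vector space `L`. -/
structure LieTripleSystem where
  /-- the ternary bracket `[x, y, z]` -/
  bracket : L →ₗ[K] L →ₗ[K] L →ₗ[K] L
  alt : ∀ x z, bracket x x z = 0
  cyclic : ∀ x y z, bracket x y z + bracket y z x + bracket z x y = 0
  fundamental : ∀ x y z t e, bracket x y (bracket z t e) =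
    bracket (bracket x y z) t e + bracket z (bracket x y t) e + bracket z t (bracket x y e)

variable {K L}

/-- A representation `θ` of a Lie triple system on `M`; the operator `D(x, y) = θ(y, x) - θ(x, y)`
is written out. -/
structure Representation (S : LieTripleSystem K L) where
  /-- the bilinear map `θ : L ⊗ L → End M` -/
  θ : L →ₗ[K] L →ₗ[K] Module.End K M
  rep_bracket : ∀ x y z t (u : M), θ z t (θ x y u) - θ y t (θ x z u) - θ x (S.bracket y z t) u
    + (θ z y (θ x t u) - θ y z (θ x t u)) = 0
  rep_deriv : ∀ x y z t (u : M), θ z t (θ y x u - θ x y u)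
    - (θ y x (θ z t u) - θ x y (θ z t u))
    + θ (S.bracket x y z) t u + θ z (S.bracket x y t) u = 0

variable {M}

/-- `D(x, y) = θ(y, x) - θ(x, y)`. -/
def Representation.D {S : LieTripleSystem K L} (ρ : Representation M S) :
    L →ₗ[K] L →ₗ[K] Module.End K M := ρ.θ.flip - ρ.θ

/-- A `3`-cocycle of the Lie triple system with coefficients in the representation. -/
structure ThreeCocycle {S : LieTripleSystem K L} (ρ : Representation M S) where
  /-- the trilinear map `H : L × L × L → M` -/
  H : L →ₗ[K] L →ₗ[K] L →ₗ[K] M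
  alt : ∀ x z, H x x z = 0
  cyclic : ∀ x y z, H x y z + H y z x + H z x y = 0
  closed : ∀ x₁ x₂ y₁ y₂ y₃, H x₁ x₂ (S.bracket y₁ y₂ y₃) + ρ.D x₁ x₂ (H y₁ y₂ y₃)
      - H (S.bracket x₁ x₂ y₁) y₂ y₃ - H y₁ (S.bracket x₁ x₂ y₂) y₃ =
    H y₁ y₂ (S.bracket x₁ x₂ y₃) + ρ.θ y₂ y₃ (H x₁ x₂ y₁) - ρ.θ y₁ y₃ (H x₁ x₂ y₂)
      + ρ.D y₁ y₂ (H x₁ x₂ y₃)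

/-- `T : M → L` is a generalized Reynolds operator (with respect to `θ` and `H`). -/
def IsGeneralizedReynolds {S : LieTripleSystem K L} {ρ : Representation M S} (ω : ThreeCocycle ρ)
    (T : M →ₗ[K] L) : Prop :=
  ∀ u v w, S.bracket (T u) (T v) (T w) =
    T (ρ.D (T u) (T v) w + ρ.θ (T v) (T w) u - ρ.θ (T u) (T w) v + ω.H (T u) (T v) (T w))

end Basic

/-! ### Cochains -/

section Cochains

variable {K V W : Type*} [Field K] [AddCommGroup V] [Module K V] [AddCommGroup W] [Module K W]

/-- `f` is (the map on decomposable tensors of) a linear map `(⋀² V) ⊗ ⋯ ⊗ (⋀² V) ⊗ V → W` with `n`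
factors `⋀² V`, whose cyclic sum over its last three arguments vanishes. -/
structure IsCochain (K : Type*) {V W : Type*} [Field K] [AddCommGroup V] [Module K V]
    [AddCommGroup W] [Module K W] {n : ℕ} (f : (Fin n → V × V) → V → W) : Prop where
  lin_last : ∀ X (a : K) x y, f X (a • x + y) = a • f X x + f X y
  lin_fst : ∀ X i z (a : K) x x' y, f (Function.update X i (a • x + x', y)) z =
    a • f (Function.update X i (x, y)) z + f (Function.update X i (x', y)) z
  lin_snd : ∀ X i z (a : K) x y y', f (Function.update X i (x, a • y + y')) z =
    a • f (Function.update X i (x, y)) z + f (Function.update X i (x, y')) z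
  alt : ∀ X i z x, f (Function.update X i (x, x)) z = 0
  cyclic : ∀ X (i : Fin n), (i : ℕ) + 1 = n → ∀ x y z, f (Function.update X i (x, y)) z
    + f (Function.update X i (y, z)) x + f (Function.update X i (z, x)) y = 0

/-- The space `C^n(V, W)` of `n`-cochains, as a subspace of a space of functions. -/
def cochainSubmodule (K V W : Type*) [Field K] [AddCommGroup V] [Module K V] [AddCommGroup W] [Module K W]
    (n : ℕ) : Submodule K ((Fin n → V × V) → V → W) where
  carrier := {f | IsCochain K f}
  add_mem' {f g} hf hg := by
    refine ⟨fun X a x y => ?_, fun X i z a x x' y => ?_, fun X i z a x y y' => ?_,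
      fun X i z x => ?_, fun X i h x y z => ?_⟩ <;> simp only [Pi.add_apply]
    · rw [hf.lin_last, hg.lin_last, smul_add]; abel
    · rw [hf.lin_fst, hg.lin_fst, smul_add]; abel
    · rw [hf.lin_snd, hg.lin_snd, smul_add]; abel
    · rw [hf.alt, hg.alt, add_zero]
    · have h₁ := hf.cyclic X i h x y z
      have h₂ := hg.cyclic X i h x y z
      calc _ = (f (Function.update X i (x, y)) z + f (Function.update X i (y, z)) x
              + f (Function.update X i (z, x)) y) + (g (Function.update X i (x, y)) z
              + g (Function.update X i (y, z)) x + g (Function.update X i (z, x)) y) := by abel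
        _ = 0 := by rw [h₁, h₂, add_zero]
  zero_mem' := by
    refine ⟨fun X a x y => ?_, fun X i z a x x' y => ?_, fun X i z a x y y' => ?_,
      fun X i z x => ?_, fun X i h x y z => ?_⟩ <;> simp
  smul_mem' c f hf := by
    refine ⟨fun X a x y => ?_, fun X i z a x x' y => ?_, fun X i z a x y y' => ?_,
      fun X i z x => ?_, fun X i h x y z => ?_⟩ <;> simp only [Pi.smul_apply]
    · rw [hf.lin_last, smul_add, smul_comm]
    · rw [hf.lin_fst, smul_add, smul_comm]
    · rw [hf.lin_snd, smul_add, smul_comm]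
    · rw [hf.alt, smul_zero]
    · rw [← smul_add, ← smul_add, hf.cyclic X i h, smul_zero]

/-- The space `C^n(V, W)` of `n`-cochains. -/
def Cochain (K V W : Type*) [Field K] [AddCommGroup V] [Module K V] [AddCommGroup W] [Module K W]
    (n : ℕ) : Type _ := ↥(cochainSubmodule K V W n)

instance (n : ℕ) : AddCommGroup (Cochain K V W n) :=
  inferInstanceAs (AddCommGroup (cochainSubmodule K V W n))

instance (n : ℕ) : Module K (Cochain K V W n) :=
  inferInstanceAs (Module K (cochainSubmodule K V W n))

/-- A cochain from a function. -/
def Cochain.mk {n : ℕ} (f : (Fin n → V × V) → V → W) (hf : IsCochain K f) : Cochain K V W n :=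
  ⟨f, hf⟩

theorem Cochain.mk_val {n : ℕ} (f : (Fin n → V × V) → V → W) (hf : IsCochain K f) :
    (Cochain.mk f hf).1 = f := rfl

theorem Cochain.ext {n : ℕ} {f g : Cochain K V W n} (h : ∀ X z, f.1 X z = g.1 X z) : f = g :=
  Subtype.ext (funext fun X => funext fun z => h X z)

theorem Cochain.add_val {n : ℕ} (f g : Cochain K V W n) : (f + g).1 = f.1 + g.1 := rfl

theorem Cochain.smul_val {n : ℕ} (a : K) (f : Cochain K V W n) : (a • f).1 = a • f.1 := rfl

/-- The graded space `C^*(V, W) = ⨁ₙ C^n(V, W)`. -/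
abbrev GradedCochain (K V W : Type*) [Field K] [AddCommGroup V] [Module K V] [AddCommGroup W]
    [Module K W] : Type _ := DirectSum ℕ (Cochain K V W)

/-- The homogeneous components of `C^*(V, W)`, as a `ℤ`-graded space vanishing in negative
degrees. -/
def cochainGrading (K V W : Type*) [Field K] [AddCommGroup V] [Module K V] [AddCommGroup W]
    [Module K W] : ℤ → Submodule K (GradedCochain K V W)
  | Int.ofNat n => LinearMap.range (DirectSum.lof K ℕ (Cochain K V W) n)
  | Int.negSucc _ => ⊥

end Cochains

/-! ### The graded Lie bracket on `C^*(V, V)` -/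

/-- The permutations `σ` of `0, …, p + q - 1` that are `(k, q)`-shuffles of the first `k + q` indices
and fix all the others. -/
def shuffles (p q k : ℕ) : Finset (Perm (Fin (p + q))) :=
  Finset.univ.filter fun σ =>
    (∀ i j : Fin (p + q), i < j → (j : ℕ) < k → σ i < σ j) ∧
    (∀ i j : Fin (p + q), k ≤ (i : ℕ) → i < j → (j : ℕ) < k + q → σ i < σ j) ∧
    ∀ i : Fin (p + q), k + q ≤ (i : ℕ) → σ i = i

section Bracket

variable {K V : Type*} [Field K] [AddCommGroup V] [Module K V]

/-- The pairs `X_{σ(1)}, …, X_{σ(k)}, X_{k+q+1}, …, X_{p+q}` (with `σ` fixing the indices above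
`k + q`). -/
def outer {p q : ℕ} (k : ℕ) (σ : Perm (Fin (p + q))) (X : Fin (p + q) → V × V) : Fin p → V × V :=
  fun j => X (σ ⟨if (j : ℕ) < k then j else j + q, by have := j.2; split_ifs <;> omega⟩)

/-- The pairs `X_{σ(k+1)}, …, X_{σ(k+q)}`. -/
def inner {p q : ℕ} (k : ℕ) (hk : k ≤ p) (σ : Perm (Fin (p + q))) (X : Fin (p + q) → V × V) :
    Fin q → V × V :=
  fun j => X (σ ⟨k + j, by have := j.2; omega⟩)

/-- With `k` counted from `0`, the summand `P(X_{σ(1)}, …, X_{σ(k)}, D x ∧ y + x ∧ D y, …, z)` of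
`P ∘ Q`, where `(x, y) = X_{k+q+1}` and `D = Q(X_{σ(k+1)}, …, X_{σ(k+q)}, ·)`. -/
def circTerm {p q : ℕ} (P : (Fin p → V × V) → V → V) (Q : (Fin q → V × V) → V → V) (k : Fin p)
    (σ : Perm (Fin (p + q))) (X : Fin (p + q) → V × V) (z : V) : V :=
  P (Function.update (outer k σ X) k
      (Q (inner k k.2.le σ X) (outer k σ X k).1, (outer k σ X k).2)) z
  + P (Function.update (outer k σ X) k
      ((outer k σ X k).1, Q (inner k k.2.le σ X) (outer k σ X k).2)) z

/-- The product `P ∘ Q`. -/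
def circFun {p q : ℕ} (P : (Fin p → V × V) → V → V) (Q : (Fin q → V × V) → V → V)
    (X : Fin (p + q) → V × V) (z : V) : V :=
  (∑ k : Fin p, ∑ σ ∈ shuffles p q k,
    ((-1) ^ ((k : ℕ) * q) * (Perm.sign σ : ℤ)) • circTerm P Q k σ X z)
  + ∑ σ ∈ shuffles p q p, ((-1) ^ (p * q) * (Perm.sign σ : ℤ)) •
      P (outer p σ X) (Q (inner p le_rfl σ X) z)


/-- Alternating bilinear functions of a pair of vectors. -/
structure IsAltBilin (K : Type*) {V W : Type*} [Field K] [AddCommGroup V] [Module K V]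
    [AddCommGroup W] [Module K W] (b : V × V → W) : Prop where
  fst : ∀ (a : K) x x' y, b (a • x + x', y) = a • b (x, y) + b (x', y)
  snd : ∀ (a : K) x y y', b (x, a • y + y') = a • b (x, y) + b (x, y')
  alt : ∀ x, b (x, x) = 0

namespace IsAltBilin

variable {W : Type*} [AddCommGroup W] [Module K W]

theorem zero : IsAltBilin K (fun _ : V × V => (0 : W)) := by
  constructor <;> simp

theorem add {b c : V × V → W} (hb : IsAltBilin K b) (hc : IsAltBilin K c) :
    IsAltBilin K (fun v => b v + c v) := by
  refine ⟨fun a x x' y => ?_, fun a x y y' => ?_, fun x => ?_⟩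
  · rw [hb.fst, hc.fst, smul_add]; abel
  · rw [hb.snd, hc.snd, smul_add]; abel
  · rw [hb.alt, hc.alt, add_zero]

theorem sum {ι : Type*} (s : Finset ι) (b : ι → V × V → W) (hb : ∀ i ∈ s, IsAltBilin K (b i)) :
    IsAltBilin K (fun v => ∑ i ∈ s, b i v) := by
  classical
  induction s using Finset.induction_on with
  | empty => simpa using zero
  | insert i s hi ih =>
    simp only [Finset.sum_insert hi]
    exact (hb i (by simp)).add (ih fun j hj => hb j (by simp [hj]))

theorem zsmul (n : ℤ) {b : V × V → W} (hb : IsAltBilin K b) : IsAltBilin K (fun v => n • b v) := by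
  refine ⟨fun a x x' y => ?_, fun a x y y' => ?_, fun x => ?_⟩
  · rw [hb.fst, smul_add, smul_comm]
  · rw [hb.snd, smul_add, smul_comm]
  · rw [hb.alt, smul_zero]

theorem comp {b : V × V → V} (hb : IsAltBilin K b) (g : V → W)
    (hg : ∀ (a : K) x y, g (a • x + y) = a • g x + g y) : IsAltBilin K (fun v => g (b v)) := by
  refine ⟨fun a x x' y => ?_, fun a x y y' => ?_, fun x => ?_⟩
  · rw [hb.fst, hg]
  · rw [hb.snd, hg]
  · rw [hb.alt]; simpa using hg (-1) 0 0

theorem swap {b : V × V → W} (hb : IsAltBilin K b) (x y : V) : b (x, y) + b (y, x) = 0 := by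
  have h := hb.alt (x + y)
  have h₁ := hb.fst 1 x y (x + y)
  have h₂ := hb.snd 1 x x y
  have h₃ := hb.snd 1 y x y
  simp only [one_smul] at h₁ h₂ h₃
  rw [h₁, h₂, h₃, hb.alt, hb.alt] at h
  simpa using h

theorem deriv {b : V × V → W} (hb : IsAltBilin K b) (D : V → V)
    (hD : ∀ (a : K) x y, D (a • x + y) = a • D x + D y) :
    IsAltBilin K (fun v => b (D v.1, v.2) + b (v.1, D v.2)) := by
  refine ⟨fun a x x' y => ?_, fun a x y y' => ?_, fun x => hb.swap _ _⟩
  · simp only [hD, hb.fst, smul_add]; abel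
  · simp only [hD, hb.snd, smul_add]; abel

end IsAltBilin

theorem IsCochain.slot {W : Type*} [AddCommGroup W] [Module K W] {n : ℕ}
    {f : (Fin n → V × V) → V → W} (hf : IsCochain K f) (X : Fin n → V × V) (i : Fin n) (z : V) :
    IsAltBilin K (fun v => f (Function.update X i v) z) :=
  ⟨fun a x x' y => hf.lin_fst X i z a x x' y, fun a x y y' => hf.lin_snd X i z a x y y',
    fun x => hf.alt X i z x⟩

theorem IsCochain.map_zero {W : Type*} [AddCommGroup W] [Module K W] {n : ℕ}
    {f : (Fin n → V × V) → V → W} (hf : IsCochain K f) (X : Fin n → V × V) : f X 0 = 0 := by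
  simpa using hf.lin_last X (-1) 0 0

/-- The position in `0, …, p + q - 1` of the `j`-th entry of `outer`. -/
def outerIdx {p : ℕ} (q k : ℕ) (j : Fin p) : Fin (p + q) :=
  ⟨if (j : ℕ) < k then j else j + q, by have := j.2; split_ifs <;> omega⟩

/-- The position in `0, …, p + q - 1` of the `j`-th entry of `inner`. -/
def innerIdx {p q : ℕ} (k : ℕ) (hk : k ≤ p) (j : Fin q) : Fin (p + q) :=
  ⟨k + j, by have := j.2; omega⟩

theorem exists_idx {p q k : ℕ} (hk : k ≤ p) (i : Fin (p + q)) :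
    (∃ j : Fin p, i = outerIdx q k j) ∨ ∃ j : Fin q, i = innerIdx k hk j := by
  by_cases h₁ : (i : ℕ) < k
  · exact .inl ⟨⟨i, by omega⟩, by ext; simp [outerIdx, h₁]⟩
  · by_cases h₂ : (i : ℕ) < k + q
    · exact .inr ⟨⟨i - k, by omega⟩, by ext; simp [innerIdx]; omega⟩
    · refine .inl ⟨⟨i - q, by omega⟩, ?_⟩
      ext
      have : ¬ ((i : ℕ) - q < k) := by omega
      simp only [outerIdx, this, if_false]
      omega

theorem outerIdx_inj {p q k : ℕ} {i j : Fin p} (h : outerIdx q k i = outerIdx q k j) : i = j := by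
  simp only [outerIdx, Fin.mk.injEq] at h
  ext
  split_ifs at h <;> omega

theorem innerIdx_inj {p q k : ℕ} (hk : k ≤ p) {i j : Fin q}
    (h : innerIdx k hk i = innerIdx k hk j) : i = j := by
  simp only [innerIdx, Fin.mk.injEq] at h
  ext
  omega

theorem outerIdx_ne_innerIdx {p q k : ℕ} (hk : k ≤ p) (i : Fin p) (j : Fin q) :
    outerIdx q k i ≠ innerIdx k hk j := by
  intro h
  simp only [outerIdx, innerIdx, Fin.mk.injEq] at h
  have := j.2
  split_ifs at h <;> omega

section Update

variable {p q k : ℕ} (hk : k ≤ p) (σ : Perm (Fin (p + q))) (X : Fin (p + q) → V × V) (v : V × V)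

theorem outer_update_outer (j : Fin p) :
    outer k σ (Function.update X (σ (outerIdx q k j)) v)
      = Function.update (outer k σ X) j v := by
  funext i
  change Function.update X (σ (outerIdx q k j)) v (σ (outerIdx q k i)) = _
  by_cases h : i = j
  · subst h; simp
  · have : σ (outerIdx q k i) ≠ σ (outerIdx q k j) := fun h' => h (outerIdx_inj (σ.injective h'))
    rw [Function.update_of_ne this, Function.update_of_ne h]; rfl

theorem inner_update_outer (j : Fin p) :
    inner k hk σ (Function.update X (σ (outerIdx q k j)) v) = inner k hk σ X := by
  funext i
  have : σ (innerIdx k hk i) ≠ σ (outerIdx q k j) :=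
    fun h' => outerIdx_ne_innerIdx hk _ _ (σ.injective h').symm
  exact Function.update_of_ne this _ _

theorem outer_update_inner (j : Fin q) :
    outer k σ (Function.update X (σ (innerIdx k hk j)) v) = outer k σ X := by
  funext i
  have : σ (outerIdx q k i) ≠ σ (innerIdx k hk j) :=
    fun h' => outerIdx_ne_innerIdx hk _ _ (σ.injective h')
  exact Function.update_of_ne this _ _

theorem inner_update_inner (j : Fin q) :
    inner k hk σ (Function.update X (σ (innerIdx k hk j)) v)
      = Function.update (inner k hk σ X) j v := by
  funext i
  change Function.update X (σ (innerIdx k hk j)) v (σ (innerIdx k hk i)) = _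
  by_cases h : i = j
  · subst h; simp
  · have : σ (innerIdx k hk i) ≠ σ (innerIdx k hk j) := fun h' => h (innerIdx_inj hk (σ.injective h'))
    rw [Function.update_of_ne this, Function.update_of_ne h]; rfl

end Update

section Closure

variable {p q : ℕ} {P : (Fin p → V × V) → V → V} {Q : (Fin q → V × V) → V → V}

theorem circTerm_slot (hP : IsCochain K P) (hQ : IsCochain K Q) (k : Fin p) (σ : Perm (Fin (p + q)))
    (X : Fin (p + q) → V × V) (i : Fin (p + q)) (z : V) :
    IsAltBilin K (fun v => circTerm P Q k σ (Function.update X i v) z) := by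
  obtain ⟨i, rfl⟩ := σ.surjective i
  obtain ⟨j, rfl⟩ | ⟨j, rfl⟩ := exists_idx k.2.le i
  · simp only [circTerm, outer_update_outer, inner_update_outer]
    by_cases h : j = k
    · subst h
      simp only [Function.update_self, Function.update_idem]
      exact (hP.slot (outer j σ X) j z).deriv _ (hQ.lin_last _)
    · simp only [Function.update_of_ne (Ne.symm h), Function.update_comm h]
      exact (hP.slot _ j z).add (hP.slot _ j z)
  · simp only [circTerm, outer_update_inner, inner_update_inner]
    exact ((hQ.slot (inner k k.2.le σ X) j _).comp
        (fun a => P (Function.update (outer k σ X) k (a, (outer k σ X k).2)) z)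
        (fun a x y => hP.lin_fst _ _ _ a x y _)).add
      ((hQ.slot (inner k k.2.le σ X) j _).comp
        (fun a => P (Function.update (outer k σ X) k ((outer k σ X k).1, a)) z)
        (fun a x y => hP.lin_snd _ _ _ a _ x y))

theorem circLast_slot (hP : IsCochain K P) (hQ : IsCochain K Q) (σ : Perm (Fin (p + q)))
    (X : Fin (p + q) → V × V) (i : Fin (p + q)) (z : V) :
    IsAltBilin K (fun v => P (outer p σ (Function.update X i v))
      (Q (inner p le_rfl σ (Function.update X i v)) z)) := by
  obtain ⟨i, rfl⟩ := σ.surjective i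
  obtain ⟨j, rfl⟩ | ⟨j, rfl⟩ := exists_idx le_rfl i
  · simp only [outer_update_outer, inner_update_outer]
    exact hP.slot _ j _
  · simp only [outer_update_inner, inner_update_inner]
    exact (hQ.slot _ j z).comp _ (hP.lin_last _)

theorem circFun_slot (hP : IsCochain K P) (hQ : IsCochain K Q)
    (X : Fin (p + q) → V × V) (i : Fin (p + q)) (z : V) :
    IsAltBilin K (fun v => circFun P Q (Function.update X i v) z) :=
  (IsAltBilin.sum _ _ fun k _ => IsAltBilin.sum _ _ fun σ _ =>
    (circTerm_slot hP hQ k σ X i z).zsmul _).add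
  (IsAltBilin.sum _ _ fun σ _ => (circLast_slot hP hQ σ X i z).zsmul _)

theorem circFun_lin_last (hP : IsCochain K P) (hQ : IsCochain K Q)
    (X : Fin (p + q) → V × V) (a : K) (x y : V) :
    circFun P Q X (a • x + y) = a • circFun P Q X x + circFun P Q X y := by
  have h₁ : ∀ (k : Fin p) σ, circTerm P Q k σ X (a • x + y)
      = a • circTerm P Q k σ X x + circTerm P Q k σ X y := fun k σ => by
    simp only [circTerm, hP.lin_last, smul_add]; abel
  have h₂ : ∀ σ : Perm (Fin (p + q)), P (outer p σ X) (Q (inner p le_rfl σ X) (a • x + y))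
      = a • P (outer p σ X) (Q (inner p le_rfl σ X) x)
        + P (outer p σ X) (Q (inner p le_rfl σ X) y) := fun σ => by
    rw [hQ.lin_last, hP.lin_last]
  simp only [circFun, h₁, h₂, smul_add, Finset.sum_add_distrib, Finset.smul_sum,
    smul_comm a (_ : ℤ)]
  abel

end Closure

section Cyclic

variable {p q : ℕ} {P : (Fin p → V × V) → V → V} {Q : (Fin q → V × V) → V → V}

theorem mem_shuffles {k : ℕ} {σ : Perm (Fin (p + q))} : σ ∈ shuffles p q k ↔
    (∀ i j : Fin (p + q), i < j → (j : ℕ) < k → σ i < σ j) ∧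
    (∀ i j : Fin (p + q), k ≤ (i : ℕ) → i < j → (j : ℕ) < k + q → σ i < σ j) ∧
    ∀ i : Fin (p + q), k + q ≤ (i : ℕ) → σ i = i := by
  simp [shuffles]

/-- The cyclic sum of `F` vanishes. -/
def IsCyc (F : V × V → V → V) : Prop := ∀ x y z, F (x, y) z + F (y, z) x + F (z, x) y = 0

theorem IsCyc.add {F G : V × V → V → V} (hF : IsCyc F) (hG : IsCyc G) :
    IsCyc (fun v z => F v z + G v z) := fun x y z => by
  calc (F (x, y) z + G (x, y) z) + (F (y, z) x + G (y, z) x) + (F (z, x) y + G (z, x) y)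
      = (F (x, y) z + F (y, z) x + F (z, x) y)
        + (G (x, y) z + G (y, z) x + G (z, x) y) := by abel
    _ = 0 := by rw [hF, hG, add_zero]

theorem IsCyc.zsmul {F : V × V → V → V} (n : ℤ) (hF : IsCyc F) :
    IsCyc (fun v z => n • F v z) := fun x y z => by
  simp only [← smul_add, hF x y z, smul_zero]

theorem IsCyc.sum {ι : Type*} (s : Finset ι) (F : ι → V × V → V → V)
    (hF : ∀ i ∈ s, IsCyc (F i)) : IsCyc (fun v z => ∑ i ∈ s, F i v z) := fun x y z => by
  simp only [← Finset.sum_add_distrib]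
  exact Finset.sum_eq_zero fun i hi => hF i hi x y z

theorem IsCochain.isCyc {n : ℕ} {f : (Fin n → V × V) → V → V} (hf : IsCochain K f)
    (X : Fin n → V × V) (i : Fin n) (hi : (i : ℕ) + 1 = n) :
    IsCyc (fun v z => f (Function.update X i v) z) := hf.cyclic X i hi

theorem circTerm_cyc (hP : IsCochain K P) (k : Fin p) (hk : (k : ℕ) + 1 < p)
    {σ : Perm (Fin (p + q))} (hσ : σ ∈ shuffles p q k) (X : Fin (p + q) → V × V)
    (l : Fin (p + q)) (hl : (l : ℕ) + 1 = p + q) :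
    IsCyc (fun v z => circTerm P Q k σ (Function.update X l v) z) := by
  have hl' : l = σ (outerIdx q k ⟨p - 1, by omega⟩) := by
    have : l = outerIdx q k ⟨p - 1, by omega⟩ := by
      have : ¬ (p - 1 < (k : ℕ)) := by omega
      ext
      simp only [outerIdx, this, if_false]
      omega
    rw [← this, (mem_shuffles.1 hσ).2.2 l (by omega)]
  have hne : (⟨p - 1, by omega⟩ : Fin p) ≠ k := by
    intro h
    have := congrArg Fin.val h
    simp only at this
    omega
  rw [hl']
  simp only [circTerm, outer_update_outer, inner_update_outer,
    Function.update_of_ne (Ne.symm hne), Function.update_comm hne]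
  exact (hP.isCyc _ _ (by simp only; omega)).add (hP.isCyc _ _ (by simp only; omega))

theorem circLast_cyc_of_inner (hP : IsCochain K P) (hQ : IsCochain K Q)
    {σ : Perm (Fin (p + q))} (hσ : σ ∈ shuffles p q p) (X : Fin (p + q) → V × V)
    (l : Fin (p + q)) (hl : (l : ℕ) + 1 = p + q) (h : ∃ j : Fin q, l = σ (innerIdx p le_rfl j)) :
    IsCyc (fun v z => P (outer p σ (Function.update X l v))
      (Q (inner p le_rfl σ (Function.update X l v)) z)) := by
  obtain ⟨j, hj⟩ := h
  have hjq : (j : ℕ) + 1 = q := by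
    by_contra hne
    have h₁ := (mem_shuffles.1 hσ).2.1 (innerIdx p le_rfl j)
      (innerIdx p le_rfl ⟨j + 1, by have := j.2; omega⟩) (by simp [innerIdx])
      (by simp [innerIdx, Fin.lt_def]) (by have := j.2; simp [innerIdx]; omega)
    rw [← hj, Fin.lt_def] at h₁
    omega
  rw [hj]
  simp only [outer_update_inner, inner_update_inner]
  intro x y z
  have key := hQ.cyclic (inner p le_rfl σ X) j hjq x y z
  have add : ∀ a b, P (outer p σ X) a + P (outer p σ X) b = P (outer p σ X) (a + b) := fun a b => by
    simpa using (hP.lin_last (outer p σ X) 1 a b).symm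
  simp only [add, key, hP.map_zero]

/-- The cycle `m → m + 1 → ⋯ → m + q → m` of the last indices. -/
def rot (m q : ℕ) : Perm (Fin (m + 1 + q)) :=
  Fin.cycleIcc ⟨m, by omega⟩ ⟨m + q, by omega⟩

theorem rot_lt {m q : ℕ} {i : Fin (m + 1 + q)} (h : (i : ℕ) < m) : rot m q i = i :=
  Fin.cycleIcc_of_lt (Fin.lt_def.2 h)

theorem rot_mid {m q : ℕ} {i : Fin (m + 1 + q)} (h : m ≤ (i : ℕ)) (h' : (i : ℕ) < m + q) :
    (rot m q i : ℕ) = i + 1 := by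
  have : NeZero (m + 1 + q) := ⟨by omega⟩
  rw [rot, Fin.cycleIcc_of_ge_of_lt (Fin.le_def.2 h) (Fin.lt_def.2 h')]
  rw [Fin.val_add, Fin.val_one']
  rw [Nat.mod_eq_of_lt (a := 1) (by omega), Nat.mod_eq_of_lt (by omega)]

theorem rot_last {m q : ℕ} {i : Fin (m + 1 + q)} (h : (i : ℕ) = m + q) :
    (rot m q i : ℕ) = m := by
  have : NeZero (m + 1 + q) := ⟨by omega⟩
  have : i = ⟨m + q, by omega⟩ := Fin.ext h
  rw [this, rot, Fin.cycleIcc_of_last (Fin.le_def.2 (by simp))]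

theorem sign_rot (m q : ℕ) : Perm.sign (rot m q) = (-1) ^ q := by
  rw [rot, Fin.sign_cycleIcc_of_le (Fin.le_def.2 (by simp))]
  simp

theorem rot_val {m q : ℕ} (i : Fin (m + 1 + q)) : (rot m q i : ℕ) =
    if (i : ℕ) < m then (i : ℕ) else if (i : ℕ) < m + q then i + 1 else m := by
  split_ifs with h₁ h₂
  · rw [rot_lt h₁]
  · exact rot_mid (by omega) h₂
  · exact rot_last (by omega)

theorem outer_rot {m q : ℕ} (σ : Perm (Fin (m + 1 + q))) (X : Fin (m + 1 + q) → V × V) :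
    outer (p := m + 1) m (σ * rot m q) X = outer (p := m + 1) (m + 1) σ X := by
  funext j
  have hj := j.2
  change X (σ (rot m q (outerIdx q m j))) = X (σ (outerIdx q (m + 1) j))
  congr 2
  ext
  rw [rot_val]
  simp only [outerIdx]
  split_ifs <;> omega

theorem inner_rot {m q : ℕ} (σ : Perm (Fin (m + 1 + q))) (X : Fin (m + 1 + q) → V × V) :
    inner (p := m + 1) m (Nat.le_succ m) (σ * rot m q) X
      = inner (p := m + 1) (m + 1) le_rfl σ X := by
  funext j
  have hj := j.2
  change X (σ (rot m q (innerIdx m (Nat.le_succ m) j))) = X (σ (innerIdx (m + 1) le_rfl j))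
  congr 2
  ext
  rw [rot_val]
  have h₁ : ¬ (m + (j : ℕ) < m) := by omega
  have h₂ : m + (j : ℕ) < m + q := by omega
  simp only [innerIdx, h₁, h₂, if_true, if_false]
  omega

theorem mul_rot_mem {m q : ℕ} {σ : Perm (Fin (m + 1 + q))} {l : Fin (m + 1 + q)}
    (hl : (l : ℕ) + 1 = m + 1 + q) :
    (σ ∈ shuffles (m + 1) q (m + 1) ∧ σ ⟨m, by omega⟩ = l)
      ↔ σ * rot m q ∈ shuffles (m + 1) q m := by
  simp only [mem_shuffles, Perm.mul_apply]
  have hrl : rot m q l = ⟨m, by omega⟩ := Fin.ext (rot_last (by omega))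
  constructor
  · rintro ⟨⟨h₁, h₂, -⟩, h₄⟩
    refine ⟨fun i j hij hj => ?_, fun i j hi hij hj => ?_, fun i hi => ?_⟩
    · rw [Fin.lt_def] at hij
      rw [rot_lt hj, rot_lt (by omega)]
      exact h₁ i j hij (by omega)
    · have hij' := Fin.lt_def.1 hij
      refine h₂ _ _ ?_ (Fin.lt_def.2 ?_) ?_ <;> simp only [rot_val] <;> split_ifs <;> omega
    · have : i = l := Fin.ext (by omega)
      rw [this, hrl, h₄]
  · rintro ⟨h₁, h₂, h₃⟩
    have h₄ : σ ⟨m, by omega⟩ = l := by rw [← hrl, h₃ l (by omega)]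
    refine ⟨⟨fun i j hij hj => ?_, fun i j hi hij hj => ?_, fun i hi => ?_⟩, h₄⟩
    · have hij' := Fin.lt_def.1 hij
      by_cases hjm : (j : ℕ) < m
      · have := h₁ i j hij hjm
        rwa [rot_lt hjm, rot_lt (by omega)] at this
      · have hj' : j = ⟨m, by omega⟩ := Fin.ext (by simp only; omega)
        rw [hj', h₄]
        have hne : σ i ≠ l := by
          rw [← h₄]
          intro h
          have := congrArg Fin.val (σ.injective h)
          simp only at this
          omega
        have := (σ i).2
        rw [Fin.lt_def]
        have : (σ i : ℕ) ≠ l := fun h => hne (Fin.ext h)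
        omega
    · have hij' := Fin.lt_def.1 hij
      have e : ∀ a : Fin (m + 1 + q), m + 1 ≤ (a : ℕ) →
          rot m q ⟨a - 1, by have := a.2; omega⟩ = a := fun a ha => by
        ext
        have := a.2
        rw [rot_val]
        simp only
        split_ifs <;> omega
      have := h₂ ⟨i - 1, by have := i.2; omega⟩ ⟨j - 1, by have := j.2; omega⟩
        (by simp only; omega) (Fin.lt_def.2 (by simp only; omega)) (by simp only; omega)
      rwa [e i hi, e j (by omega)] at this
    · have := i.2
      omega

theorem circFun_cyc (hP : IsCochain K P) (hQ : IsCochain K Q) (X : Fin (p + q) → V × V)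
    (l : Fin (p + q)) (hl : (l : ℕ) + 1 = p + q) :
    IsCyc (fun v z => circFun P Q (Function.update X l v) z) := by
  cases p with
  | zero =>
    simp only [circFun, Finset.univ_eq_empty, Finset.sum_empty, zero_add]
    refine IsCyc.sum _ _ fun σ hσ => IsCyc.zsmul _
      (circLast_cyc_of_inner hP hQ hσ X l hl ?_)
    obtain ⟨i, hi⟩ := σ.surjective l
    obtain ⟨j, -⟩ | ⟨j, hj⟩ := exists_idx (p := 0) (k := 0) le_rfl i
    · exact j.elim0
    · exact ⟨j, by rw [← hi, hj]⟩
  | succ m =>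
    have split : ∀ Y z, circFun P Q Y z =
        (∑ k : Fin m, ∑ σ ∈ shuffles (m + 1) q k.castSucc,
          ((-1) ^ ((k : ℕ) * q) * (Perm.sign σ : ℤ)) • circTerm P Q k.castSucc σ Y z)
        + ((∑ σ ∈ shuffles (m + 1) q m, ((-1) ^ (m * q) * (Perm.sign σ : ℤ)) •
            (circTerm P Q (Fin.last m) σ Y z + P (outer m σ Y) (Q (inner m (Nat.le_succ m) σ Y) z)))
        + ∑ σ ∈ (shuffles (m + 1) q (m + 1)).filter (fun σ => ¬ σ ⟨m, by omega⟩ = l),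
            ((-1) ^ ((m + 1) * q) * (Perm.sign σ : ℤ)) •
              P (outer (m + 1) σ Y) (Q (inner (m + 1) le_rfl σ Y) z)) := by
      intro Y z
      have hbij : ∑ σ ∈ (shuffles (m + 1) q (m + 1)).filter (fun σ => σ ⟨m, by omega⟩ = l),
            ((-1) ^ ((m + 1) * q) * (Perm.sign σ : ℤ)) •
              P (outer (m + 1) σ Y) (Q (inner (m + 1) le_rfl σ Y) z)
          = ∑ σ ∈ shuffles (m + 1) q m, ((-1) ^ (m * q) * (Perm.sign σ : ℤ)) •
              P (outer m σ Y) (Q (inner m (Nat.le_succ m) σ Y) z) := by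
        refine Finset.sum_bij' (fun σ _ => σ * rot m q) (fun τ _ => τ * (rot m q)⁻¹)
          ?_ ?_ ?_ ?_ ?_
        · intro σ hσ
          exact (mul_rot_mem hl).1 (Finset.mem_filter.1 hσ)
        · intro τ hτ
          exact Finset.mem_filter.2 ((mul_rot_mem hl).2 (by simpa using hτ))
        · intro σ _; simp
        · intro τ _; simp
        · intro σ _
          rw [outer_rot, inner_rot]
          congr 1
          rw [Perm.sign_mul, sign_rot]
          push_cast
          have : ((-1 : ℤ) ^ q) * (-1) ^ q = 1 := by rw [← mul_pow]; simp
          ring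
      rw [circFun, Fin.sum_univ_castSucc, ← Finset.sum_filter_add_sum_filter_not
        (shuffles (m + 1) q (m + 1)) (fun σ => σ ⟨m, by omega⟩ = l), hbij]
      simp only [smul_add, Finset.sum_add_distrib, Fin.val_castSucc, Fin.val_last]
      abel
    simp only [split]
    refine IsCyc.add (IsCyc.sum _ _ fun k _ => IsCyc.sum _ _ fun σ hσ => IsCyc.zsmul _
      (circTerm_cyc hP _ (by simp) hσ X l hl)) (IsCyc.add (IsCyc.sum _ _ fun σ hσ =>
        IsCyc.zsmul _ ?_) (IsCyc.sum _ _ fun σ hσ => IsCyc.zsmul _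
          (circLast_cyc_of_inner hP hQ (Finset.mem_filter.1 hσ).1 X l hl ?_)))
    · have hl' : l = σ (outerIdx q m (Fin.last m)) := by
        have : l = outerIdx q m (Fin.last m) := by
          ext
          simp only [outerIdx, Fin.val_last, lt_irrefl, if_false]
          omega
        rw [← this, (mem_shuffles.1 hσ).2.2 l (by omega)]
      rw [hl']
      simp only [circTerm, outer_update_outer, inner_update_outer, Fin.val_last]
      intro x y z
      simp only [Function.update_self, Function.update_idem]
      set A := outer (p := m + 1) m σ X
      set D := Q (inner (p := m + 1) m (Nat.le_succ m) σ X)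
      have c := hP.cyclic A (Fin.last m) (by simp)
      have c₁ := c (D x) y z
      have c₂ := c x (D y) z
      have c₃ := c x y (D z)
      calc _ = (P (Function.update A (Fin.last m) (D x, y)) z
              + P (Function.update A (Fin.last m) (y, z)) (D x)
              + P (Function.update A (Fin.last m) (z, D x)) y)
            + (P (Function.update A (Fin.last m) (x, D y)) z
              + P (Function.update A (Fin.last m) (D y, z)) x
              + P (Function.update A (Fin.last m) (z, x)) (D y))
            + (P (Function.update A (Fin.last m) (x, y)) (D z)
              + P (Function.update A (Fin.last m) (y, D z)) x
              + P (Function.update A (Fin.last m) (D z, x)) y) := by abel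
        _ = 0 := by rw [c₁, c₂, c₃]; simp
    · obtain ⟨hσ, hne⟩ := Finset.mem_filter.1 hσ
      obtain ⟨i, hi⟩ := σ.surjective l
      obtain ⟨j, hj⟩ | ⟨j, hj⟩ := exists_idx (k := m + 1) le_rfl i
      · exfalso
        have hjm : (j : ℕ) < m := by
          have := j.2
          by_contra h
          apply hne
          rw [← hi, hj]
          congr 1
          ext
          simp only [outerIdx]
          split_ifs
          omega
        have := (mem_shuffles.1 hσ).1 i ⟨m, by omega⟩
          (by rw [hj, Fin.lt_def]; simp only [outerIdx]; split_ifs <;> omega) (by simp)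
        rw [hi, Fin.lt_def] at this
        have := (σ ⟨m, by omega⟩).2
        omega
      · exact ⟨j, by rw [← hi, hj]⟩

end Cyclic

theorem circFun_isCochain {p q : ℕ} {P : (Fin p → V × V) → V → V} {Q : (Fin q → V × V) → V → V}
    (hP : IsCochain K P) (hQ : IsCochain K Q) : IsCochain K (circFun P Q) :=
  ⟨circFun_lin_last hP hQ, fun X i z a x x' y => (circFun_slot hP hQ X i z).fst a x x' y,
    fun X i z a x y y' => (circFun_slot hP hQ X i z).snd a x y y',
    fun X i z x => (circFun_slot hP hQ X i z).alt x,
    fun X i hi x y z => circFun_cyc hP hQ X i hi x y z⟩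

theorem circFun_lin_left {p q : ℕ} (a : K) (P P' : (Fin p → V × V) → V → V)
    (Q : (Fin q → V × V) → V → V) :
    circFun (a • P + P') Q = a • circFun P Q + circFun P' Q := by
  funext X z
  simp only [circFun, circTerm, Pi.add_apply, Pi.smul_apply, smul_add, Finset.sum_add_distrib,
    Finset.smul_sum, smul_comm a (_ : ℤ)]
  abel

theorem circFun_lin_right {p q : ℕ} (a : K) {P : (Fin p → V × V) → V → V} (hP : IsCochain K P)
    (Q Q' : (Fin q → V × V) → V → V) :
    circFun P (a • Q + Q') = a • circFun P Q + circFun P Q' := by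
  funext X z
  simp only [circFun, circTerm, Pi.add_apply, Pi.smul_apply, smul_add, Finset.sum_add_distrib,
    Finset.smul_sum, smul_comm a (_ : ℤ), hP.lin_fst, hP.lin_snd, hP.lin_last]
  abel

/-- The product `∘ : C^p(V, V) × C^q(V, V) → C^{p+q}(V, V)`. -/
def circ (p q : ℕ) : Cochain K V V p →ₗ[K] Cochain K V V q →ₗ[K] Cochain K V V (p + q) :=
  LinearMap.mk₂ K (fun P Q => Cochain.mk (circFun P.1 Q.1) (circFun_isCochain P.2 Q.2))
    (fun P P' Q => Subtype.ext (by simpa [Cochain.mk_val, Cochain.add_val] using circFun_lin_left (1 : K) P.1 P'.1 Q.1))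
    (fun a P Q => Subtype.ext (by
      have h := circFun_lin_left a P.1 0 Q.1
      have h₀ : circFun (0 : (Fin p → V × V) → V → V) Q.1 = 0 := by
        simpa using circFun_lin_left (-1 : K) 0 0 Q.1
      rw [h₀] at h
      simpa [Cochain.mk_val, Cochain.smul_val] using h))
    (fun P Q Q' => Subtype.ext (by simpa [Cochain.mk_val, Cochain.add_val] using circFun_lin_right (1 : K) P.2 Q.1 Q'.1))
    (fun a P Q => Subtype.ext (by
      have h := circFun_lin_right a P.2 Q.1 0
      have h₀ : circFun P.1 (0 : (Fin q → V × V) → V → V) = 0 := by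
        simpa using circFun_lin_right (-1 : K) P.2 0 0
      rw [h₀] at h
      simpa [Cochain.mk_val, Cochain.smul_val] using h))

/-- The bracket `[P, Q] = P ∘ Q - (-1)^{pq} Q ∘ P` of homogeneous elements. -/
def bracketHom (p q : ℕ) : Cochain K V V p →ₗ[K] Cochain K V V q →ₗ[K] GradedCochain K V V :=
  (circ p q).compr₂ (DirectSum.lof K ℕ (Cochain K V V) (p + q))
    - ((-1 : ℤ) ^ (p * q)) •
      ((circ q p).compr₂ (DirectSum.lof K ℕ (Cochain K V V) (q + p))).flip

/-- The graded Lie bracket on `C^*(V, V)`. -/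
def bracket : GradedCochain K V V →ₗ[K] GradedCochain K V V →ₗ[K] GradedCochain K V V :=
  DirectSum.toModule K ℕ _ fun p =>
    (DirectSum.toModule K ℕ _ fun q => (bracketHom p q).flip).flip

theorem bracket_lof {p q : ℕ} (P : Cochain K V V p) (Q : Cochain K V V q) :
    bracket (DirectSum.lof K ℕ (Cochain K V V) p P)
      (DirectSum.lof K ℕ (Cochain K V V) q Q)
    = DirectSum.lof K ℕ (Cochain K V V) (p + q) (circ p q P Q)
      - ((-1 : ℤ) ^ (p * q)) •
        DirectSum.lof K ℕ (Cochain K V V) (q + p) (circ q p Q P) := by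
  simp [bracket, bracketHom]

end Bracket

/-! ### The brackets on `C^*(M, L)` -/

section Derived

variable {K L M : Type*} [Field K] [AddCommGroup L] [Module K L] [AddCommGroup M] [Module K M]

/-- Extension by zero `C^n(M, L) → C^n(L ⊕ M, L ⊕ M)`. -/
def inclHom (n : ℕ) : Cochain K M L n →ₗ[K] Cochain K (L × M) (L × M) n where
  toFun f := Cochain.mk (fun X z => (f.1 (fun i => ((X i).1.2, (X i).2.2)) z.2, 0)) (by
    have e : ∀ (X : Fin n → (L × M) × (L × M)) i x y,
        (fun j => ((Function.update X i (x, y) j).1.2, (Function.update X i (x, y) j).2.2))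
          = Function.update (fun j => ((X j).1.2, (X j).2.2)) i (x.2, y.2) := by
      intro X i x y
      funext j
      by_cases h : j = i
      · subst h; simp
      · simp [Function.update_of_ne h]
    have hf := f.2
    refine ⟨fun X a x y => ?_, fun X i z a x x' y => ?_, fun X i z a x y y' => ?_,
      fun X i z x => ?_, fun X i h x y z => ?_⟩
    · simp [hf.lin_last]
    · simp [e, hf.lin_fst]
    · simp [e, hf.lin_snd]
    · simp [e, hf.alt]
    · simp only [e]
      simp [hf.cyclic _ i h])
  map_add' f g := Cochain.ext fun X z => by simp [Cochain.mk_val, Cochain.add_val]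
  map_smul' a f := Cochain.ext fun X z => by simp [Cochain.mk_val, Cochain.smul_val]

/-- The component `C^n(L ⊕ M, L ⊕ M) → C^n(M, L)`. -/
def projHom (n : ℕ) : Cochain K (L × M) (L × M) n →ₗ[K] Cochain K M L n where
  toFun f := Cochain.mk (fun X z => (f.1 (fun i => ((0, (X i).1), (0, (X i).2))) (0, z)).1) (by
    have e : ∀ (X : Fin n → M × M) i x y,
        (fun j => (((0 : L), (Function.update X i (x, y) j).1),
          ((0 : L), (Function.update X i (x, y) j).2)))
          = Function.update (fun j => ((0, (X j).1), (0, (X j).2))) i ((0, x), (0, y)) := by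
      intro X i x y
      funext j
      by_cases h : j = i
      · subst h; simp
      · simp [Function.update_of_ne h]
    have e' : ∀ (a : K) (x y : M), ((0 : L), a • x + y) = a • (0, x) + (0, y) := by simp
    have hf := f.2
    refine ⟨fun X a x y => ?_, fun X i z a x x' y => ?_, fun X i z a x y y' => ?_,
      fun X i z x => ?_, fun X i h x y z => ?_⟩
    · simp only [e', hf.lin_last]; rfl
    · simp only [e, e', hf.lin_fst]; rfl
    · simp only [e, e', hf.lin_snd]; rfl
    · simp only [e, hf.alt]; rfl
    · simp only [e]
      exact congrArg Prod.fst (hf.cyclic _ i h (0, x) (0, y) (0, z)))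
  map_add' f g := Cochain.ext fun X z => by simp [Cochain.mk_val, Cochain.add_val]
  map_smul' a f := Cochain.ext fun X z => by simp [Cochain.mk_val, Cochain.smul_val]

/-- The inclusion `C^*(M, L) → C^*(L ⊕ M, L ⊕ M)`. -/
def incl : GradedCochain K M L →ₗ[K] GradedCochain K (L × M) (L × M) :=
  DirectSum.lmap fun n => inclHom n

/-- The projection `C^*(L ⊕ M, L ⊕ M) → C^*(M, L)`. -/
def proj : GradedCochain K (L × M) (L × M) →ₗ[K] GradedCochain K M L :=
  DirectSum.lmap fun n => projHom n

/-- A trilinear map on `V` with the two symmetries, as an element of `C^1(V, V)`. -/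
def ofTrilinear {V : Type*} [AddCommGroup V] [Module K V] (t : V → V → V → V)
    (h₁ : ∀ (a : K) x x' y z, t (a • x + x') y z = a • t x y z + t x' y z)
    (h₂ : ∀ (a : K) x y y' z, t x (a • y + y') z = a • t x y z + t x y' z)
    (h₃ : ∀ (a : K) x y z z', t x y (a • z + z') = a • t x y z + t x y z')
    (alt : ∀ x z, t x x z = 0) (cyc : ∀ x y z, t x y z + t y z x + t z x y = 0) :
    Cochain K V V 1 :=
  Cochain.mk (fun X z => t (X 0).1 (X 0).2 z) (by
    refine ⟨fun X a x y => h₃ _ _ _ _ _, fun X i z a x x' y => ?_, fun X i z a x y y' => ?_,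
      fun X i z x => ?_, fun X i h x y z => ?_⟩ <;>
      obtain rfl : i = 0 := Subsingleton.elim _ _
    · simp [h₁]
    · simp [h₂]
    · simp [alt]
    · simpa using cyc x y z)

variable {S : LieTripleSystem K L}

/-- `π + θ ∈ C^1(L ⊕ M, L ⊕ M)`:
`(x + u, y + v, z + w) ↦ [x, y, z] + θ(y, z)u - θ(x, z)v + D(x, y)w`. -/
def semidirect (ρ : Representation M S) : Cochain K (L × M) (L × M) 1 :=
  ofTrilinear (fun a b c => (S.bracket a.1 b.1 c.1,
      ρ.θ b.1 c.1 a.2 - ρ.θ a.1 c.1 b.2 + ρ.D a.1 b.1 c.2))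
    (fun a x x' y z => by ext <;> simp [smul_sub] ; abel)
    (fun a x y y' z => by ext <;> simp [smul_sub] ; abel)
    (fun a x y z z' => by ext <;> simp [smul_sub] ; abel)
    (fun x z => by ext <;> simp [S.alt, Representation.D])
    (fun x y z => by
      ext
      · simp [S.cyclic]
      · simp [Representation.D]; abel)

/-- `H`, as an element of `C^1(L ⊕ M, L ⊕ M)`. -/
def ThreeCocycle.toCochain {ρ : Representation M S} (ω : ThreeCocycle ρ) :
    Cochain K (L × M) (L × M) 1 :=
  ofTrilinear (fun a b c => (0, ω.H a.1 b.1 c.1))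
    (fun a x x' y z => by ext <;> simp)
    (fun a x y y' z => by ext <;> simp)
    (fun a x y z z' => by ext <;> simp)
    (fun x z => by ext <;> simp [ω.alt])
    (fun x y z => by ext <;> simp [ω.cyclic])

/-- `l₃(P, Q, R) = [[[π + θ, P], Q], R]`. -/
def l₃ (ρ : Representation M S) :
    MultilinearMap K (fun _ : Fin 3 => GradedCochain K M L) (GradedCochain K M L) :=
  MultilinearMap.mk' (fun P => proj (bracket (bracket (bracket
      (DirectSum.lof K ℕ (Cochain K (L × M) (L × M)) 1 (semidirect ρ))
      (incl (P 0))) (incl (P 1))) (incl (P 2))))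
    (fun P i x y => by fin_cases i <;> simp [Function.update])
    (fun P i a x => by fin_cases i <;> simp [Function.update])

/-- `l₄(P, Q, R, S) = [[[[H, P], Q], R], S]`. -/
def l₄ {ρ : Representation M S} (ω : ThreeCocycle ρ) :
    MultilinearMap K (fun _ : Fin 4 => GradedCochain K M L) (GradedCochain K M L) :=
  MultilinearMap.mk' (fun P => proj (bracket (bracket (bracket (bracket
      (DirectSum.lof K ℕ (Cochain K (L × M) (L × M)) 1 ω.toCochain)
      (incl (P 0))) (incl (P 1))) (incl (P 2))) (incl (P 3))))
    (fun P i x y => by fin_cases i <;> simp [Function.update])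
    (fun P i a x => by fin_cases i <;> simp [Function.update])

/-- The structure maps of the `L_∞`-algebra `C^*(M, L)`: `l₃`, `l₄`, and zero in the other
arities. -/
def structureMaps {ρ : Representation M S} (ω : ThreeCocycle ρ) : ∀ k : ℕ,
    MultilinearMap K (fun _ : Fin k => GradedCochain K M L) (GradedCochain K M L)
  | 3 => l₃ ρ
  | 4 => l₄ ω
  | _ => 0

/-- A linear map `M → L` as an element of `C^0(M, L)`. -/
def ofLinear (T : M →ₗ[K] L) : Cochain K M L 0 :=
  Cochain.mk (fun _ z => T z) ⟨fun _ a x y => by simp, fun _ i => i.elim0, fun _ i => i.elim0,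
    fun _ i => i.elim0, fun _ i => i.elim0⟩

/-- A linear map `M → L` as a degree `0` element of `C^*(M, L)`. -/
def ofHom (T : M →ₗ[K] L) : GradedCochain K M L :=
  DirectSum.lof K ℕ (Cochain K M L) 0 (ofLinear T)

end Derived

/-! ### `L_∞`-algebras -/

section LInfinity

variable {K G : Type*} [Field K] [AddCommGroup G] [Module K G]

/-- The Koszul sign `ε(σ)` of the rearrangement `x_{σ(1)}, …, x_{σ(n)}` of homogeneous elements
`x₁, …, xₙ` of degrees `d₁, …, dₙ`. -/
def koszulSign {n : ℕ} (d : Fin n → ℤ) (σ : Perm (Fin n)) : ℤˣ :=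
  ∏ i : Fin n, ∏ j : Fin n,
    if i < j ∧ σ j < σ i then Int.negOnePow (d (σ i) * d (σ j)) else 1

/-- The `(i, n - i)`-shuffles. -/
def jacobiShuffles (n i : ℕ) : Finset (Perm (Fin n)) :=
  Finset.univ.filter fun σ =>
    (∀ a b : Fin n, a < b → (b : ℕ) < i → σ a < σ b) ∧
    (∀ a b : Fin n, i ≤ (a : ℕ) → a < b → σ a < σ b)

/-- The maps `l k` (`k ≥ 1`) form an `L_∞`-algebra structure, in the convention with graded symmetric
structure maps of degree `1`, on the `ℤ`-graded vector space `G = ⨁ 𝒢 n`. (The value `l 0` plays no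
role.) -/
structure IsLInfinity (𝒢 : ℤ → Submodule K G) (l : ∀ k : ℕ, MultilinearMap K (fun _ : Fin k => G) G) :
    Prop where
  graded : DirectSum.IsInternal 𝒢
  degree : ∀ n, 1 ≤ n → ∀ (d : Fin n → ℤ) (x : Fin n → G), (∀ i, x i ∈ 𝒢 (d i)) →
    l n x ∈ 𝒢 (∑ i, d i + 1)
  symm : ∀ n, 1 ≤ n → ∀ (d : Fin n → ℤ) (x : Fin n → G), (∀ i, x i ∈ 𝒢 (d i)) →
    ∀ σ : Perm (Fin n), l n (fun i => x (σ i)) = koszulSign d σ • l n x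
  jacobi : ∀ n, 1 ≤ n → ∀ (d : Fin n → ℤ) (x : Fin n → G), (∀ i, x i ∈ 𝒢 (d i)) →
    ∑ i : Fin n, ∑ σ ∈ jacobiShuffles n (i + 1), koszulSign d σ •
      l (n - (i + 1) + 1) (Fin.cons
        (l (i + 1) fun a => x (σ ⟨a, by have := a.2; have := i.2; omega⟩))
        fun b : Fin (n - (i + 1)) => x (σ ⟨i + 1 + b, by have := b.2; omega⟩)) = 0

/-- `π` is a Maurer–Cartan element: it has degree `0` and `∑_{n ≥ 1} (1/n!) l_n(π, …, π) = 0`, the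
sum having only finitely many nonzero terms. -/
def IsMaurerCartan (𝒢 : ℤ → Submodule K G) (l : ∀ k : ℕ, MultilinearMap K (fun _ : Fin k => G) G)
    (π : G) : Prop :=
  π ∈ 𝒢 0 ∧ {n : ℕ | l (n + 1) (fun _ => π) ≠ 0}.Finite ∧
    ∑ᶠ n : ℕ, ((n + 1).factorial : K)⁻¹ • l (n + 1) (fun _ => π) = 0

/-- The twisted maps `l_k^π(x₁, …, x_k) = ∑_{n ≥ 0} (1/n!) l_{n+k}(π, …, π, x₁, …, x_k)`, with `n`
copies of `π` (a finite sum if almost all of the `l_k` vanish). -/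
noncomputable def twist (l : ∀ k : ℕ, MultilinearMap K (fun _ : Fin k => G) G) (π : G) (k : ℕ) :
    MultilinearMap K (fun _ : Fin k => G) G :=
  ∑ᶠ n : ℕ, (n.factorial : K)⁻¹ •
    ((l (n + k)).domDomCongr finSumFinEquiv.symm).currySum fun _ : Fin n => π

end LInfinity



/-! ### The iterated brackets defining `l₃` and `l₄` lie in `C^*(M, L)` -/

section WellDefined

section Conj

variable {K V : Type*} [Field K] [AddCommGroup V] [Module K V]

/-- Transport of a cochain along a linear automorphism. -/
def conjHom (e : V ≃ₗ[K] V) (n : ℕ) : Cochain K V V n →ₗ[K] Cochain K V V n where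
  toFun f := Cochain.mk (fun X z => e.symm (f.1 (fun i => (e (X i).1, e (X i).2)) (e z))) (by
    have h : ∀ (X : Fin n → V × V) i x y,
        (fun j => (e (Function.update X i (x, y) j).1, e (Function.update X i (x, y) j).2))
          = Function.update (fun j => (e (X j).1, e (X j).2)) i (e x, e y) := by
      intro X i x y
      funext j
      by_cases h : j = i
      · subst h; simp
      · simp [Function.update_of_ne h]
    have hf := f.2
    refine ⟨fun X a x y => ?_, fun X i z a x x' y => ?_, fun X i z a x y y' => ?_,
      fun X i z x => ?_, fun X i hi x y z => ?_⟩
    · simp [hf.lin_last]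
    · simp [h, hf.lin_fst]
    · simp [h, hf.lin_snd]
    · simp [h, hf.alt]
    · simp only [h, ← map_add, hf.cyclic _ i hi, map_zero])
  map_add' f g := Cochain.ext fun X z => by simp [Cochain.mk_val, Cochain.add_val]
  map_smul' a f := Cochain.ext fun X z => by simp [Cochain.mk_val, Cochain.smul_val]

theorem conjHom_val (e : V ≃ₗ[K] V) {n : ℕ} (f : Cochain K V V n) (X : Fin n → V × V) (z : V) :
    (conjHom e n f).1 X z = e.symm (f.1 (fun i => (e (X i).1, e (X i).2)) (e z)) := rfl

theorem conjHom_circ (e : V ≃ₗ[K] V) {p q : ℕ} (P : Cochain K V V p) (Q : Cochain K V V q) :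
    conjHom e (p + q) (circ p q P Q) = circ p q (conjHom e p P) (conjHom e q Q) := by
  refine Cochain.ext fun X z => ?_
  have h : ∀ (A : Fin p → V × V) i x y,
      (fun j => (e (Function.update A i (x, y) j).1, e (Function.update A i (x, y) j).2))
        = Function.update (fun j => (e (A j).1, e (A j).2)) i (e x, e y) := by
    intro A i x y
    funext j
    by_cases h : j = i
    · subst h; simp
    · simp [Function.update_of_ne h]
  change e.symm (circFun P.1 Q.1 _ _) = circFun (conjHom e p P).1 (conjHom e q Q).1 X z
  simp only [circFun, circTerm, map_add, map_sum, map_zsmul, conjHom_val, h,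
    LinearEquiv.apply_symm_apply]
  rfl

/-- Transport along a linear automorphism on `C^*(V, V)`. -/
def conj (e : V ≃ₗ[K] V) : GradedCochain K V V →ₗ[K] GradedCochain K V V :=
  DirectSum.lmap fun n => conjHom e n

theorem conj_bracket (e : V ≃ₗ[K] V) (f g : GradedCochain K V V) :
    conj e (bracket f g) = bracket (conj e f) (conj e g) := by
  have : (bracket (K := K) (V := V)).compr₂ (conj e) = bracket.compl₁₂ (conj e) (conj e) := by
    refine DirectSum.linearMap_ext K fun p => ?_
    refine LinearMap.ext fun P => ?_
    refine DirectSum.linearMap_ext K fun q => ?_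
    refine LinearMap.ext fun Q => ?_
    simp only [LinearMap.comp_apply, LinearMap.compr₂_apply, LinearMap.compl₁₂_apply, conj,
      bracket_lof, map_sub, map_zsmul, DirectSum.lmap_lof, conjHom_circ]
  exact LinearMap.congr_fun₂ this f g

end Conj

section Poly

variable {K W : Type*} [Field K] [AddCommGroup W] [Module K W]

/-- Polynomial functions `K → W`, tested on linear forms. -/
def IsPoly (φ : K → W) : Prop := ∀ f : Module.Dual K W, ∃ p : Polynomial K, ∀ t, f (φ t) = p.eval t

theorem IsPoly.const (w : W) : IsPoly (fun _ : K => w) := fun f => ⟨Polynomial.C (f w), by simp⟩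

theorem IsPoly.add {φ ψ : K → W} (hφ : IsPoly φ) (hψ : IsPoly ψ) :
    IsPoly (fun t => φ t + ψ t) := fun f => by
  obtain ⟨p, hp⟩ := hφ f
  obtain ⟨r, hr⟩ := hψ f
  exact ⟨p + r, fun t => by simp [hp, hr]⟩

theorem IsPoly.smul {φ : K → W} (hφ : IsPoly φ) : IsPoly (fun t => t • φ t) := fun f => by
  obtain ⟨p, hp⟩ := hφ f
  exact ⟨Polynomial.X * p, fun t => by simp [hp]⟩

theorem IsPoly.map {W' : Type*} [AddCommGroup W'] [Module K W'] {φ : K → W} (hφ : IsPoly φ)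
    (g : W →ₗ[K] W') : IsPoly (fun t => g (φ t)) := fun f => hφ (f ∘ₗ g)

theorem IsPoly.zero_of [CharZero K] {φ : K → W} (hφ : IsPoly φ) (h : ∀ t, t ≠ 0 → φ t = 0) :
    φ 0 = 0 := by
  rw [← Module.forall_dual_apply_eq_zero_iff K]
  intro f
  obtain ⟨p, hp⟩ := hφ f
  have hp0 : p = 0 := by
    refine Polynomial.eq_zero_of_infinite_isRoot p
      ((Set.infinite_univ.sdiff (Set.finite_singleton (0 : K))).mono fun t ht => ?_)
    change p.eval t = 0
    rw [← hp, h t (by simpa using ht), map_zero]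
  rw [hp, hp0, Polynomial.eval_zero]

end Poly

section Weight

variable {K L M : Type*} [Field K] [AddCommGroup L] [Module K L] [AddCommGroup M] [Module K M]

/-- The map `(x, u) ↦ (t x, u)` of `L ⊕ M`. -/
def scaleFst (t : K) (x : L × M) : L × M := (t • x.1, x.2)

/-- The automorphism `(x, u) ↦ (t x, u)` of `L ⊕ M` for `t ≠ 0`. -/
def scaleEquiv (t : Kˣ) : (L × M) ≃ₗ[K] (L × M) :=
  LinearEquiv.prodCongr (LinearEquiv.smulOfUnit t) (LinearEquiv.refl K M)

theorem smulOfUnit_eq (t : Kˣ) (x : L) : LinearEquiv.smulOfUnit t x = (t : K) • x := rfl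

theorem scaleFst_eq (t : K) (x : L × M) : scaleFst t x = t • (x.1, (0 : M)) + ((0 : L), x.2) := by
  simp [scaleFst]

theorem isPoly_cochain {n : ℕ} (f : Cochain K (L × M) (L × M) n)
    (X : Fin n → (L × M) × (L × M)) (z : L × M) :
    IsPoly (fun t : K => f.1 (fun i => (scaleFst t (X i).1, scaleFst t (X i).2))
      (scaleFst t z)) := by
  have hf := f.2
  have key : ∀ (s : Finset (Fin n)) (Y : Fin n → (L × M) × (L × M)) (z : L × M),
      IsPoly (fun t : K => f.1 (fun i => if i ∈ s then (scaleFst t (X i).1, scaleFst t (X i).2)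
        else Y i) z) := by
    intro s
    induction s using Finset.induction_on with
    | empty => intro Y z; simpa using IsPoly.const _
    | insert j s hj ih =>
      intro Y z
      have e : ∀ (t : K) v, Function.update
          (fun i => if i ∈ s then (scaleFst t (X i).1, scaleFst t (X i).2) else Y i) j v
          = fun i => if i ∈ s then (scaleFst t (X i).1, scaleFst t (X i).2)
            else Function.update Y j v i := by
        intro t v
        funext i
        by_cases h : i = j
        · subst h; simp [hj]
        · simp [Function.update_of_ne h]
      have e' : ∀ t : K, (fun i => if i ∈ insert j s then
          (scaleFst t (X i).1, scaleFst t (X i).2) else Y i) = Function.update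
          (fun i => if i ∈ s then (scaleFst t (X i).1, scaleFst t (X i).2) else Y i) j
          (t • ((X j).1.1, (0 : M)) + ((0 : L), (X j).1.2),
            t • ((X j).2.1, (0 : M)) + ((0 : L), (X j).2.2)) := by
        intro t
        funext i
        by_cases h : i = j
        · subst h; simp [scaleFst_eq]
        · simp [h]
      simp only [e', hf.lin_fst, hf.lin_snd]
      simp only [e]
      exact (((ih _ _).smul.add (ih _ _)).smul).add ((ih _ _).smul.add (ih _ _))
  have h : ∀ z, IsPoly (fun t : K => f.1 (fun i => (scaleFst t (X i).1, scaleFst t (X i).2)) z) :=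
    fun z => by simpa using key Finset.univ X z
  simp only [scaleFst_eq _ z, hf.lin_last]
  exact (h _).smul.add (h _)

/-- A cochain that the automorphisms `(x, u) ↦ (t x, u)` scale by `t⁻¹` lies in `C^n(M, L)`. -/
theorem inclHom_projHom [CharZero K] {n : ℕ} (f : Cochain K (L × M) (L × M) n)
    (hf : ∀ t : Kˣ, conjHom (scaleEquiv t) n f = (↑t⁻¹ : K) • f) :
    inclHom n (projHom n f) = f := by
  refine Cochain.ext fun X z => ?_
  have hp := isPoly_cochain f X z
  have hs : ∀ t : Kˣ, f.1 (fun i => (scaleFst (t : K) (X i).1, scaleFst (t : K) (X i).2))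
      (scaleFst (t : K) z) = ((f.1 X z).1, (↑t⁻¹ : K) • (f.1 X z).2) := by
    intro t
    have h : (scaleEquiv t).symm (f.1 (fun i => (scaleFst (t : K) (X i).1,
        scaleFst (t : K) (X i).2)) (scaleFst (t : K) z)) = (↑t⁻¹ : K) • f.1 X z := by
      have := congrArg (fun g : Cochain K (L × M) (L × M) n => g.1 X z) (hf t)
      exact this
    rw [LinearEquiv.symm_apply_eq] at h
    rw [h]
    ext
    · change (t : K) • ((↑t⁻¹ : K) • f.1 X z).1 = _
      simp
    · rfl
  have h₁ := ((hp.map (LinearMap.fst K L M)).add (IsPoly.const (-(f.1 X z).1))).zero_of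
    (fun t ht => by
      have := hs (Units.mk0 t ht)
      simp only [Units.val_mk0] at this
      simp [this])
  have h₂ := ((hp.map (LinearMap.snd K L M)).smul.add (IsPoly.const (-(f.1 X z).2))).zero_of
    (fun t ht => by
      have := hs (Units.mk0 t ht)
      simp only [Units.val_mk0] at this
      simp [this, ht])
  simp only [LinearMap.fst_apply, add_neg_eq_zero] at h₁
  simp only [zero_smul, zero_add, neg_eq_zero] at h₂
  refine Prod.ext ?_ ?_
  · rw [← h₁]
    simp [inclHom, projHom, Cochain.mk_val, scaleFst]
  · rw [h₂]
    simp [inclHom, Cochain.mk_val]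

theorem conj_incl (t : Kˣ) (f : GradedCochain K M L) :
    conj (scaleEquiv t) (incl f) = (↑t⁻¹ : K) • incl f := by
  have : (conj (scaleEquiv t)).comp (incl (K := K) (L := L) (M := M)) = (↑t⁻¹ : K) • incl := by
    refine DirectSum.linearMap_ext K fun n => LinearMap.ext fun f => ?_
    simp only [LinearMap.comp_apply, LinearMap.smul_apply, conj, incl, DirectSum.lmap_lof,
      ← map_smul]
    congr 1
  exact LinearMap.congr_fun this f

theorem incl_proj [CharZero K] (F : GradedCochain K (L × M) (L × M))
    (hF : ∀ t : Kˣ, conj (scaleEquiv t) F = (↑t⁻¹ : K) • F) : incl (proj F) = F := by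
  refine DFinsupp.ext fun n => ?_
  have h₁ : ∀ G : GradedCochain K M L, incl G n = inclHom n (G n) := fun G =>
    DirectSum.lmap_apply _ _ _
  have h₂ : proj F n = projHom n (F n) := DirectSum.lmap_apply _ _ _
  rw [h₁, h₂]
  refine inclHom_projHom _ fun t => ?_
  have h := congrArg (fun G : GradedCochain K (L × M) (L × M) => G n) (hF t)
  have h₃ : conj (scaleEquiv t) F n = conjHom (scaleEquiv t) n (F n) := DirectSum.lmap_apply _ _ _
  rw [← h₃]
  exact h

variable {S : LieTripleSystem K L}

theorem conj_semidirect (ρ : Representation M S) (t : Kˣ) :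
    conj (scaleEquiv t) (DirectSum.lof K ℕ (Cochain K (L × M) (L × M)) 1 (semidirect ρ))
      = ((t : K) ^ 2) • DirectSum.lof K ℕ (Cochain K (L × M) (L × M)) 1 (semidirect ρ) := by
  rw [conj, DirectSum.lmap_lof, ← map_smul]
  congr 1
  refine Cochain.ext fun X z => ?_
  rw [conjHom_val, LinearEquiv.symm_apply_eq]
  ext
  · simp [semidirect, ofTrilinear, Cochain.mk_val, Cochain.smul_val, scaleEquiv, smul_smul,
      smulOfUnit_eq, pow_succ, mul_assoc]
  · simp [semidirect, ofTrilinear, Cochain.mk_val, Cochain.smul_val, scaleEquiv, smul_smul,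
      smulOfUnit_eq, pow_succ, smul_add, smul_sub]

theorem conj_toCochain {ρ : Representation M S} (ω : ThreeCocycle ρ) (t : Kˣ) :
    conj (scaleEquiv t) (DirectSum.lof K ℕ (Cochain K (L × M) (L × M)) 1 ω.toCochain)
      = ((t : K) ^ 3) • DirectSum.lof K ℕ (Cochain K (L × M) (L × M)) 1 ω.toCochain := by
  rw [conj, DirectSum.lmap_lof, ← map_smul]
  congr 1
  refine Cochain.ext fun X z => ?_
  rw [conjHom_val, LinearEquiv.symm_apply_eq]
  ext
  · simp [ThreeCocycle.toCochain, ofTrilinear, Cochain.mk_val, Cochain.smul_val, scaleEquiv]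
  · simp [ThreeCocycle.toCochain, ofTrilinear, Cochain.mk_val, Cochain.smul_val, scaleEquiv,
      smul_smul, smulOfUnit_eq, pow_succ, mul_assoc]

/-- Inside `C^*(L ⊕ M, L ⊕ M)`, `l₃(P, Q, R)` is the iterated bracket `[[[π + θ, P], Q], R]`. -/
theorem incl_l₃ [CharZero K] (ρ : Representation M S) (P : Fin 3 → GradedCochain K M L) :
    incl (l₃ ρ P) = bracket (bracket (bracket
      (DirectSum.lof K ℕ (Cochain K (L × M) (L × M)) 1 (semidirect ρ))
      (incl (P 0))) (incl (P 1))) (incl (P 2)) := by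
  refine incl_proj _ fun t => ?_
  simp only [conj_bracket, conj_incl, conj_semidirect, map_smul, LinearMap.smul_apply, smul_smul]
  congr 1
  simp [pow_succ]

/-- Inside `C^*(L ⊕ M, L ⊕ M)`, `l₄(P, Q, R, S)` is the iterated bracket `[[[[H, P], Q], R], S]`. -/
theorem incl_l₄ [CharZero K] {ρ : Representation M S} (ω : ThreeCocycle ρ)
    (P : Fin 4 → GradedCochain K M L) :
    incl (l₄ ω P) = bracket (bracket (bracket (bracket
      (DirectSum.lof K ℕ (Cochain K (L × M) (L × M)) 1 ω.toCochain)
      (incl (P 0))) (incl (P 1))) (incl (P 2))) (incl (P 3)) := by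
  refine incl_proj _ fun t => ?_
  simp only [conj_bracket, conj_incl, conj_toCochain, map_smul, LinearMap.smul_apply, smul_smul]
  congr 1
  simp only [Units.val_inv_eq_inv_val]
  field_simp

end Weight

end WellDefined
/-! ### The twisted maps -/

section Twisted

variable {K L M : Type*} [Field K] [AddCommGroup L] [Module K L] [AddCommGroup M] [Module K M]

/-- The maps `l_k^T` on `C^*(M, L)`: the twist by `T` of the structure maps. -/
noncomputable def twistedMaps {S : LieTripleSystem K L} {ρ : Representation M S}
    (ω : ThreeCocycle ρ) (T : M →ₗ[K] L) (k : ℕ) :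
    MultilinearMap K (fun _ : Fin k => GradedCochain K M L) (GradedCochain K M L) :=
  twist (structureMaps ω) (ofHom T) k

end Twisted

end LieTriple

/-! The argument is the derived bracket construction. Let `P` be the projection `proj` of the graded
Lie algebra `C^*(L ⊕ M, L ⊕ M)` onto `C^*(M, L)`. The subspace `C^*(M, L)` is an abelian subalgebra
(`bracket_incl_incl`): its elements have values in `L` and vanish as soon as one argument lies in
`L`. The kernel of `P` consists of the cochains that send arguments in `M` into `M`, so it is closed
under the bracket (`proj_bracket_eq_zero`).

The element `Δ = π + θ + H` satisfies `[Δ, Δ] = 0`, because the bracket twisted by the cocycle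
satisfies the fundamental identity on `L ⊕ M` (`twistedSemidirect_fundamental`). Whenever `Δ` has
degree 1, `[Δ, Δ] = 0` and `PΔ = 0`, the maps `P[⋯[Δ, x₁], ⋯, x_k]` form an `L_∞`-algebra
(`isLInfinity_of_derived`). To see this, expand the iterated bracket of `[Δ, Δ]` with the `x_i` by
the Leibniz rule and apply `P[A, B] = P[PA, B] + P[A, PB]`. This produces the left side of the
generalized Jacobi identity twice, and `2` is invertible.

Under the scaling `(x, u) ↦ (t x, u)`, the element `π + θ` has weight 2, `H` has weight 3 and
`C^*(M, L)` has weight -1. Hence `Δ` has only ternary and quaternary derived brackets, namely `l₃`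
and `l₄` (`structureMaps_eq_derived`).

Bracketing with `T` has the exponential given by conjugation with the shear `(x, u) ↦ (x + Tu, u)`
(`conjHom_shear`). The twisted maps are therefore the derived brackets of the conjugate `Δ_T`
(`twistedMaps_eq_derived`). Conjugation preserves `[Δ, Δ] = 0`, and `PΔ_T = 0` says exactly that `T`
is a generalized Reynolds operator (`proj_conj_shear_eq_zero`). Shears compose additively, so the
Maurer–Cartan expression of `T'` is `PΔ_{T+T'} - PΔ_T = PΔ_{T+T'}`.

The graded Jacobi identity for the shuffle-defined bracket has to be proved as well. Cochains are
turned into functions of words of pairs, on which the product has a recursion in the first letter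
(`wordCirc_toWord`). Induction on the word then shows that `F ↦ F ∘ Q` turns the graded commutator
into a commutator of operators (`wordCirc_wordBracket`), and this gives Jacobi formally. -/

namespace LieTriple

open Equiv

set_option linter.unusedSectionVars false
set_option linter.unusedSimpArgs false

/-! ### The product on functions of a word of pairs -/

section Words

variable {V W : Type*} [AddCommGroup V] [AddCommGroup W]

/-- The function `F (X, ·)` of the remaining letters. -/
def contract {U : Type*} (X : V × V) (F : List (V × V) → U) : List (V × V) → U :=
  fun l => F (X :: l)

/-- The insertion of `Q` (of parity `s`) into `F`, by recursion on the word of pairs. -/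
def insertWord : List (V × V) → ℤˣ → (List (V × V) → V → W) → (List (V × V) → V → V) → V → W
  | [], _, F, Q => fun z => F [] (Q [] z)
  | X :: l, s, F, Q => fun z => (s : ℤ) • insertWord l s (contract X F) Q z
      + insertWord l (-s) F (contract X Q) z
      + (contract (Q [] X.1, X.2) F l z + contract (X.1, Q [] X.2) F l z)

/-- The insertion of `Q` into `F`, as a function of the word of pairs. -/
def wordCirc (s : ℤˣ) (F : List (V × V) → V → W) (Q : List (V × V) → V → V)
    (l : List (V × V)) : V → W := insertWord l s F Q

/-- Functions of a word of pairs and a vector that are additive in every vector. -/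
structure IsMultiadditive (F : List (V × V) → V → W) : Prop where
  last : ∀ l a b, F l (a + b) = F l a + F l b
  fst : ∀ l₁ l₂ x x' y z, F (l₁ ++ (x + x', y) :: l₂) z
    = F (l₁ ++ (x, y) :: l₂) z + F (l₁ ++ (x', y) :: l₂) z
  snd : ∀ l₁ l₂ x y y' z, F (l₁ ++ (x, y + y') :: l₂) z
    = F (l₁ ++ (x, y) :: l₂) z + F (l₁ ++ (x, y') :: l₂) z

theorem IsMultiadditive.contract {F : List (V × V) → V → W} (hF : IsMultiadditive F) (X : V × V) :
    IsMultiadditive (contract X F) :=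
  ⟨fun _ => hF.last _, fun l₁ => hF.fst (X :: l₁), fun l₁ => hF.snd (X :: l₁)⟩

/-- The function `Q` is supported on the words of parity `s`. -/
def HasParity {U : Type*} [Zero U] (s : ℤˣ) (Q : List (V × V) → U) : Prop :=
  ∀ l, (-1 : ℤˣ) ^ l.length ≠ s → Q l = 0

theorem HasParity.contract {U : Type*} [Zero U] {s : ℤˣ} {Q : List (V × V) → U}
    (hQ : HasParity s Q) (X : V × V) :
    HasParity (-s) (contract X Q) := fun l hl => hQ _ fun h => hl (by
  rw [← h, List.length_cons, pow_succ]; simp)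

theorem HasParity.nil {U : Type*} [Zero U] {Q : List (V × V) → U} (hQ : HasParity (-1) Q) :
    Q [] = 0 := hQ _ (by rw [List.length_nil]; decide)

theorem wordCirc_nil (s : ℤˣ) (F : List (V × V) → V → W) (Q : List (V × V) → V → V) (z : V) :
    wordCirc s F Q [] z = F [] (Q [] z) := rfl

/-- Contraction with a letter is a graded derivation of the product, up to a correction in which the
operator `Q []` acts on the letter. This holds by definition, which is the advantage of the
recursive product over the shuffle formula. -/
theorem contract_wordCirc (s : ℤˣ) (F : List (V × V) → V → W) (Q : List (V × V) → V → V)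
    (X : V × V) : contract X (wordCirc s F Q) = (s : ℤ) • wordCirc s (contract X F) Q
      + wordCirc (-s) F (contract X Q)
      + (contract (Q [] X.1, X.2) F + contract (X.1, Q [] X.2) F) := rfl

theorem wordCirc_cons (s : ℤˣ) (F : List (V × V) → V → W) (Q : List (V × V) → V → V)
    (X : V × V) (l : List (V × V)) (z : V) :
    wordCirc s F Q (X :: l) z = (s : ℤ) • wordCirc s (contract X F) Q l z
      + wordCirc (-s) F (contract X Q) l z
      + (contract (Q [] X.1, X.2) F l z + contract (X.1, Q [] X.2) F l z) := rfl

theorem contract_add (F G : List (V × V) → V → W) (X : V × V) :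
    contract X (F + G) = contract X F + contract X G := rfl

theorem contract_zsmul (n : ℤ) (F : List (V × V) → V → W) (X : V × V) :
    contract X (n • F) = n • contract X F := rfl

theorem wordCirc_add_left (s : ℤˣ) (F F' : List (V × V) → V → W) (Q : List (V × V) → V → V) :
    wordCirc s (F + F') Q = wordCirc s F Q + wordCirc s F' Q := by
  funext l z
  induction l generalizing s F F' Q with
  | nil => rfl
  | cons X l ih =>
    simp only [wordCirc_cons, contract_add, ih, Pi.add_apply, smul_add]
    abel

theorem wordCirc_zsmul_left (s : ℤˣ) (n : ℤ) (F : List (V × V) → V → W)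
    (Q : List (V × V) → V → V) : wordCirc s (n • F) Q = n • wordCirc s F Q := by
  funext l z
  induction l generalizing s F Q with
  | nil => rfl
  | cons X l ih =>
    simp only [wordCirc_cons, contract_zsmul, ih, Pi.smul_apply]
    module

section Right

variable {F : List (V × V) → V → W}

theorem IsMultiadditive.contract_fst (hF : IsMultiadditive F) (x x' y : V) :
    LieTriple.contract (x + x', y) F
      = LieTriple.contract (x, y) F + LieTriple.contract (x', y) F :=
  funext fun l => funext fun z => hF.fst [] l x x' y z

theorem IsMultiadditive.contract_snd (hF : IsMultiadditive F) (x y y' : V) :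
    LieTriple.contract (x, y + y') F
      = LieTriple.contract (x, y) F + LieTriple.contract (x, y') F :=
  funext fun l => funext fun z => hF.snd [] l x y y' z

theorem IsMultiadditive.contract_zsmul_fst (hF : IsMultiadditive F) (n : ℤ) (x y : V) :
    LieTriple.contract (n • x, y) F = n • LieTriple.contract (x, y) F :=
  map_zsmul (AddMonoidHom.mk' (fun x => LieTriple.contract (x, y) F)
    fun x x' => hF.contract_fst x x' y) n x

theorem IsMultiadditive.contract_zsmul_snd (hF : IsMultiadditive F) (n : ℤ) (x y : V) :
    LieTriple.contract (x, n • y) F = n • LieTriple.contract (x, y) F :=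
  map_zsmul (AddMonoidHom.mk' (fun y => LieTriple.contract (x, y) F)
    fun y y' => hF.contract_snd x y y') n y

theorem IsMultiadditive.contract_zero_fst (hF : IsMultiadditive F) (y : V) :
    LieTriple.contract (0, y) F = 0 := by simpa using hF.contract_fst 0 0 y

theorem IsMultiadditive.contract_zero_snd (hF : IsMultiadditive F) (x : V) :
    LieTriple.contract (x, 0) F = 0 := by simpa using hF.contract_snd x 0 0

theorem IsMultiadditive.last_zero (hF : IsMultiadditive F) (l : List (V × V)) : F l 0 = 0 := by
  simpa using hF.last l 0 0

theorem IsMultiadditive.last_zsmul (hF : IsMultiadditive F) (l : List (V × V)) (n : ℤ) (z : V) :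
    F l (n • z) = n • F l z :=
  map_zsmul (AddMonoidHom.mk' (F l) (hF.last l)) n z

theorem wordCirc_add_right (hF : IsMultiadditive F) (s : ℤˣ) (Q Q' : List (V × V) → V → V) :
    wordCirc s F (Q + Q') = wordCirc s F Q + wordCirc s F Q' := by
  funext l z
  induction l generalizing s F Q Q' with
  | nil => exact hF.last _ _ _
  | cons X l ih =>
    simp only [wordCirc_cons, contract_add, ih (hF.contract X), ih hF, Pi.add_apply,
      hF.contract_fst, hF.contract_snd, smul_add]
    abel

theorem wordCirc_zsmul_right (hF : IsMultiadditive F) (s : ℤˣ) (n : ℤ)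
    (Q : List (V × V) → V → V) : wordCirc s F (n • Q) = n • wordCirc s F Q :=
  map_zsmul (AddMonoidHom.mk' (fun Q => wordCirc s F Q) (wordCirc_add_right hF s)) n Q

theorem wordCirc_zero_right (hF : IsMultiadditive F) (s : ℤˣ) :
    wordCirc s F (0 : List (V × V) → V → V) = 0 := by
  simpa using wordCirc_zsmul_right hF s 0 0

theorem wordCirc_zero_left (s : ℤˣ) (Q : List (V × V) → V → V) :
    wordCirc s (0 : List (V × V) → V → W) Q = 0 := by
  simpa using wordCirc_zsmul_left s 0 (0 : List (V × V) → V → W) Q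

end Right

/-- The sign of the interchange of two letters of parities `s` and `t`. -/
def swapSign (s t : ℤˣ) : ℤ := if s = -1 ∧ t = -1 then -1 else 1

theorem swapSign_one_left (t : ℤˣ) : swapSign 1 t = 1 := by
  simp [swapSign, show (1 : ℤˣ) ≠ -1 by decide]

theorem swapSign_one_right (s : ℤˣ) : swapSign s 1 = 1 := by
  simp [swapSign, show (1 : ℤˣ) ≠ -1 by decide]

theorem swapSign_neg_one : swapSign (-1) (-1) = -1 := by simp [swapSign]

/-- The graded commutator of functions of words. -/
def wordBracket (s t : ℤˣ) (Q R : List (V × V) → V → V) : List (V × V) → V → V :=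
  wordCirc t Q R + (-swapSign s t) • wordCirc s R Q

/-- Inserting the commutator is the commutator of the insertions. -/
theorem wordCirc_wordBracket {F : List (V × V) → V → W} (hF : IsMultiadditive F) {s t : ℤˣ}
    {Q R : List (V × V) → V → V} (aQ : IsMultiadditive Q) (aR : IsMultiadditive R)
    (hQ : HasParity s Q) (hR : HasParity t R) :
    wordCirc (s * t) F (wordBracket s t Q R)
      = wordCirc t (wordCirc s F Q) R + (-swapSign s t) • wordCirc s (wordCirc t F R) Q := by
  funext l z
  induction l generalizing s t F Q R with
  | nil =>
    have h : F [] (Q [] (R [] z) + (-swapSign s t) • R [] (Q [] z))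
      = F [] (Q [] (R [] z)) + (-swapSign s t) • F [] (R [] (Q [] z)) := by
      rw [hF.last, hF.last_zsmul]
    exact h
  | cons X l ih =>
    -- The letter `X` is absorbed by `F`, by `Q` or by `R`, which gives the three induction
    -- hypotheses. The remaining terms have `Q []` or `R []` acting on `X`; they match or cancel
    -- directly.
    have i₁ := ih (hF.contract X) aQ aR hQ hR
    have i₂ := ih hF (aQ.contract X) aR (hQ.contract X) hR
    have i₃ := ih hF aQ (aR.contract X) hQ (hR.contract X)
    -- The operator `Q []` is nonzero only if `s = 1`, and `R []` only if `t = 1`. In all four cases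
    -- `i₁` enters with the coefficient `s * t`, `i₂` with `t` and `i₃` with `1`.
    rcases Int.units_eq_one_or s with rfl | rfl <;> rcases Int.units_eq_one_or t with rfl | rfl
    · simp only [wordBracket, swapSign_one_left, swapSign_one_right, swapSign_neg_one,
        wordCirc_add_right hF, wordCirc_add_right (hF.contract X), wordCirc_zsmul_right hF,
        wordCirc_zsmul_right (hF.contract X), contract_add, contract_zsmul, wordCirc_cons,
        contract_wordCirc, wordCirc_add_left, wordCirc_zsmul_left, Pi.add_apply, Pi.smul_apply,
        wordCirc_nil, hF.contract_fst, hF.contract_snd, hF.contract_zsmul_fst,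
        hF.contract_zsmul_snd, one_mul, mul_one, neg_mul, mul_neg, neg_neg, Units.val_one,
        Units.val_neg, Pi.zero_apply, hF.contract_zero_fst, hF.contract_zero_snd,
        wordCirc_zero_right hF, wordCirc_zero_left, aQ.last_zero, aR.last_zero,
        aQ.contract_zero_fst, aQ.contract_zero_snd, aR.contract_zero_fst, aR.contract_zero_snd] at i₁ i₂ i₃ ⊢
      linear_combination (norm := module) (1:ℤ) • i₁ + (1:ℤ) • i₂ + i₃
    · simp only [wordBracket, swapSign_one_left, swapSign_one_right, swapSign_neg_one,
        wordCirc_add_right hF, wordCirc_add_right (hF.contract X), wordCirc_zsmul_right hF,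
        wordCirc_zsmul_right (hF.contract X), contract_add, contract_zsmul, wordCirc_cons,
        contract_wordCirc, wordCirc_add_left, wordCirc_zsmul_left, Pi.add_apply, Pi.smul_apply,
        wordCirc_nil, hF.contract_fst, hF.contract_snd, hF.contract_zsmul_fst,
        hF.contract_zsmul_snd, one_mul, mul_one, neg_mul, mul_neg, neg_neg, Units.val_one,
        Units.val_neg, Pi.zero_apply, hF.contract_zero_fst, hF.contract_zero_snd,
        wordCirc_zero_right hF, wordCirc_zero_left, aQ.last_zero, aR.last_zero,
        aQ.contract_zero_fst, aQ.contract_zero_snd, aR.contract_zero_fst, aR.contract_zero_snd, hR.nil] at i₁ i₂ i₃ ⊢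
      linear_combination (norm := module) (-1:ℤ) • i₁ + (-1:ℤ) • i₂ + i₃
    · simp only [wordBracket, swapSign_one_left, swapSign_one_right, swapSign_neg_one,
        wordCirc_add_right hF, wordCirc_add_right (hF.contract X), wordCirc_zsmul_right hF,
        wordCirc_zsmul_right (hF.contract X), contract_add, contract_zsmul, wordCirc_cons,
        contract_wordCirc, wordCirc_add_left, wordCirc_zsmul_left, Pi.add_apply, Pi.smul_apply,
        wordCirc_nil, hF.contract_fst, hF.contract_snd, hF.contract_zsmul_fst,
        hF.contract_zsmul_snd, one_mul, mul_one, neg_mul, mul_neg, neg_neg, Units.val_one,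
        Units.val_neg, Pi.zero_apply, hF.contract_zero_fst, hF.contract_zero_snd,
        wordCirc_zero_right hF, wordCirc_zero_left, aQ.last_zero, aR.last_zero,
        aQ.contract_zero_fst, aQ.contract_zero_snd, aR.contract_zero_fst, aR.contract_zero_snd, hQ.nil] at i₁ i₂ i₃ ⊢
      linear_combination (norm := module) (-1:ℤ) • i₁ + (1:ℤ) • i₂ + i₃
    · simp only [wordBracket, swapSign_one_left, swapSign_one_right, swapSign_neg_one,
        wordCirc_add_right hF, wordCirc_add_right (hF.contract X), wordCirc_zsmul_right hF,
        wordCirc_zsmul_right (hF.contract X), contract_add, contract_zsmul, wordCirc_cons,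
        contract_wordCirc, wordCirc_add_left, wordCirc_zsmul_left, Pi.add_apply, Pi.smul_apply,
        wordCirc_nil, hF.contract_fst, hF.contract_snd, hF.contract_zsmul_fst,
        hF.contract_zsmul_snd, one_mul, mul_one, neg_mul, mul_neg, neg_neg, Units.val_one,
        Units.val_neg, Pi.zero_apply, hF.contract_zero_fst, hF.contract_zero_snd,
        wordCirc_zero_right hF, wordCirc_zero_left, aQ.last_zero, aR.last_zero,
        aQ.contract_zero_fst, aQ.contract_zero_snd, aR.contract_zero_fst, aR.contract_zero_snd, hQ.nil, hR.nil] at i₁ i₂ i₃ ⊢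
      linear_combination (norm := module) (1:ℤ) • i₁ + (-1:ℤ) • i₂ + i₃
end Words

/-! ### Sums over shuffles -/

section Extension

variable {N : ℕ}

/-- The permutation of `Fin (N + 1)` that sends `a` to `0` and is `τ` on the other indices. -/
def extendPerm (a : Fin (N + 1)) (τ : Perm (Fin N)) : Perm (Fin (N + 1)) :=
  Perm.decomposeFin.symm (0, τ) * Fin.cycleRange a

theorem extendPerm_self (a : Fin (N + 1)) (τ : Perm (Fin N)) : extendPerm a τ a = 0 := by
  simp [extendPerm]

theorem extendPerm_succAbove (a : Fin (N + 1)) (τ : Perm (Fin N)) (i : Fin N) :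
    extendPerm a τ (a.succAbove i) = (τ i).succ := by
  simp [extendPerm]

theorem extendPerm_injective (a : Fin (N + 1)) : Function.Injective (extendPerm a) := by
  intro τ τ' h
  ext i
  have := congrArg (fun σ : Perm (Fin (N + 1)) => σ (a.succAbove i)) h
  simp only [extendPerm_succAbove] at this
  exact congrArg Fin.val (Fin.succ_injective _ this)

theorem exists_eq_extendPerm {a : Fin (N + 1)} {σ : Perm (Fin (N + 1))} (h : σ a = 0) :
    ∃ τ, σ = extendPerm a τ := by
  refine ⟨(Perm.decomposeFin (σ * (Fin.cycleRange a)⁻¹)).2, ?_⟩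
  -- `Fin.cycleRange a` carries `a` to `0`, so undoing it leaves a permutation that fixes `0` and
  -- hence comes from `Fin N`.
  have h₀ : (Perm.decomposeFin (σ * (Fin.cycleRange a)⁻¹)).1 = 0 := by
    have := Perm.decomposeFin_symm_apply_zero (Perm.decomposeFin (σ * (Fin.cycleRange a)⁻¹)).1
      (Perm.decomposeFin (σ * (Fin.cycleRange a)⁻¹)).2
    rw [← this, Prod.mk.eta, Equiv.symm_apply_apply, Perm.mul_apply]
    exact (congrArg σ (Fin.cycleRange_symm_zero a)).trans h
  rw [extendPerm, ← h₀, Prod.mk.eta, Equiv.symm_apply_apply, inv_mul_cancel_right]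

/-- This turns summation over permutations into recursion on words: the index `a` with `σ a = 0` is
the place at which the first letter is inserted into a rearrangement of the tail. -/
theorem ofFn_extendPerm {α : Type*} (X : Fin (N + 1) → α) (a : Fin (N + 1)) (τ : Perm (Fin N)) :
    List.ofFn (fun i => X (extendPerm a τ i))
      = (List.ofFn fun i => X (τ i).succ).take a
        ++ X 0 :: (List.ofFn fun i => X (τ i).succ).drop a := by
  have ha := a.2
  refine List.ext_getElem (by simp; omega) fun i hi hi' => ?_
  rw [List.length_ofFn] at hi
  have key : ∀ j : Fin N, X (τ j).succ = X (extendPerm a τ (a.succAbove j)) := fun j => by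
    rw [extendPerm_succAbove]
  rw [List.getElem_ofFn, List.getElem_append]
  simp only [List.length_take, List.length_ofFn, List.getElem_take, List.getElem_ofFn, key]
  split_ifs with h
  · congr 2
    exact (Fin.succAbove_of_castSucc_lt a ⟨i, by omega⟩ (by rw [Fin.lt_def]; simp; omega)).symm
  · rcases Nat.eq_or_lt_of_le (show (a : ℕ) ≤ i by omega) with h' | h'
    · have : (⟨i, hi⟩ : Fin (N + 1)) = a := Fin.ext h'.symm
      simp [this, extendPerm_self, show i - min (a : ℕ) N = 0 by omega]
    · obtain ⟨m, hm⟩ : ∃ m, i - min (a : ℕ) N = m + 1 := ⟨i - min (a : ℕ) N - 1, by omega⟩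
      simp only [hm, List.getElem_cons_succ, List.getElem_drop, List.getElem_ofFn, key]
      congr 2
      rw [Fin.succAbove_of_le_castSucc a _ (by rw [Fin.le_def]; simp)]
      ext
      simp only [Fin.val_succ]
      omega

/-- The product of the signs `χ (σ i) (σ j)` over the inversions of `σ`. -/
def inversionSign (χ : Fin N → Fin N → ℤˣ) (σ : Perm (Fin N)) : ℤˣ :=
  ∏ i : Fin N, ∏ j : Fin N, if i < j ∧ σ j < σ i then χ (σ i) (σ j) else 1

/-- The value `0` at position `a` is the least one, so it forms inversions with exactly the
positions before `a`. All other inversions are those of `τ`. -/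
theorem inversionSign_extendPerm {α : Type*} (χ : α → α → ℤˣ) (X : Fin (N + 1) → α)
    (a : Fin (N + 1)) (τ : Perm (Fin N)) :
    inversionSign (fun i j => χ (X i) (X j)) (extendPerm a τ)
      = (((List.ofFn fun i => X (τ i).succ).take a).map fun y => χ y (X 0)).prod
        * inversionSign (fun i j => χ (X i.succ) (X j.succ)) τ := by
  rw [inversionSign, Fin.prod_univ_succAbove _ a]
  simp only [Fin.prod_univ_succAbove _ a, extendPerm_self, extendPerm_succAbove, Fin.not_lt_zero,
    and_false, if_false, Finset.prod_const_one, one_mul, Fin.succ_pos, and_true,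
    Finset.prod_mul_distrib, Fin.succAbove_lt_succAbove_iff, Fin.succ_lt_succ_iff]
  congr 1
  rw [List.map_take, List.map_ofFn, List.prod_take_ofFn]
  rw [Finset.prod_filter]
  refine Finset.prod_congr rfl fun i _ => ?_
  have : a.succAbove i < a ↔ (i : ℕ) < a := by
    rw [Fin.succAbove_lt_iff_castSucc_lt, Fin.lt_def, Fin.val_castSucc]
  simp only [this, Function.comp]

end Extension

/-! ### Recursion for sums over shuffles -/

section ShuffleSums

/-- The permutations of `Fin N` that are `(k, q)`-shuffles of the first `k + q` indices and fix the
others. -/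
def initialShuffles (N k q : ℕ) : Finset (Perm (Fin N)) :=
  Finset.univ.filter fun σ =>
    (∀ i j : Fin N, i < j → (j : ℕ) < k → σ i < σ j) ∧
    (∀ i j : Fin N, k ≤ (i : ℕ) → i < j → (j : ℕ) < k + q → σ i < σ j) ∧
    ∀ i : Fin N, k + q ≤ (i : ℕ) → σ i = i

theorem mem_initialShuffles {N k q : ℕ} {σ : Perm (Fin N)} : σ ∈ initialShuffles N k q ↔
    (∀ i j : Fin N, i < j → (j : ℕ) < k → σ i < σ j) ∧
    (∀ i j : Fin N, k ≤ (i : ℕ) → i < j → (j : ℕ) < k + q → σ i < σ j) ∧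
    ∀ i : Fin N, k + q ≤ (i : ℕ) → σ i = i := by
  simp [initialShuffles]

theorem initialShuffles_zero_zero (N : ℕ) : initialShuffles N 0 0 = {1} := by
  ext σ
  rw [mem_initialShuffles, Finset.mem_singleton]
  constructor
  · rintro ⟨-, -, h⟩
    exact Equiv.ext fun i => h i (by simp)
  · rintro rfl
    exact ⟨fun i j h _ => h, fun i j _ h _ => h, fun i _ => rfl⟩

variable {N k q : ℕ}

/-- The case in which the first letter of the word opens the first block; `extendPerm_mem` is the
case in which it opens the second. -/
theorem extendPerm_zero_mem {τ : Perm (Fin N)} :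
    extendPerm 0 τ ∈ initialShuffles (N + 1) (k + 1) q ↔ τ ∈ initialShuffles N k q := by
  have e₀ : extendPerm 0 τ 0 = 0 := extendPerm_self 0 τ
  have e : ∀ i : Fin N, extendPerm 0 τ i.succ = (τ i).succ := extendPerm_succAbove 0 τ
  simp only [mem_initialShuffles, Fin.forall_fin_succ, e, e₀, Fin.succ_lt_succ_iff, Fin.val_succ,
    Fin.val_zero, Fin.succ_inj, Fin.not_lt_zero, Fin.succ_pos, lt_irrefl]
  simp [add_right_comm k 1 q]

theorem extendPerm_mem {τ : Perm (Fin N)} {a : Fin (N + 1)} (ha : (a : ℕ) = k) :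
    extendPerm a τ ∈ initialShuffles (N + 1) k (q + 1) ↔ τ ∈ initialShuffles N k q := by
  have e₀ := extendPerm_self a τ
  have e := extendPerm_succAbove a τ
  have hv : ∀ i : Fin N, (a.succAbove i : ℕ) = if (i : ℕ) < k then (i : ℕ) else i + 1 := by
    intro i
    split_ifs with h
    · rw [Fin.succAbove_of_castSucc_lt _ _ (by rw [Fin.lt_def]; simpa [ha] using h)]; rfl
    · rw [Fin.succAbove_of_le_castSucc _ _ (by rw [Fin.le_def]; simp; omega)]; rfl
  rw [mem_initialShuffles, mem_initialShuffles]
  constructor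
  · rintro ⟨h₁, h₂, h₃⟩
    refine ⟨fun i j hij hj => ?_, fun i j hi hij hj => ?_, fun i hi => ?_⟩
    · have := h₁ (a.succAbove i) (a.succAbove j) (Fin.succAbove_lt_succAbove_iff.2 hij)
        (by rw [hv]; split_ifs; omega)
      rwa [e, e, Fin.succ_lt_succ_iff] at this
    · have := h₂ (a.succAbove i) (a.succAbove j) (by rw [hv]; split_ifs <;> omega)
        (Fin.succAbove_lt_succAbove_iff.2 hij) (by rw [hv]; split_ifs <;> omega)
      rwa [e, e, Fin.succ_lt_succ_iff] at this
    · have := congrArg Fin.val (h₃ (a.succAbove i) (by rw [hv]; split_ifs <;> omega))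
      rw [e, hv, Fin.val_succ] at this
      ext
      split_ifs at this <;> omega
  · rintro ⟨h₁, h₂, h₃⟩
    have hi' : ∀ i : Fin (N + 1), i = a ∨ ∃ j, i = a.succAbove j := fun i =>
      (eq_or_ne i a).imp_right fun h => (Fin.exists_succAbove_eq h).imp fun _ => Eq.symm
    refine ⟨fun i j hij hj => ?_, fun i j hi hij hj => ?_, fun i hi => ?_⟩
    · obtain rfl | ⟨i, rfl⟩ := hi' i
      · have := Fin.lt_def.1 hij
        omega
      obtain rfl | ⟨j, rfl⟩ := hi' j
      · omega
      rw [e, e, Fin.succ_lt_succ_iff]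
      refine h₁ i j (Fin.succAbove_lt_succAbove_iff.1 hij) ?_
      rw [hv] at hj
      split_ifs at hj <;> omega
    · obtain rfl | ⟨j, rfl⟩ := hi' j
      · have := Fin.lt_def.1 hij
        omega
      obtain rfl | ⟨i, rfl⟩ := hi' i
      · rw [e, e₀]
        exact Fin.succ_pos _
      rw [e, e, Fin.succ_lt_succ_iff]
      rw [hv] at hj hi
      refine h₂ i j ?_ (Fin.succAbove_lt_succAbove_iff.1 hij) ?_
      · split_ifs at hi <;> omega
      · split_ifs at hj <;> omega
    · obtain rfl | ⟨i, rfl⟩ := hi' i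
      · omega
      rw [hv] at hi
      rw [e, h₃ i (by split_ifs at hi <;> omega)]
      ext
      rw [Fin.val_succ, hv]
      split_ifs at hi ⊢ <;> omega

/-- Both blocks are increasing, so the least value can only stand at the beginning of one of them.
It cannot lie in the fixed tail, which does not contain the index `0` when `0 < k + q`. -/
theorem apply_zero_of_mem {σ : Perm (Fin (N + 1))} (hσ : σ ∈ initialShuffles (N + 1) k q)
    {a : Fin (N + 1)} (ha : σ a = 0) (hkq : 0 < k + q) :
    (a = 0 ∧ 0 < k) ∨ ((a : ℕ) = k ∧ 0 < q) := by
  obtain ⟨h₁, h₂, h₃⟩ := mem_initialShuffles.1 hσ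
  have lt : ∀ b, ¬ σ b < σ a := fun b => by rw [ha]; exact Fin.not_lt_zero _
  rcases lt_or_ge (a : ℕ) k with h | h
  · by_cases h₀ : a = 0
    · exact .inl ⟨h₀, by omega⟩
    · exact (lt 0 (h₁ 0 a (Fin.pos_of_ne_zero h₀) h)).elim
  · rcases lt_or_ge (a : ℕ) (k + q) with h' | h'
    · rcases Nat.eq_or_lt_of_le h with h'' | h''
      · exact .inr ⟨h''.symm, by omega⟩
      · have := a.2
        exact (lt ⟨k, by omega⟩ (h₂ ⟨k, by omega⟩ a le_rfl (Fin.lt_def.2 h'') h')).elim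
    · have := h₃ a h'
      rw [ha] at this
      rw [← this, Fin.val_zero] at h'
      omega

theorem initialShuffles_succ_zero : initialShuffles (N + 1) (k + 1) 0
    = (initialShuffles N k 0).map ⟨extendPerm 0, extendPerm_injective 0⟩ := by
  ext σ
  simp only [Finset.mem_map, Function.Embedding.coeFn_mk]
  constructor
  · intro hσ
    obtain ⟨a, ha⟩ := σ.surjective 0
    obtain ⟨rfl, -⟩ | ⟨-, h⟩ := apply_zero_of_mem hσ ha (by omega)
    · obtain ⟨τ, rfl⟩ := exists_eq_extendPerm ha
      exact ⟨τ, extendPerm_zero_mem.1 hσ, rfl⟩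
    · omega
  · rintro ⟨τ, hτ, rfl⟩
    exact extendPerm_zero_mem.2 hτ

theorem initialShuffles_zero_succ : initialShuffles (N + 1) 0 (q + 1)
    = (initialShuffles N 0 q).map ⟨extendPerm 0, extendPerm_injective 0⟩ := by
  ext σ
  simp only [Finset.mem_map, Function.Embedding.coeFn_mk]
  constructor
  · intro hσ
    obtain ⟨a, ha⟩ := σ.surjective 0
    obtain ⟨-, h⟩ | ⟨h, -⟩ := apply_zero_of_mem hσ ha (by omega)
    · omega
    · obtain rfl : a = 0 := Fin.ext h
      obtain ⟨τ, rfl⟩ := exists_eq_extendPerm ha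
      exact ⟨τ, (extendPerm_mem h).1 hσ, rfl⟩
  · rintro ⟨τ, hτ, rfl⟩
    exact (extendPerm_mem rfl).2 hτ

/-- A Pascal recursion: the first letter opens either the first or the second block. -/
theorem initialShuffles_succ_succ (h : k + 1 < N + 1) : initialShuffles (N + 1) (k + 1) (q + 1)
    = (initialShuffles N k (q + 1)).map ⟨extendPerm 0, extendPerm_injective 0⟩
      ∪ (initialShuffles N (k + 1) q).map ⟨extendPerm ⟨k + 1, h⟩, extendPerm_injective _⟩ := by
  ext σ
  simp only [Finset.mem_union, Finset.mem_map, Function.Embedding.coeFn_mk]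
  constructor
  · intro hσ
    obtain ⟨a, ha⟩ := σ.surjective 0
    obtain ⟨rfl, -⟩ | ⟨h', -⟩ := apply_zero_of_mem hσ ha (by omega)
    · obtain ⟨τ, rfl⟩ := exists_eq_extendPerm ha
      exact .inl ⟨τ, extendPerm_zero_mem.1 hσ, rfl⟩
    · obtain rfl : a = ⟨k + 1, h⟩ := Fin.ext h'
      obtain ⟨τ, rfl⟩ := exists_eq_extendPerm ha
      exact .inr ⟨τ, (extendPerm_mem h').1 hσ, rfl⟩
  · rintro (⟨τ, hτ, rfl⟩ | ⟨τ, hτ, rfl⟩)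
    · exact extendPerm_zero_mem.2 hτ
    · exact (extendPerm_mem rfl).2 hτ

theorem disjoint_initialShuffles (h : k + 1 < N + 1) (s t : Finset (Perm (Fin N))) : Disjoint
    (s.map ⟨extendPerm 0, extendPerm_injective 0⟩)
    (t.map ⟨extendPerm ⟨k + 1, h⟩, extendPerm_injective _⟩) := by
  rw [Finset.disjoint_left]
  intro σ h₁ h₂
  simp only [Finset.mem_map, Function.Embedding.coeFn_mk] at h₁ h₂
  obtain ⟨τ, -, rfl⟩ := h₁
  obtain ⟨τ', -, e⟩ := h₂
  have : (0 : Fin (N + 1)) = ⟨k + 1, h⟩ := (extendPerm 0 τ).injective (by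
    rw [extendPerm_self, ← e, extendPerm_self])
  simp [Fin.ext_iff] at this

variable {α W : Type*} [AddCommGroup W]

/-- The signed sum of `G` over the ways of distributing the first `k + q` letters of a word into
two words of lengths `k` and `q`, keeping the order of the letters, by recursion on the word. The
third argument of `G` is the rest of the word. -/
def shuffleSum (χ : α → α → ℤˣ) : List α → ℕ → ℕ → (List α → List α → List α → W) → W
  | w, 0, 0, G => G [] [] w
  -- The word is too short for the requested lengths; the uses of the sum have `k + q` at most the
  -- length.
  | [], _, _, _ => 0
  | x :: w, k + 1, 0, G => shuffleSum χ w k 0 fun I J r => G (x :: I) J r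
  | x :: w, 0, q + 1, G => shuffleSum χ w 0 q fun I J r => G I (x :: J) r
  | x :: w, k + 1, q + 1, G => shuffleSum χ w k (q + 1) (fun I J r => G (x :: I) J r)
      + shuffleSum χ w (k + 1) q fun I J r => (I.map fun y => χ y x).prod • G I (x :: J) r

/-- The Pascal recursion of the shuffles agrees with the recursion defining `shuffleSum`: a letter
that opens the second block is moved past the whole first block `I`, at the cost of the signs `χ y
x`. With a general `χ` this serves both the signature and the Koszul sign. -/
theorem sum_initialShuffles (χ : α → α → ℤˣ) (X : Fin N → α) (h : k + q ≤ N)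
    (G : List α → List α → List α → W) :
    ∑ σ ∈ initialShuffles N k q, inversionSign (fun i j => χ (X i) (X j)) σ •
      G ((List.ofFn fun i => X (σ i)).take k) (((List.ofFn fun i => X (σ i)).drop k).take q)
        ((List.ofFn fun i => X (σ i)).drop (k + q))
      = shuffleSum χ (List.ofFn X) k q G := by
  induction N generalizing k q G with
  | zero =>
    obtain rfl : k = 0 := by omega
    obtain rfl : q = 0 := by omega
    rw [initialShuffles_zero_zero]
    simp [shuffleSum, inversionSign]
  | succ N ih =>
    rcases k with _ | k <;> rcases q with _ | q
    · rw [initialShuffles_zero_zero]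
      have : inversionSign (fun i j => χ (X i) (X j)) 1 = 1 := by
        refine Finset.prod_eq_one fun i _ => Finset.prod_eq_one fun j _ => if_neg ?_
        simp only [Perm.one_apply]
        omega
      simp [shuffleSum, this]
    · rw [initialShuffles_zero_succ, Finset.sum_map, List.ofFn_succ, shuffleSum, ← ih _ (by omega)]
      refine Finset.sum_congr rfl fun τ _ => ?_
      simp only [Function.Embedding.coeFn_mk, inversionSign_extendPerm, ofFn_extendPerm]
      simp
    · rw [initialShuffles_succ_zero, Finset.sum_map, List.ofFn_succ, shuffleSum, ← ih _ (by omega)]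
      refine Finset.sum_congr rfl fun τ _ => ?_
      simp only [Function.Embedding.coeFn_mk, inversionSign_extendPerm, ofFn_extendPerm]
      simp
    · rw [initialShuffles_succ_succ (by omega), Finset.sum_union (disjoint_initialShuffles _ _ _),
        Finset.sum_map, Finset.sum_map, List.ofFn_succ, shuffleSum, ← ih _ (by omega),
        ← ih _ (by omega)]
      congr 1
      · refine Finset.sum_congr rfl fun τ _ => ?_
        simp only [Function.Embedding.coeFn_mk, inversionSign_extendPerm, ofFn_extendPerm]
        simp [add_right_comm k 1 (q + 1)]
      · refine Finset.sum_congr rfl fun τ _ => ?_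
        simp only [Function.Embedding.coeFn_mk, inversionSign_extendPerm, ofFn_extendPerm]
        have hl : ((List.ofFn fun i => X (τ i).succ).take (k + 1)).length = k + 1 := by
          simp; omega
        generalize (List.ofFn fun i => X (τ i).succ) = w at hl ⊢
        have e : ((w.take (k + 1)) ++ X 0 :: w.drop (k + 1)).drop (k + 1 + (q + 1))
            = w.drop (k + 1 + q) := by
          rw [← List.drop_drop, List.drop_left' hl, List.drop_succ_cons, List.drop_drop]
        rw [e, List.take_left' hl, List.drop_left' hl, List.take_succ_cons, mul_comm, mul_smul]

theorem shuffleSum_congr (χ : α → α → ℤˣ) (w : List α) (h : k + q ≤ w.length)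
    {G G' : List α → List α → List α → W}
    (hG : ∀ I J r, I.length = k → J.length = q → k + q + r.length = w.length →
      G I J r = G' I J r) : shuffleSum χ w k q G = shuffleSum χ w k q G' := by
  induction w generalizing k q G G' with
  | nil =>
    simp only [List.length_nil] at h
    obtain rfl : k = 0 := by omega
    obtain rfl : q = 0 := by omega
    exact hG [] [] [] rfl rfl rfl
  | cons x w ih =>
    rw [List.length_cons] at h
    rcases k with _ | k <;> rcases q with _ | q
    · exact hG _ _ _ rfl rfl (by simp)
    · exact ih (by omega) fun I J r hI hJ hr =>
        hG _ _ _ hI (by simp [hJ]) (by simp only [List.length_cons]; omega)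
    · exact ih (by omega) fun I J r hI hJ hr =>
        hG _ _ _ (by simp [hI]) hJ (by simp only [List.length_cons]; omega)
    · rw [shuffleSum, shuffleSum]
      congr 1
      · exact ih (by omega) fun I J r hI hJ hr =>
          hG _ _ _ (by simp [hI]) hJ (by simp only [List.length_cons]; omega)
      · refine ih (by omega) fun I J r hI hJ hr => ?_
        rw [hG _ _ _ hI (by simp [hJ]) (by simp only [List.length_cons]; omega)]

theorem shuffleSum_zsmul (χ : α → α → ℤˣ) (w : List α) (n : ℤ)
    (G : List α → List α → List α → W) :
    shuffleSum χ w k q (fun I J r => n • G I J r) = n • shuffleSum χ w k q G := by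
  induction w generalizing k q G with
  | nil => rcases k with _ | k <;> rcases q with _ | q <;> simp [shuffleSum]
  | cons x w ih =>
    rcases k with _ | k <;> rcases q with _ | q
    · simp [shuffleSum]
    · simp only [shuffleSum, ih]
    · simp only [shuffleSum, ih]
    · simp only [shuffleSum, ih, smul_add, smul_comm _ n]

end ShuffleSums

/-! ### The product of cochains in terms of words -/

section WordFormula

variable {V W : Type*} [AddCommGroup V] [AddCommGroup W]

/-- The function `Q` is supported on the words of length `q`. -/
def HasLength {U : Type*} [Zero U] (q : ℕ) (Q : List (V × V) → U) : Prop :=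
  ∀ l, l.length ≠ q → Q l = 0

theorem HasLength.hasParity {U : Type*} [Zero U] {q : ℕ} {Q : List (V × V) → U}
    (hQ : HasLength q Q) : HasParity ((-1) ^ q) Q :=
  fun l hl => hQ l fun h => hl (by rw [h])

theorem HasLength.contract {U : Type*} [Zero U] {q : ℕ} {Q : List (V × V) → U}
    (hQ : HasLength (q + 1) Q) (X : V × V) : HasLength q (contract X Q) :=
  fun l hl => hQ _ (by simpa using hl)

theorem HasLength.contract_eq_zero {U : Type*} [Zero U] {Q : List (V × V) → U}
    (hQ : HasLength 0 Q) (X : V × V) : LieTriple.contract X Q = 0 :=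
  funext fun _ => hQ _ (by simp)

/-- The effect of the derivation `Q J` on the first letter of `r`, inserted into `F` after `I`. -/
def derivTerm (F : List (V × V) → V → W) (Q : List (V × V) → V → V) (z : V)
    (I J : List (V × V)) : List (V × V) → W
  | [] => 0
  | v :: r => F (I ++ (Q J v.1, v.2) :: r) z + F (I ++ (v.1, Q J v.2) :: r) z

theorem derivTerm_cons_left (F : List (V × V) → V → W) (Q : List (V × V) → V → V) (z : V)
    (X : V × V) (I J r : List (V × V)) :
    derivTerm F Q z (X :: I) J r = derivTerm (contract X F) Q z I J r := by
  cases r <;> rfl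

theorem derivTerm_cons_right (F : List (V × V) → V → W) (Q : List (V × V) → V → V) (z : V)
    (X : V × V) (I J r : List (V × V)) :
    derivTerm F Q z I (X :: J) r = derivTerm F (contract X Q) z I J r := by
  cases r <;> rfl

/-- When all letters anticommute, passing the first block costs a sign that depends only on its
length `k + 1`, so the sign leaves the sum. -/
theorem shuffleSum_odd {α : Type*} {k q : ℕ} (x : α) (w : List α) (h : k + 1 + q ≤ w.length)
    (G : List α → List α → List α → W) :
    shuffleSum (fun _ _ => -1) (x :: w) (k + 1) (q + 1) G
      = shuffleSum (fun _ _ => -1) w k (q + 1) (fun I J r => G (x :: I) J r)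
        + ((-1 : ℤ) ^ (k + 1)) • shuffleSum (fun _ _ => -1) w (k + 1) q
          fun I J r => G I (x :: J) r := by
  rw [shuffleSum, ← shuffleSum_zsmul]
  congr 1
  refine shuffleSum_congr _ _ h fun I J r hI _ _ => ?_
  rw [List.map_const', List.prod_replicate, hI, Units.smul_def]
  simp

/-- The recursive product unfolds to the shuffle formula. At each stage the first letter goes to the
outer word `I`, to the inner word `J`, or, once `Q` has received all its letters, it is the letter
on which the derivation acts. -/
theorem wordCirc_eq_shuffleSum {p q : ℕ} {F : List (V × V) → V → W} {Q : List (V × V) → V → V}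
    (aF : IsMultiadditive F) (hF : HasLength p F) (hQ : HasLength q Q) (w : List (V × V))
    (hw : w.length = p + q) (z : V) :
    wordCirc ((-1) ^ q) F Q w z
      = (∑ k ∈ Finset.range p, ((-1 : ℤ) ^ (k * q)) •
          shuffleSum (fun _ _ => -1) w k q (derivTerm F Q z))
        + ((-1 : ℤ) ^ (p * q)) • shuffleSum (fun _ _ => -1) w p q fun I J _ => F I (Q J z) := by
  induction w generalizing p q F Q with
  | nil =>
    rw [List.length_nil] at hw
    obtain rfl : p = 0 := by omega
    obtain rfl : q = 0 := by omega
    simp [wordCirc_nil, shuffleSum]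
  | cons X w ih =>
    rw [List.length_cons] at hw
    rcases p with _ | p <;> rcases q with _ | q
    · omega
    -- `F` takes no letters, so `X` can only be absorbed by `Q`.
    · have i := ih aF hF (hQ.contract X) (by omega)
      have h₀ : Q [] = 0 := hQ _ (by simp)
      simp only [Finset.range_zero, Finset.sum_empty, zero_add, zero_mul, pow_zero, one_smul]
        at i ⊢
      rw [wordCirc_cons, hF.contract_eq_zero, wordCirc_zero_left, pow_succ, mul_neg_one, neg_neg,
        i, shuffleSum, hF.contract_eq_zero, hF.contract_eq_zero]
      simp [contract]
    -- `Q` takes no letters: `X` either goes to `F` or is acted on by `Q []`. The latter is the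
    -- summand `k = 0`.
    · have i := ih (aF.contract X) (hF.contract X) hQ (by omega)
      simp only [pow_zero, mul_zero, one_smul] at i ⊢
      rw [wordCirc_cons, hQ.contract_eq_zero, wordCirc_zero_right aF, i, Finset.sum_range_succ']
      have d : derivTerm F Q z [] [] (X :: w)
        = contract (Q [] X.1, X.2) F w z + contract (X.1, Q [] X.2) F w z := rfl
      simp only [shuffleSum, derivTerm_cons_left, d]
      simp only [Units.val_one, one_smul, Pi.zero_apply, add_zero]
      rw [add_right_comm]
      rfl
    · have i₁ := ih (aF.contract X) (hF.contract X) hQ (by omega)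
      have i₂ := ih aF hF (hQ.contract X) (by omega)
      have h₀ : Q [] = 0 := hQ _ (by simp)
      have s : (-(-1) ^ (q + 1) : ℤˣ) = (-1) ^ q := by rw [pow_succ]; simp
      have e : ∀ k, k + 1 ≤ p + 1 → ∀ G, shuffleSum (W := W) (fun _ _ => -1) (X :: w) (k + 1)
          (q + 1) G = _ := fun k hk G => shuffleSum_odd X w (by omega) G
      -- Giving a letter to `Q` lowers its degree by one; the sign for passing the `a` outer letters
      -- makes up the difference between `a * (q + 1)` and `a * q`.
      have sgn : ∀ a : ℕ, (-1 : ℤ) ^ (a * (q + 1)) * (-1) ^ a = (-1) ^ (a * q) := fun a => by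
        rw [← pow_add, show a * (q + 1) + a = a * q + 2 * a by ring, pow_add, pow_mul _ 2]
        simp
      have sgn' : ∀ a : ℕ, (-1 : ℤ) ^ ((a + 1) * (q + 1))
          = (-1) ^ (q + 1) * (-1) ^ (a * (q + 1)) := fun a => by ring
      rw [wordCirc_cons, s, i₁, i₂, h₀, Pi.zero_apply, Pi.zero_apply, aF.contract_zero_fst,
        aF.contract_zero_snd, Finset.sum_range_succ' _ p, Finset.sum_range_succ' _ p]
      -- Since `Q [] = 0`, each summand with a nonempty outer word splits in two. The first part is
      -- a summand of `i₁` with index lowered by one, the second a summand of `i₂`; the summand `k =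
      -- 0` comes from `i₂` alone.
      have h : ∀ k ∈ Finset.range p, ((-1 : ℤ) ^ ((k + 1) * (q + 1))) •
          shuffleSum (fun _ _ => -1) (X :: w) (k + 1) (q + 1) (derivTerm F Q z)
          = (((-1) ^ (q + 1) : ℤˣ) : ℤ) • ((-1 : ℤ) ^ (k * (q + 1))) •
              shuffleSum (fun _ _ => -1) w k (q + 1) (derivTerm (contract X F) Q z)
            + ((-1 : ℤ) ^ ((k + 1) * q)) •
              shuffleSum (fun _ _ => -1) w (k + 1) q (derivTerm F (contract X Q) z) := by
        intro k hk
        rw [e k (by have := Finset.mem_range.1 hk; omega), smul_add, smul_smul, sgn, sgn',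
          mul_smul]
        simp only [derivTerm_cons_left, derivTerm_cons_right]
        simp
      rw [Finset.sum_congr rfl h, Finset.sum_add_distrib, ← Finset.smul_sum, e p le_rfl,
        smul_add ((-1 : ℤ) ^ ((p + 1) * (q + 1))), smul_smul ((-1 : ℤ) ^ ((p + 1) * (q + 1))), sgn,
        sgn' p, mul_smul]
      simp only [shuffleSum, derivTerm_cons_right, zero_mul, pow_zero, one_smul, smul_add,
        Pi.zero_apply, add_zero, Units.val_pow_eq_pow_val, Units.val_neg, Units.val_one]
      simp only [contract]
      abel

end WordFormula

/-! ### Cochains as functions of words -/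

section ToWord

variable {K V W : Type*} [Field K] [AddCommGroup V] [Module K V] [AddCommGroup W] [Module K W]

/-- The function of words that is `f` on the words of length `n` and zero on the others. -/
def toWord {n : ℕ} (f : (Fin n → V × V) → V → W) (l : List (V × V)) : V → W :=
  if h : l.length = n then f fun i => l[i] else 0

theorem toWord_hasLength {n : ℕ} (f : (Fin n → V × V) → V → W) : HasLength n (toWord f) :=
  fun _ hl => dif_neg hl

theorem toWord_eq {n : ℕ} (f : (Fin n → V × V) → V → W) {l : List (V × V)} (g : Fin n → V × V)
    (h : l = List.ofFn g) : toWord f l = f g := by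
  subst h
  rw [toWord, dif_pos (List.length_ofFn)]
  congr 1
  funext i
  simp

theorem toWord_append_cons {n : ℕ} (f : (Fin n → V × V) → V → W) (l₁ l₂ : List (V × V))
    (h : l₁.length + 1 + l₂.length = n) : ∃ X : Fin n → V × V, ∀ v,
      toWord f (l₁ ++ v :: l₂) = f (Function.update X ⟨l₁.length, by omega⟩ v) := by
  refine ⟨fun i => (l₁ ++ 0 :: l₂)[i]'(by have := i.2; simp; omega), fun v => ?_⟩
  refine toWord_eq _ _ (List.ext_getElem (by simp; omega) fun i h₁ h₂ => ?_)
  rw [List.getElem_ofFn, Function.update_apply]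
  simp only [Fin.mk.injEq, Fin.getElem_fin]
  split_ifs with hi
  · subst hi
    simp
  · simp only [List.getElem_append]
    split_ifs with h'
    · rfl
    · obtain ⟨m, hm⟩ : ∃ m, i - l₁.length = m + 1 := ⟨i - l₁.length - 1, by omega⟩
      simp only [hm, List.getElem_cons_succ]

theorem IsCochain.isMultiadditive {n : ℕ} {f : (Fin n → V × V) → V → W} (hf : IsCochain K f) :
    IsMultiadditive (toWord f) := by
  refine ⟨fun l a b => ?_, fun l₁ l₂ x x' y z => ?_, fun l₁ l₂ x y y' z => ?_⟩
  · by_cases h : l.length = n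
    · simp only [toWord, dif_pos h]
      simpa using hf.lin_last _ 1 a b
    · simp [toWord, h]
  · by_cases h : l₁.length + 1 + l₂.length = n
    · obtain ⟨X, hX⟩ := toWord_append_cons f l₁ l₂ h
      simp only [hX]
      simpa using hf.lin_fst X _ z 1 x x' y
    · have h' : ∀ v, toWord f (l₁ ++ v :: l₂) = 0 := fun v =>
        toWord_hasLength f _ (by simp; omega)
      simp [h']
  · by_cases h : l₁.length + 1 + l₂.length = n
    · obtain ⟨X, hX⟩ := toWord_append_cons f l₁ l₂ h
      simp only [hX]
      simpa using hf.lin_snd X _ z 1 x y y'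
    · have h' : ∀ v, toWord f (l₁ ++ v :: l₂) = 0 := fun v =>
        toWord_hasLength f _ (by simp; omega)
      simp [h']

theorem inversionSign_neg_one {N : ℕ} (σ : Perm (Fin N)) :
    inversionSign (fun _ _ => -1) σ = Perm.sign σ := by
  rw [Perm.sign_eq_prod_prod_Ioi, inversionSign]
  refine Finset.prod_congr rfl fun i _ => ?_
  rw [← Finset.prod_filter_mul_prod_filter_not Finset.univ (fun j => i < j)]
  have h₁ : Finset.univ.filter (fun j => i < j) = Finset.Ioi i := by ext; simp
  rw [h₁, Finset.prod_eq_one (s := Finset.univ.filter fun j => ¬ i < j), mul_one]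
  · refine Finset.prod_congr rfl fun j hj => ?_
    have hij := Finset.mem_Ioi.1 hj
    have hne : σ i ≠ σ j := fun h => hij.ne (σ.injective h)
    rcases lt_or_gt_of_ne hne with h | h
    · simp [hij, h, h.le, not_lt.2 h.le]
    · simp [hij, h, not_lt.2 h.le]
  · intro j hj
    simp [(Finset.mem_filter.1 hj).2]

/-- This lets the product defined by shuffles be studied by induction on words: with the constant
sign -1 the inversion sign is the signature, and the two sums in `circFun` are those of
`wordCirc_eq_shuffleSum`. -/
theorem wordCirc_toWord {p q : ℕ} {P : (Fin p → V × V) → V → V} {Q : (Fin q → V × V) → V → V}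
    (hP : IsCochain K P) (X : Fin (p + q) → V × V) (z : V) :
    wordCirc ((-1) ^ q) (toWord P) (toWord Q) (List.ofFn X) z = circFun P Q X z := by
  rw [wordCirc_eq_shuffleSum hP.isMultiadditive (toWord_hasLength P) (toWord_hasLength Q) _
    (by simp), circFun, Finset.sum_range]
  have hinner : ∀ (k : ℕ) (hk : k ≤ p) (σ : Perm (Fin (p + q))),
      toWord Q (((List.ofFn fun i => X (σ i)).drop k).take q) = Q (inner k hk σ X) := by
    intro k hk σ
    refine toWord_eq _ _ (List.ext_getElem (by simp; omega) fun i h₁ h₂ => ?_)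
    simp [inner]
  congr 1
  · refine Finset.sum_congr rfl fun k _ => ?_
    have hk := k.2
    rw [← sum_initialShuffles _ X (by omega), Finset.smul_sum]
    refine Finset.sum_congr rfl fun σ _ => ?_
    rw [inversionSign_neg_one, mul_smul, Units.smul_def]
    congr 2
    have e : (List.ofFn fun i => X (σ i)).drop (k + q) = outer k σ X k ::
        (List.ofFn fun i => X (σ i)).drop (k + q + 1) := by
      rw [List.drop_eq_getElem_cons (by simp)]
      simp [outer]
    have houter : ∀ v, toWord P ((List.ofFn fun i => X (σ i)).take k ++
        v :: (List.ofFn fun i => X (σ i)).drop (k + q + 1))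
          = P (Function.update (outer k σ X) k v) := by
      intro v
      refine toWord_eq _ _ (List.ext_getElem (by simp; omega) fun i h₁ h₂ => ?_)
      rw [List.getElem_ofFn, Function.update_apply]
      simp only [List.getElem_append, List.length_take, List.length_ofFn, List.getElem_take,
        List.getElem_ofFn, Fin.ext_iff]
      have hi : i < p := by simpa using h₂
      split_ifs with h h' h'
      · omega
      · have : i < (k : ℕ) := by omega
        simp [outer, this]
      · simp [show i - min (k : ℕ) (p + q) = 0 by omega]
      · obtain ⟨m, hm⟩ : ∃ m, i - min (k : ℕ) (p + q) = m + 1 :=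
          ⟨i - min (k : ℕ) (p + q) - 1, by omega⟩
        simp only [hm, List.getElem_cons_succ, List.getElem_drop, List.getElem_ofFn, outer]
        congr 3
        split_ifs <;> omega
    rw [e]
    simp only [derivTerm, houter, hinner k hk.le]
    rfl
  · rw [← sum_initialShuffles _ X le_rfl, Finset.smul_sum]
    refine Finset.sum_congr rfl fun σ _ => ?_
    rw [inversionSign_neg_one, mul_smul, Units.smul_def, hinner p le_rfl]
    congr 2
    rw [toWord_eq P (outer p σ X)]
    refine List.ext_getElem (by simp) fun i h₁ h₂ => ?_
    have hi : i < p := by simpa using h₂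
    simp [outer, hi]

end ToWord

/-! ### The graded Lie algebra `C^*(V, V)` -/

section GradedLie

variable {V : Type*} [AddCommGroup V]

/-- `wordCirc_wordBracket`, applied with each of `P`, `Q`, `R` in the role of `F`, rewrites the
three terms in which a commutator is inserted. What remains are double insertions of the form `(A ∘
B) ∘ C`, which cancel in pairs. -/
theorem wordBracket_jacobi {p q r : ℤˣ} {P Q R : List (V × V) → V → V} (aP : IsMultiadditive P)
    (aQ : IsMultiadditive Q) (aR : IsMultiadditive R) (hP : HasParity p P) (hQ : HasParity q Q)
    (hR : HasParity r R) : wordBracket (p * q) r (wordBracket p q P Q) R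
      = wordBracket p (q * r) P (wordBracket q r Q R)
        + swapSign q r • wordBracket (p * r) q (wordBracket p r P R) Q := by
  have h₁ := wordCirc_wordBracket aP aQ aR hQ hR
  have h₂ := wordCirc_wordBracket aQ aP aR hP hR
  have h₃ := wordCirc_wordBracket aR aP aQ hP hQ
  have e : ∀ s t (F G : List (V × V) → V → V),
    wordBracket s t F G = wordCirc t F G + (-swapSign s t) • wordCirc s G F := fun _ _ _ _ => rfl
  rw [e (p * q), e p (q * r), e (p * r), h₁, h₂, h₃]
  simp only [wordBracket, wordCirc_add_left, wordCirc_zsmul_left, smul_add, smul_smul]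
  rcases Int.units_eq_one_or p with rfl | rfl <;> rcases Int.units_eq_one_or q with rfl | rfl <;>
    rcases Int.units_eq_one_or r with rfl | rfl <;>
    simp only [swapSign_one_left, swapSign_one_right, swapSign_neg_one, one_mul, mul_one,
      neg_mul, mul_neg, neg_neg] <;> module

theorem swapSign_pow (p q : ℕ) : swapSign ((-1) ^ p) ((-1) ^ q) = (-1) ^ (p * q) := by
  rcases Nat.even_or_odd p with hp | hp <;> rcases Nat.even_or_odd q with hq | hq
  · rw [hp.neg_one_pow, swapSign_one_left, (hp.mul_right q).neg_one_pow]
  · rw [hp.neg_one_pow, swapSign_one_left, (hp.mul_right q).neg_one_pow]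
  · rw [hq.neg_one_pow, swapSign_one_right, (hq.mul_left p).neg_one_pow]
  · rw [hp.neg_one_pow, hq.neg_one_pow, swapSign_neg_one, (hp.mul hq).neg_one_pow]

theorem wordCirc_hasLength {p q : ℕ} {s : ℤˣ} {F Q : List (V × V) → V → V}
    (aF : IsMultiadditive F) (hF : HasLength p F) (hQ : HasLength q Q) :
    HasLength (p + q) (wordCirc s F Q) := by
  intro l hl
  funext z
  induction l generalizing p q s F Q with
  | nil =>
    rw [wordCirc_nil]
    by_cases h : q = 0
    · rw [hF [] (by simp only [List.length_nil] at hl ⊢; omega), Pi.zero_apply, Pi.zero_apply]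
    · rw [hQ [] (by simp only [List.length_nil]; omega), Pi.zero_apply, aF.last_zero]
  | cons X l ih =>
    rw [List.length_cons] at hl
    have h₁ : wordCirc s (contract X F) Q l z = 0 := by
      rcases p with _ | p
      · rw [hF.contract_eq_zero, wordCirc_zero_left]; rfl
      · exact ih (aF.contract X) (hF.contract X) hQ (by omega)
    have h₂ : wordCirc (-s) F (contract X Q) l z = 0 := by
      rcases q with _ | q
      · rw [hQ.contract_eq_zero, wordCirc_zero_right aF]; rfl
      · exact ih aF hF (hQ.contract X) (by omega)
    rw [wordCirc_cons, h₁, h₂]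
    by_cases h : q = 0
    · have h₃ : ∀ v, F (v :: l) = 0 := fun v => hF _ (by rw [List.length_cons]; omega)
      simp [contract, h₃]
    · simp [hQ [] (by simp only [List.length_nil]; omega), aF.contract_zero_fst,
        aF.contract_zero_snd]

variable {K W : Type*} [Field K] [Module K V] [AddCommGroup W] [Module K W]

/-- The elements of `C^*(V, W)` as functions of words. -/
def words : GradedCochain K V W →ₗ[K] List (V × V) → V → W where
  toFun F l := (F l.length).1 fun i => l[i]
  map_add' F G := rfl
  map_smul' a F := rfl

/-- Identities in `C^*(V, W)` may thus be checked on words, with no transport between `C^(p+q)` and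
`C^(q+p)`. -/
theorem words_injective : Function.Injective (words (K := K) (V := V) (W := W)) := by
  intro F G h
  refine DFinsupp.ext fun n => Cochain.ext fun X z => ?_
  have := congrFun (congrFun h (List.ofFn X)) z
  have e : ∀ F : GradedCochain K V W, words F (List.ofFn X) = (F n).1 X := by
    intro F
    -- The length of `List.ofFn X` equals `n` only propositionally, so the degree is generalized
    -- before it is identified with `n`.
    have aux : ∀ m (hm : m = n), (F m).1 (fun i => X (Fin.cast hm i)) = (F n).1 X := by
      rintro m rfl
      rfl
    rw [← aux _ (List.length_ofFn)]
    refine congrArg (F (List.ofFn X).length).1 (funext fun i => ?_)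
    rw [Fin.getElem_fin, List.getElem_ofFn]
    rfl
  rwa [e, e] at this

theorem words_lof {n : ℕ} (f : Cochain K V W n) :
    words (DirectSum.lof K ℕ (Cochain K V W) n f) = toWord f.1 := by
  funext l
  by_cases h : l.length = n
  · subst h
    rw [toWord, dif_pos rfl]
    change (DirectSum.of (Cochain K V W) _ f _).1 _ = _
    rw [DirectSum.of_eq_same]
  · rw [toWord_hasLength f.1 l h]
    change (DirectSum.of (Cochain K V W) n f l.length).1 _ = _
    rw [DirectSum.of_eq_of_ne _ _ _ h]
    rfl

theorem words_circ {p q : ℕ} (P : Cochain K V V p) (Q : Cochain K V V q) :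
    words (DirectSum.lof K ℕ (Cochain K V V) (p + q) (circ p q P Q))
      = wordCirc ((-1) ^ q) (toWord P.1) (toWord Q.1) := by
  rw [words_lof]
  funext l z
  by_cases h : l.length = p + q
  · obtain ⟨X, rfl⟩ : ∃ X : Fin (p + q) → V × V, l = List.ofFn X :=
      ⟨fun i => l[i], List.ext_getElem (by simpa using h) fun i h₁ h₂ => by simp⟩
    rw [wordCirc_toWord P.2, toWord_eq _ X rfl]
    rfl
  · rw [toWord_hasLength _ l h, wordCirc_hasLength P.2.isMultiadditive (toWord_hasLength _)
      (toWord_hasLength _) l h]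

theorem mem_cochainGrading_natCast {n : ℕ} {F : GradedCochain K V W} :
    F ∈ cochainGrading K V W n ↔ ∃ f, DirectSum.lof K ℕ (Cochain K V W) n f = F := Iff.rfl

theorem words_bracket {p q : ℕ} {F G : GradedCochain K V V} (hF : F ∈ cochainGrading K V V p)
    (hG : G ∈ cochainGrading K V V q) :
    words (bracket F G) = wordBracket ((-1) ^ p) ((-1) ^ q) (words F) (words G) := by
  obtain ⟨f, rfl⟩ := mem_cochainGrading_natCast.1 hF
  obtain ⟨g, rfl⟩ := mem_cochainGrading_natCast.1 hG
  rw [bracket_lof, map_sub, map_zsmul, words_circ, words_circ, words_lof, words_lof, wordBracket,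
    swapSign_pow, neg_smul, sub_eq_add_neg]

/-- The grading is zero in negative degrees; this reduces statements about integer degrees to
natural ones. -/
theorem exists_natCast_of_mem {d : ℤ} {F : GradedCochain K V W} (hF : F ∈ cochainGrading K V W d)
    (h : F ≠ 0) : ∃ n : ℕ, d = n := by
  cases d with
  | ofNat n => exact ⟨n, rfl⟩
  | negSucc n => exact (h hF).elim

theorem bracket_mem {p q : ℤ} {F G : GradedCochain K V V} (hF : F ∈ cochainGrading K V V p)
    (hG : G ∈ cochainGrading K V V q) : bracket F G ∈ cochainGrading K V V (p + q) := by
  by_cases h₁ : F = 0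
  · simp [h₁]
  by_cases h₂ : G = 0
  · simp [h₂]
  obtain ⟨p, rfl⟩ := exists_natCast_of_mem hF h₁
  obtain ⟨q, rfl⟩ := exists_natCast_of_mem hG h₂
  obtain ⟨f, rfl⟩ := mem_cochainGrading_natCast.1 hF
  obtain ⟨g, rfl⟩ := mem_cochainGrading_natCast.1 hG
  rw [bracket_lof, ← Nat.cast_add]
  refine Submodule.sub_mem _ (mem_cochainGrading_natCast.2 ⟨_, rfl⟩) ?_
  refine zsmul_mem ?_ _
  rw [add_comm p q]
  exact mem_cochainGrading_natCast.2 ⟨_, rfl⟩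

theorem words_isMultiadditive {p : ℤ} {F : GradedCochain K V W}
    (hF : F ∈ cochainGrading K V W p) : IsMultiadditive (words F) := by
  by_cases h₁ : F = 0
  · subst h₁
    constructor <;> simp
  obtain ⟨p, rfl⟩ := exists_natCast_of_mem hF h₁
  obtain ⟨f, rfl⟩ := mem_cochainGrading_natCast.1 hF
  rw [words_lof]
  exact f.2.isMultiadditive

theorem words_hasParity {p : ℕ} {F : GradedCochain K V W}
    (hF : F ∈ cochainGrading K V W p) : HasParity ((-1) ^ p) (words F) := by
  obtain ⟨f, rfl⟩ := mem_cochainGrading_natCast.1 hF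
  rw [words_lof]
  exact (toWord_hasLength _).hasParity

theorem negOnePow_natCast_mul (p q : ℕ) :
    ((Int.negOnePow ((p : ℤ) * q) : ℤˣ) : ℤ) = (-1) ^ (p * q) := by
  rw [← Nat.cast_mul, Int.negOnePow_def, zpow_natCast]
  simp

theorem bracket_skew {p q : ℤ} {F G : GradedCochain K V V} (hF : F ∈ cochainGrading K V V p)
    (hG : G ∈ cochainGrading K V V q) :
    bracket F G = -(Int.negOnePow (p * q) • bracket G F) := by
  by_cases h₁ : F = 0
  · simp [h₁]
  by_cases h₂ : G = 0
  · simp [h₂]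
  obtain ⟨p, rfl⟩ := exists_natCast_of_mem hF h₁
  obtain ⟨q, rfl⟩ := exists_natCast_of_mem hG h₂
  obtain ⟨f, rfl⟩ := mem_cochainGrading_natCast.1 hF
  obtain ⟨g, rfl⟩ := mem_cochainGrading_natCast.1 hG
  have : ((-1 : ℤ) ^ (p * q)) * (-1) ^ (p * q) = 1 := by rw [← mul_pow]; simp
  rw [bracket_lof, bracket_lof, Units.smul_def, negOnePow_natCast_mul, smul_sub, smul_smul,
    mul_comm q p, this, one_smul, neg_sub]

/-- Jacobi in the form of a Leibniz rule for `[·, H]`, the one suited to left-nested brackets. It is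
`wordBracket_jacobi` read through the injection `words`. -/
theorem bracket_jacobi {p q r : ℤ} {F G H : GradedCochain K V V}
    (hF : F ∈ cochainGrading K V V p) (hG : G ∈ cochainGrading K V V q)
    (hH : H ∈ cochainGrading K V V r) :
    bracket (bracket F G) H = bracket F (bracket G H)
      + Int.negOnePow (q * r) • bracket (bracket F H) G := by
  by_cases h₁ : F = 0
  · simp [h₁]
  by_cases h₂ : G = 0
  · simp [h₂]
  by_cases h₃ : H = 0
  · simp [h₃]
  obtain ⟨p, rfl⟩ := exists_natCast_of_mem hF h₁
  obtain ⟨q, rfl⟩ := exists_natCast_of_mem hG h₂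
  obtain ⟨r, rfl⟩ := exists_natCast_of_mem hH h₃
  apply words_injective
  have hFG : bracket F G ∈ cochainGrading K V V (p + q : ℕ) := by
    simpa using bracket_mem hF hG
  have hFH : bracket F H ∈ cochainGrading K V V (p + r : ℕ) := by
    simpa using bracket_mem hF hH
  have hGH : bracket G H ∈ cochainGrading K V V (q + r : ℕ) := by
    simpa using bracket_mem hG hH
  rw [map_add, Units.smul_def, map_zsmul, words_bracket hFG hH, words_bracket hF hG,
    words_bracket hF hGH, words_bracket hG hH, words_bracket hFH hG, words_bracket hF hH,
    negOnePow_natCast_mul, ← swapSign_pow, pow_add, pow_add, pow_add]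
  exact wordBracket_jacobi (words_isMultiadditive hF) (words_isMultiadditive hG)
    (words_isMultiadditive hH) (words_hasParity hF) (words_hasParity hG) (words_hasParity hH)

end GradedLie

/-! ### Sums over all splittings of a word -/

section SplitSums

variable {α W : Type*} [AddCommGroup W]

/-- The signed sum of `G` over the ways of distributing the letters of a word into two words,
keeping the order of the letters, by recursion on the word. -/
def splitSum (χ : α → α → ℤˣ) : List α → (List α → List α → W) → W
  | [], G => G [] []
  | x :: w, G => splitSum χ w (fun I J => G (x :: I) J)
      + splitSum χ w fun I J => (I.map fun y => χ y x).prod • G I (x :: J)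

theorem shuffleSum_zero (χ : α → α → ℤˣ) (w : List α) (k q : ℕ) :
    shuffleSum χ w k q (fun _ _ _ => (0 : W)) = 0 := by
  simpa using shuffleSum_zsmul (k := k) (q := q) χ w 0 fun _ _ _ => (0 : W)

/-- Adding the Pascal recursions for all lengths of the first block removes the restriction on
lengths. In the extreme summands, where one block is empty, only one branch of the recursion exists.
-/
theorem sum_shuffleSum (χ : α → α → ℤˣ) (w : List α) (G : List α → List α → W) :
    ∑ k ∈ Finset.range (w.length + 1), shuffleSum χ w k (w.length - k) (fun I J _ => G I J)
      = splitSum χ w G := by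
  induction w generalizing G with
  | nil => simp [shuffleSum, splitSum]
  | cons x w ih =>
    rw [splitSum, ← ih, ← ih, List.length_cons, Finset.sum_range_succ', Finset.sum_range_succ,
      Finset.sum_range_succ _ w.length, Finset.sum_range_succ' _ w.length]
    have h : ∀ k ∈ Finset.range w.length,
        shuffleSum χ (x :: w) (k + 1) (w.length + 1 - (k + 1)) (fun I J _ => G I J)
        = shuffleSum χ w k (w.length - k) (fun I J _ => G (x :: I) J)
          + shuffleSum χ w (k + 1) (w.length - (k + 1))
            fun I J _ => (I.map fun y => χ y x).prod • G I (x :: J) := by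
      intro k hk
      obtain ⟨m, hm⟩ : ∃ m, w.length - k = m + 1 :=
        ⟨w.length - k - 1, by have := Finset.mem_range.1 hk; omega⟩
      rw [show w.length + 1 - (k + 1) = m + 1 by omega, hm,
        show w.length - (k + 1) = m by omega, shuffleSum]
    have h₀ : shuffleSum χ (x :: w) 0 (w.length + 1 - 0) (fun I J _ => G I J)
        = shuffleSum χ w 0 (w.length - 0)
            fun I J _ => (I.map fun y => χ y x).prod • G I (x :: J) := by
      rw [Nat.sub_zero, Nat.sub_zero, shuffleSum]
      refine shuffleSum_congr _ _ (by omega) fun I J r hI _ _ => ?_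
      rw [List.eq_nil_of_length_eq_zero hI]
      simp
    have h₁ : shuffleSum χ (x :: w) (w.length + 1) (w.length + 1 - (w.length + 1))
          (fun I J _ => G I J)
        = shuffleSum χ w w.length (w.length - w.length) (fun I J _ => G (x :: I) J) := by
      rw [Nat.sub_self, Nat.sub_self, shuffleSum]
    rw [Finset.sum_congr rfl h, Finset.sum_add_distrib, h₀, h₁]
    abel

theorem splitSum_add (χ : α → α → ℤˣ) (w : List α) (G G' : List α → List α → W) :
    splitSum χ w (fun I J => G I J + G' I J) = splitSum χ w G + splitSum χ w G' := by
  induction w generalizing G G' with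
  | nil => rfl
  | cons x w ih =>
    simp only [splitSum, ih, smul_add]
    abel

theorem map_splitSum {W' : Type*} [AddCommGroup W'] (f : W →+ W') (χ : α → α → ℤˣ) (w : List α)
    (G : List α → List α → W) : f (splitSum χ w G) = splitSum χ w fun I J => f (G I J) := by
  induction w generalizing G with
  | nil => rfl
  | cons x w ih => simp only [splitSum, map_add, ih, Units.smul_def, map_zsmul]

theorem units_smul_splitSum (s : ℤˣ) (χ : α → α → ℤˣ) (w : List α)
    (G : List α → List α → W) : s • splitSum χ w G = splitSum χ w fun I J => s • G I J :=
  map_splitSum (DistribSMul.toAddMonoidHom W s) χ w G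

theorem splitSum_congr (χ : α → α → ℤˣ) (p : α → Prop) {w : List α} (hw : ∀ x ∈ w, p x)
    {G G' : List α → List α → W}
    (h : ∀ I J, (∀ x ∈ I, p x) → (∀ x ∈ J, p x) → G I J = G' I J) :
    splitSum χ w G = splitSum χ w G' := by
  induction w generalizing G G' with
  | nil => exact h _ _ (by simp) (by simp)
  | cons x w ih =>
    rw [List.forall_mem_cons] at hw
    rw [splitSum, splitSum]
    congr 1
    · exact ih hw.2 fun I J hI hJ => h _ _ (List.forall_mem_cons.2 ⟨hw.1, hI⟩) hJ
    · refine ih hw.2 fun I J hI hJ => ?_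
      rw [h _ _ hI (List.forall_mem_cons.2 ⟨hw.1, hJ⟩)]

end SplitSums

/-! ### Koszul signs of words with degrees -/

section Degrees

variable {H W : Type*} [AddCommGroup W]

/-- The Koszul sign of the interchange of two letters with degrees. -/
def letterSign (x y : H × ℤ) : ℤˣ := Int.negOnePow (x.2 * y.2)

/-- The total degree of a word of letters with degrees. -/
def wordDegree (w : List (H × ℤ)) : ℤ := (w.map Prod.snd).sum

theorem wordDegree_cons (x : H × ℤ) (w : List (H × ℤ)) :
    wordDegree (x :: w) = x.2 + wordDegree w := by simp [wordDegree]

theorem prod_letterSign (x : H × ℤ) (I : List (H × ℤ)) :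
    (I.map fun y => letterSign y x).prod = Int.negOnePow (wordDegree I * x.2) := by
  induction I with
  | nil => simp [wordDegree]
  | cons y I ih =>
    rw [List.map_cons, List.prod_cons, ih, wordDegree_cons, letterSign, add_mul,
      Int.negOnePow_add]

/-- Each splitting occurs with its two words in either order, and the signs of `(I, J)` and `(J, I)`
differ by the Koszul sign of moving `I` past `J`. -/
theorem splitSum_swap (w : List (H × ℤ)) (G : List (H × ℤ) → List (H × ℤ) → W) :
    splitSum letterSign w (fun I J => Int.negOnePow (wordDegree I * wordDegree J) • G J I)
      = splitSum letterSign w G := by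
  induction w generalizing G with
  | nil => simp [splitSum, wordDegree]
  | cons x w ih =>
    rw [splitSum, splitSum, ← ih fun I J => G (x :: I) J,
      ← ih fun I J => (I.map fun y => letterSign y x).prod • G I (x :: J), add_comm]
    simp only [prod_letterSign, wordDegree_cons, smul_smul, ← Int.negOnePow_add]
    congr 3 <;> funext I J
    -- Here the exponents differ by twice `wordDegree I * x.2`; in the other branch they are equal.
    · congr 1
      rw [Int.negOnePow_eq_iff]
      exact ⟨wordDegree I * x.2, by ring⟩
    · congr 2
      ring

end Degrees

/-! ### Iterated brackets -/

section Iterated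

variable {K V H : Type*} [Field K] [AddCommGroup V] [Module K V]

/-- The iterated bracket `[⋯[[A, x₁], x₂], ⋯, xₙ]`. -/
def iterBracket (A : GradedCochain K V V) (w : List (GradedCochain K V V)) :
    GradedCochain K V V := w.foldl (fun B x => bracket B x) A

theorem iterBracket_cons (A x : GradedCochain K V V) (w : List (GradedCochain K V V)) :
    iterBracket A (x :: w) = iterBracket (bracket A x) w := rfl

theorem iterBracket_append (A : GradedCochain K V V) (v w : List (GradedCochain K V V)) :
    iterBracket A (v ++ w) = iterBracket (iterBracket A v) w := List.foldl_append

/-- `A ↦ [⋯[[A, x₁], x₂], ⋯, xₙ]` as a linear map. -/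
def iterBracketHom : List (GradedCochain K V V) → GradedCochain K V V →ₗ[K] GradedCochain K V V
  | [] => LinearMap.id
  | x :: w => iterBracketHom w ∘ₗ bracket.flip x

theorem iterBracketHom_apply (w : List (GradedCochain K V V)) (A : GradedCochain K V V) :
    iterBracketHom w A = iterBracket A w := by
  induction w generalizing A with
  | nil => rfl
  | cons x w ih => exact ih _

theorem iterBracket_add (w : List (GradedCochain K V V)) (A B : GradedCochain K V V) :
    iterBracket (A + B) w = iterBracket A w + iterBracket B w := by
  simp only [← iterBracketHom_apply, map_add]

theorem iterBracket_smul (w : List (GradedCochain K V V)) (a : K) (A : GradedCochain K V V) :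
    iterBracket (a • A) w = a • iterBracket A w := by
  simp only [← iterBracketHom_apply, map_smul]

theorem iterBracket_units_smul (w : List (GradedCochain K V V)) (s : ℤˣ)
    (A : GradedCochain K V V) : iterBracket (s • A) w = s • iterBracket A w := by
  simp only [← iterBracketHom_apply, Units.smul_def, map_zsmul]

theorem iterBracket_zero (w : List (GradedCochain K V V)) : iterBracket 0 w = 0 := by
  simp only [← iterBracketHom_apply, map_zero]

/-- The letters are homogeneous of the given degrees. -/
def IsGradedWord (w : List (GradedCochain K V V × ℤ)) : Prop :=
  ∀ x ∈ w, x.1 ∈ cochainGrading K V V x.2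

theorem iterBracket_mem {a : ℤ} {A : GradedCochain K V V} (hA : A ∈ cochainGrading K V V a)
    {w : List (GradedCochain K V V × ℤ)} (hw : IsGradedWord w) :
    iterBracket A (w.map Prod.fst) ∈ cochainGrading K V V (a + wordDegree w) := by
  induction w generalizing a A with
  | nil => simpa [wordDegree, iterBracket] using hA
  | cons x w ih =>
    obtain ⟨hx, hw⟩ := List.forall_mem_cons.1 hw
    rw [wordDegree_cons, ← add_assoc]
    exact ih (bracket_mem hA hx) hw

/-- The iterated bracket of a bracket, expanded by the Leibniz rule. -/
theorem iterBracket_bracket {a b : ℤ} {A B : GradedCochain K V V}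
    (hA : A ∈ cochainGrading K V V a) (hB : B ∈ cochainGrading K V V b)
    {w : List (GradedCochain K V V × ℤ)} (hw : IsGradedWord w) :
    iterBracket (bracket A B) (w.map Prod.fst)
      = splitSum letterSign w fun I J => Int.negOnePow (wordDegree I * b) •
          bracket (iterBracket A (I.map Prod.fst)) (iterBracket B (J.map Prod.fst)) := by
  induction w generalizing a b A B with
  | nil => simp [splitSum, wordDegree, iterBracket]
  | cons x w ih =>
    obtain ⟨hx, hw⟩ := List.forall_mem_cons.1 hw
    -- By Jacobi the letter `x` joins either the word bracketed with `B` or, with a sign, the word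
    -- bracketed with `A`.
    rw [List.map_cons, iterBracket_cons, bracket_jacobi hA hB hx, iterBracket_add,
      iterBracket_units_smul, ih hA (bracket_mem hB hx) hw, ih (bracket_mem hA hx) hB hw,
      splitSum, add_comm, units_smul_splitSum]
    simp only [prod_letterSign, wordDegree_cons, smul_smul, ← Int.negOnePow_add, List.map_cons,
      iterBracket_cons]
    congr 3 <;> funext I J <;> congr 2 <;> ring

/-- In an iterated bracket with pairwise commuting letters, a letter can be moved to the front. -/
theorem iterBracket_move {a : ℤ} {A : GradedCochain K V V} (hA : A ∈ cochainGrading K V V a)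
    {x : GradedCochain K V V × ℤ} (hx : x.1 ∈ cochainGrading K V V x.2)
    {v w : List (GradedCochain K V V × ℤ)} (hv : IsGradedWord v)
    (hc : ∀ y ∈ v, bracket y.1 x.1 = 0) :
    iterBracket A ((v ++ x :: w).map Prod.fst)
      = Int.negOnePow (wordDegree v * x.2) • iterBracket A ((x :: (v ++ w)).map Prod.fst) := by
  induction v generalizing a A with
  | nil => simp [wordDegree]
  | cons y v ih =>
    obtain ⟨hy, hv⟩ := List.forall_mem_cons.1 hv
    obtain ⟨hcy, hc⟩ := List.forall_mem_cons.1 hc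
    -- In `[[A, y], x]` the Jacobi term `[A, [y, x]]` vanishes by `hcy`, so exchanging `y` and `x`
    -- costs only the Koszul sign.
    rw [List.cons_append, List.map_cons, iterBracket_cons, ih (bracket_mem hA hy) hv hc,
      List.map_cons, iterBracket_cons, bracket_jacobi hA hy hx, hcy, map_zero, zero_add,
      iterBracket_units_smul, smul_smul, ← Int.negOnePow_add, wordDegree_cons, add_comm (_ * _),
      ← add_mul]
    rfl

end Iterated

/-! ### `C^*(M, L)` inside `C^*(L ⊕ M, L ⊕ M)` -/

section Projection

variable {K L M : Type*} [Field K] [AddCommGroup L] [Module K L] [AddCommGroup M] [Module K M]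

theorem incl_lof {n : ℕ} (f : Cochain K M L n) : incl (DirectSum.lof K ℕ (Cochain K M L) n f)
    = DirectSum.lof K ℕ (Cochain K (L × M) (L × M)) n (inclHom n f) := DirectSum.lmap_lof _ _ _

theorem proj_lof {n : ℕ} (f : Cochain K (L × M) (L × M) n) :
    proj (DirectSum.lof K ℕ (Cochain K (L × M) (L × M)) n f)
      = DirectSum.lof K ℕ (Cochain K M L) n (projHom n f) := DirectSum.lmap_lof _ _ _

theorem proj_incl' (F : GradedCochain K M L) : proj (incl F) = F := by
  have : proj ∘ₗ incl (K := K) (L := L) (M := M) = LinearMap.id := by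
    refine DirectSum.linearMap_ext K fun n => LinearMap.ext fun f => ?_
    simp only [LinearMap.comp_apply, incl_lof, proj_lof, LinearMap.id_apply]
    rfl
  exact LinearMap.congr_fun this F

theorem incl_mem {d : ℤ} {F : GradedCochain K M L} (hF : F ∈ cochainGrading K M L d) :
    incl F ∈ cochainGrading K (L × M) (L × M) d := by
  by_cases h : F = 0
  · simp [h]
  obtain ⟨n, rfl⟩ := exists_natCast_of_mem hF h
  obtain ⟨f, rfl⟩ := mem_cochainGrading_natCast.1 hF
  exact mem_cochainGrading_natCast.2 ⟨_, (incl_lof f).symm⟩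

theorem proj_mem {d : ℤ} {F : GradedCochain K (L × M) (L × M)}
    (hF : F ∈ cochainGrading K (L × M) (L × M) d) : proj F ∈ cochainGrading K M L d := by
  by_cases h : F = 0
  · simp [h]
  obtain ⟨n, rfl⟩ := exists_natCast_of_mem hF h
  obtain ⟨f, rfl⟩ := mem_cochainGrading_natCast.1 hF
  exact mem_cochainGrading_natCast.2 ⟨_, (proj_lof f).symm⟩

theorem inclHom_fst_eq_zero {p : ℕ} (P : Cochain K M L p) (X : Fin p → (L × M) × (L × M))
    (i : Fin p) (x y z : L × M) (hx : x.2 = 0) :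
    (inclHom p P).1 (Function.update X i (x, y)) z = 0 := by
  have e : (inclHom p P).1 (Function.update X i (x, y)) z
      = (inclHom p P).1 (Function.update X i (0, y)) z := by
    have : (fun j => ((Function.update X i (x, y) j).1.2, (Function.update X i (x, y) j).2.2))
        = fun j => ((Function.update X i (0, y) j).1.2, (Function.update X i (0, y) j).2.2) := by
      funext j
      by_cases h : j = i
      · subst h; simp [hx]
      · simp [Function.update_of_ne h]
    simp only [inclHom, LinearMap.coe_mk, AddHom.coe_mk, Cochain.mk_val, this]
  rw [e]
  -- Linearity with scalar -1 at zero vectors gives `f 0 = -f 0 + f 0 = 0`.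
  simpa using (inclHom p P).2.lin_fst X i z (-1) 0 0 y

theorem inclHom_snd_eq_zero {p : ℕ} (P : Cochain K M L p) (X : Fin p → (L × M) × (L × M))
    (i : Fin p) (x y z : L × M) (hy : y.2 = 0) :
    (inclHom p P).1 (Function.update X i (x, y)) z = 0 := by
  have e : (inclHom p P).1 (Function.update X i (x, y)) z
      = (inclHom p P).1 (Function.update X i (x, 0)) z := by
    have : (fun j => ((Function.update X i (x, y) j).1.2, (Function.update X i (x, y) j).2.2))
        = fun j => ((Function.update X i (x, 0) j).1.2, (Function.update X i (x, 0) j).2.2) := by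
      funext j
      by_cases h : j = i
      · subst h; simp [hy]
      · simp [Function.update_of_ne h]
    simp only [inclHom, LinearMap.coe_mk, AddHom.coe_mk, Cochain.mk_val, this]
  rw [e]
  simpa using (inclHom p P).2.lin_snd X i z (-1) x 0 0

theorem inclHom_last_eq_zero {p : ℕ} (P : Cochain K M L p) (X : Fin p → (L × M) × (L × M))
    (z : L × M) (hz : z.2 = 0) : (inclHom p P).1 X z = 0 := by
  have e : (inclHom p P).1 X z = (inclHom p P).1 X 0 := by
    simp only [inclHom, LinearMap.coe_mk, AddHom.coe_mk, Cochain.mk_val, hz, Prod.snd_zero]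
  rw [e, (inclHom p P).2.map_zero]

/-- Every summand feeds a value of `Q`, which lies in `L`, into an argument of `P`, and `P` only
sees components in `M`. Hence `C^*(M, L)` is abelian. -/
theorem circ_inclHom {p q : ℕ} (P : Cochain K M L p) (Q : Cochain K M L q) :
    circ p q (inclHom p P) (inclHom q Q) = 0 := by
  refine Cochain.ext fun X z => ?_
  have hQ : ∀ Y z, ((inclHom (L := L) q Q).1 Y z).2 = 0 := fun _ _ => rfl
  change circFun _ _ X z = 0
  rw [circFun, Finset.sum_eq_zero, Finset.sum_eq_zero, add_zero]
  · intro σ _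
    rw [inclHom_last_eq_zero P _ _ (hQ _ _), smul_zero]
  · refine fun k _ => Finset.sum_eq_zero fun σ _ => ?_
    rw [circTerm, inclHom_fst_eq_zero P _ _ _ _ _ (hQ _ _),
      inclHom_snd_eq_zero P _ _ _ _ _ (hQ _ _), add_zero, smul_zero]

theorem bracket_incl_incl (F G : GradedCochain K M L) : bracket (incl F) (incl G) = 0 := by
  have : (bracket (K := K) (V := L × M)).compl₁₂ incl incl = 0 := by
    refine DirectSum.linearMap_ext K fun p => LinearMap.ext fun P =>
      DirectSum.linearMap_ext K fun q => LinearMap.ext fun Q => ?_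
    simp only [LinearMap.comp_apply, LinearMap.compl₁₂_apply, incl_lof, bracket_lof, circ_inclHom,
      map_zero, smul_zero, sub_zero]
    rfl
  exact LinearMap.congr_fun₂ this F G

/-- The function maps arguments in `M` into `M`. -/
def PreservesSnd {n : ℕ} (f : (Fin n → (L × M) × (L × M)) → L × M → L × M) : Prop :=
  ∀ X z, (∀ i, (X i).1.1 = 0 ∧ (X i).2.1 = 0) → z.1 = 0 → (f X z).1 = 0

/-- This describes the kernel of the projection by a property that is visibly stable under
composition. -/
theorem projHom_eq_zero {n : ℕ} {f : Cochain K (L × M) (L × M) n} :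
    projHom n f = 0 ↔ PreservesSnd f.1 := by
  constructor
  · intro h X z hX hz
    have := congrArg (fun g : Cochain K M L n => g.1 (fun i => ((X i).1.2, (X i).2.2)) z.2) h
    have e : (fun i => (((0 : L), (X i).1.2), ((0 : L), (X i).2.2))) = X := by
      funext i
      obtain ⟨h₁, h₂⟩ := hX i
      refine Prod.ext (Prod.ext h₁.symm rfl) (Prod.ext h₂.symm rfl)
    have ez : ((0 : L), z.2) = z := Prod.ext hz.symm rfl
    simp only [projHom, LinearMap.coe_mk, AddHom.coe_mk, Cochain.mk_val, e, ez] at this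
    exact this
  · intro h
    exact Cochain.ext fun X z => h _ _ (fun i => ⟨rfl, rfl⟩) rfl

theorem PreservesSnd.circFun {p q : ℕ} {P : (Fin p → (L × M) × (L × M)) → L × M → L × M}
    {Q : (Fin q → (L × M) × (L × M)) → L × M → L × M} (hP : PreservesSnd P)
    (hQ : PreservesSnd Q) : PreservesSnd (circFun P Q) := by
  intro X z hX hz
  rw [LieTriple.circFun, Prod.fst_add, Prod.fst_sum, Prod.fst_sum, Finset.sum_eq_zero,
    Finset.sum_eq_zero, add_zero]
  · intro σ _
    have h : (P (outer p σ X) (Q (inner p le_rfl σ X) z)).1 = 0 :=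
      hP _ _ (fun i => hX _) (hQ _ _ (fun i => hX _) hz)
    rw [Prod.smul_fst, h, smul_zero]
  · intro k _
    rw [Prod.fst_sum]
    refine Finset.sum_eq_zero fun σ _ => ?_
    have h : ∀ a b : L × M, a.1 = 0 → b.1 = 0 →
        (P (Function.update (outer k σ X) k (a, b)) z).1 = 0 := by
      intro a b h₁ h₂
      refine hP _ _ (fun i => ?_) hz
      by_cases hi : i = k
      · subst hi; simp [h₁, h₂]
      · rw [Function.update_of_ne hi]; exact hX _
    have ho : (outer k σ X k).1.1 = 0 ∧ (outer k σ X k).2.1 = 0 := hX _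
    have hi : ∀ y : L × M, y.1 = 0 → (Q (inner k k.2.le σ X) y).1 = 0 :=
      fun y hy => hQ _ _ (fun i => hX _) hy
    rw [Prod.smul_fst, circTerm, Prod.fst_add, h _ _ (hi _ ho.1) ho.2, h _ _ ho.1 (hi _ ho.2),
      add_zero, smul_zero]

/-- The kernel of the projection is a subalgebra: composites of maps preserving `M` preserve `M`. -/
theorem proj_bracket_eq_zero {p q : ℤ} {F G : GradedCochain K (L × M) (L × M)}
    (hF : F ∈ cochainGrading K (L × M) (L × M) p) (hG : G ∈ cochainGrading K (L × M) (L × M) q)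
    (hpF : proj F = 0) (hpG : proj G = 0) : proj (bracket F G) = 0 := by
  by_cases h₁ : F = 0
  · simp [h₁]
  by_cases h₂ : G = 0
  · simp [h₂]
  obtain ⟨p, rfl⟩ := exists_natCast_of_mem hF h₁
  obtain ⟨q, rfl⟩ := exists_natCast_of_mem hG h₂
  obtain ⟨f, rfl⟩ := mem_cochainGrading_natCast.1 hF
  obtain ⟨g, rfl⟩ := mem_cochainGrading_natCast.1 hG
  have inj : ∀ n, Function.Injective (DirectSum.lof K ℕ (Cochain K M L) n) :=
    fun n => DirectSum.of_injective n
  rw [proj_lof] at hpF hpG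
  have hf := projHom_eq_zero.1 (inj _ (hpF.trans (map_zero _).symm))
  have hg := projHom_eq_zero.1 (inj _ (hpG.trans (map_zero _).symm))
  have h₁ : projHom (p + q) (circ p q f g) = 0 := projHom_eq_zero.2 (hf.circFun hg)
  have h₂ : projHom (q + p) (circ q p g f) = 0 := projHom_eq_zero.2 (hg.circFun hf)
  rw [bracket_lof, map_sub, map_zsmul, proj_lof, proj_lof, h₁, h₂, map_zero, map_zero, smul_zero,
    sub_zero]

end Projection

/-! ### Derived brackets -/

section Derived

variable {K L M : Type*} [Field K] [AddCommGroup L] [Module K L] [AddCommGroup M] [Module K M]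

/-- `P[A, B] = P[PA, B] + P[A, PB]` for the projection `P` onto `C^*(M, L)`. -/
theorem proj_bracket {a b : ℤ} {A B : GradedCochain K (L × M) (L × M)}
    (hA : A ∈ cochainGrading K (L × M) (L × M) a) (hB : B ∈ cochainGrading K (L × M) (L × M) b) :
    proj (bracket A B) = proj (bracket (incl (proj A)) B) + proj (bracket A (incl (proj B))) := by
  -- `A - PA` and `B - PB` lie in the kernel of `P`, so `P[A - PA, B - PB] = 0`. In the expansion
  -- `[PA, PB]` vanishes, since `C^*(M, L)` is abelian.
  have h := proj_bracket_eq_zero (Submodule.sub_mem _ hA (incl_mem (proj_mem hA)))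
    (Submodule.sub_mem _ hB (incl_mem (proj_mem hB))) (by rw [map_sub, proj_incl', sub_self])
    (by rw [map_sub, proj_incl', sub_self])
  simp only [map_sub, LinearMap.sub_apply, bracket_incl_incl, map_zero, sub_zero] at h
  rw [← sub_eq_zero, ← h]
  abel

/-- The letters are homogeneous elements of `C^*(M, L)`. -/
def IsLetter (x : GradedCochain K (L × M) (L × M) × ℤ) : Prop :=
  x.1 ∈ cochainGrading K (L × M) (L × M) x.2 ∧ ∃ F : GradedCochain K M L, incl F = x.1

theorem IsLetter.bracket_eq_zero {x y : GradedCochain K (L × M) (L × M) × ℤ} (hx : IsLetter x)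
    (hy : IsLetter y) : bracket x.1 y.1 = 0 := by
  obtain ⟨-, F, hF⟩ := hx
  obtain ⟨-, G, hG⟩ := hy
  rw [← hF, ← hG, bracket_incl_incl]

/-- The derived bracket of the letters of a word. -/
def derived (Δ : GradedCochain K (L × M) (L × M)) (w : List (GradedCochain K (L × M) (L × M))) :
    GradedCochain K M L := proj (iterBracket Δ w)

/-- The generalized Jacobi identity, still including the splitting with empty `I`. It is the
projection of the iterated bracket of `[Δ, Δ] = 0` with the letters of `w`, expanded by the Leibniz
rule. -/
theorem splitSum_derived [CharZero K] {Δ : GradedCochain K (L × M) (L × M)}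
    (hΔ : Δ ∈ cochainGrading K (L × M) (L × M) 1) (hΔΔ : bracket Δ Δ = 0)
    {w : List (GradedCochain K (L × M) (L × M) × ℤ)} (hw : ∀ x ∈ w, IsLetter x) :
    splitSum letterSign w (fun I J =>
      derived Δ (incl (derived Δ (I.map Prod.fst)) :: J.map Prod.fst)) = 0 := by
  have h := iterBracket_bracket hΔ hΔ (w := w) fun x hx => (hw x hx).1
  rw [hΔΔ, iterBracket_zero] at h
  have h' := congrArg proj h
  rw [map_zero] at h'
  have h'' := map_splitSum (proj (K := K) (L := L) (M := M)).toAddMonoidHom letterSign w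
    fun I J => Int.negOnePow (wordDegree I * 1) •
      bracket (iterBracket Δ (I.map Prod.fst)) (iterBracket Δ (J.map Prod.fst))
  simp only [LinearMap.toAddMonoidHom_coe] at h''
  -- The projection of `[Δ_I, Δ_J]` gives one term with `PΔ_I` inserted and one with `PΔ_J`
  -- inserted. By `splitSum_swap` both have the same total, so twice the wanted sum is zero.
  rw [h'', splitSum_congr letterSign IsLetter hw (G' := fun I J =>
    derived Δ (incl (derived Δ (I.map Prod.fst)) :: J.map Prod.fst)
      + Int.negOnePow (wordDegree I * wordDegree J) •
        derived Δ (incl (derived Δ (J.map Prod.fst)) :: I.map Prod.fst)), splitSum_add,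
    splitSum_swap w fun I J =>
      derived Δ (incl (derived Δ (I.map Prod.fst)) :: J.map Prod.fst), ← two_smul K, eq_comm,
    smul_eq_zero] at h'
  · exact h'.resolve_left two_ne_zero
  · intro I J hI hJ
    have mI := iterBracket_mem hΔ fun x hx => (hI x hx).1
    have mJ := iterBracket_mem hΔ fun x hx => (hJ x hx).1
    have mPI := incl_mem (proj_mem mI)
    have mPJ := incl_mem (proj_mem mJ)
    have lPI : IsLetter (incl (derived Δ (I.map Prod.fst)), 1 + wordDegree I) := ⟨mPI, _, rfl⟩
    have lPJ : IsLetter (incl (derived Δ (J.map Prod.fst)), 1 + wordDegree J) := ⟨mPJ, _, rfl⟩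
    -- `PΔ_J` is itself a letter of degree `1 + wordDegree J`, hence it commutes with the letters of
    -- `I` and can be moved to the front.
    have key : ∀ {I J : List (GradedCochain K (L × M) (L × M) × ℤ)}, (∀ x ∈ I, IsLetter x) →
        IsLetter (incl (derived Δ (J.map Prod.fst)), 1 + wordDegree J) →
        proj (bracket (iterBracket Δ (I.map Prod.fst)) (incl (derived Δ (J.map Prod.fst))))
          = Int.negOnePow (wordDegree I * (1 + wordDegree J)) •
            derived Δ (incl (derived Δ (J.map Prod.fst)) :: I.map Prod.fst) := by
      intro I J hI hJ
      have := iterBracket_move hΔ hJ.1 (w := []) (fun x hx => (hI x hx).1)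
        fun y hy => (hI y hy).bracket_eq_zero hJ
      rw [List.map_append, iterBracket_append, List.append_nil] at this
      rw [derived, derived]
      have h₂ := congrArg proj this
      rw [Units.smul_def, map_zsmul, ← Units.smul_def] at h₂
      exact h₂
    change proj (Int.negOnePow _ • bracket _ _) = _
    rw [Units.smul_def, map_zsmul, ← Units.smul_def, proj_bracket mI mJ, bracket_skew mPI mJ,
      map_neg, Units.smul_def (Int.negOnePow ((1 + wordDegree I) * _)), map_zsmul,
      ← Units.smul_def]
    have k₁ := key hI lPJ
    have k₂ := key hJ lPI
    rw [derived] at k₁ k₂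
    rw [k₁, k₂, smul_add, smul_neg, smul_smul, smul_smul, smul_smul, ← Int.negOnePow_add,
      ← Int.negOnePow_add, ← Int.negOnePow_add]
    congr 1
    -- The total exponent is odd and cancels the minus sign of skew symmetry.
    · rw [show wordDegree I * 1 + (1 + wordDegree I) * (1 + wordDegree J)
        + wordDegree J * (1 + wordDegree I) = 2 * (wordDegree I + wordDegree J
          + wordDegree I * wordDegree J) + 1 by ring, Int.negOnePow_add, Int.negOnePow_two_mul]
      simp
      rfl
    · congr 1
      rw [Int.negOnePow_eq_iff]
      exact ⟨wordDegree I, by ring⟩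

end Derived

/-! ### The `L_∞`-algebra of derived brackets -/

section DerivedLInfinity

theorem isInternal_cochainGrading (K V W : Type*) [Field K] [AddCommGroup V] [Module K V]
    [AddCommGroup W] [Module K W] : DirectSum.IsInternal (cochainGrading K V W) := by
  rw [DirectSum.isInternal_submodule_iff_iSupIndep_and_iSup_eq_top]
  constructor
  · rw [iSupIndep_def]
    rintro (n | n)
    · rw [Submodule.disjoint_def]
      rintro _ ⟨f, rfl⟩ hf
      have hle : ⨆ j, ⨆ (_ : j ≠ Int.ofNat n), cochainGrading K V W j
          ≤ LinearMap.ker (DirectSum.component K ℕ (Cochain K V W) n) := by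
        refine iSup₂_le fun j hj => ?_
        rcases j with m | m
        · rintro _ ⟨g, rfl⟩
          rw [LinearMap.mem_ker, DirectSum.component.of, dif_neg]
          rintro rfl
          exact hj rfl
        · exact bot_le
      have := hle hf
      rw [LinearMap.mem_ker, DirectSum.component.lof_self] at this
      rw [this, map_zero]
    · exact disjoint_bot_left
  · rw [eq_top_iff]
    intro F _
    induction F using DirectSum.induction_on with
    | zero => exact zero_mem _
    | of n f => exact Submodule.mem_iSup_of_mem (n : ℤ) ⟨f, rfl⟩
    | add F G hF hG => exact add_mem (hF trivial) (hG trivial)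

/-- The Koszul sign is the inversion sign for `letterSign`. The labels `y` only complete the degrees
to letters and do not affect the value. -/
theorem koszulSign_extendPerm {N : ℕ} (d : Fin (N + 1) → ℤ) (a : Fin (N + 1)) (τ : Perm (Fin N))
    {α : Type*} (y : Fin (N + 1) → α) : koszulSign d (extendPerm a τ)
      = Int.negOnePow (wordDegree ((List.ofFn fun i => (y (τ i).succ, d (τ i).succ)).take a) * d 0)
        * koszulSign (fun i => d i.succ) τ := by
  have := inversionSign_extendPerm letterSign (fun i => (y i, d i)) a τ
  rwa [prod_letterSign] at this

variable {K L M : Type*} [Field K] [AddCommGroup L] [Module K L] [AddCommGroup M] [Module K M]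

/-- Graded symmetry of the derived brackets rests only on the letters commuting: the letter with
index `0` is moved to the front and the rest is sorted by induction. -/
theorem iterBracket_perm {n : ℕ} {a : ℤ} {A : GradedCochain K (L × M) (L × M)}
    (hA : A ∈ cochainGrading K (L × M) (L × M) a) {d : Fin n → ℤ}
    {x : Fin n → GradedCochain K (L × M) (L × M)} (hx : ∀ i, IsLetter (x i, d i))
    (σ : Perm (Fin n)) : iterBracket A (List.ofFn fun i => x (σ i))
      = koszulSign d σ • iterBracket A (List.ofFn x) := by
  induction n generalizing a A with
  | zero => simp [koszulSign]
  | succ N ih =>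
    obtain ⟨b, hb⟩ := σ.surjective 0
    obtain ⟨τ, rfl⟩ := exists_eq_extendPerm hb
    have h₁ : (List.ofFn fun i => x (extendPerm b τ i))
        = (List.ofFn fun i => (x (extendPerm b τ i), d (extendPerm b τ i))).map Prod.fst := by
      rw [List.map_ofFn]; rfl
    have hτ : ∀ z ∈ List.ofFn fun i => (x (τ i).succ, d (τ i).succ), IsLetter z := by
      intro z hz
      obtain ⟨i, rfl⟩ := (List.mem_ofFn' _ _).1 hz
      exact hx _
    have htake : ∀ z ∈ (List.ofFn fun i => (x (τ i).succ, d (τ i).succ)).take b, IsLetter z :=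
      fun z hz => hτ z (List.mem_of_mem_take hz)
    rw [h₁, ofFn_extendPerm (fun i => (x i, d i)), iterBracket_move hA (hx 0).1
      (fun z hz => (htake z hz).1) (fun z hz => (htake z hz).bracket_eq_zero (hx 0)),
      List.take_append_drop, List.map_cons, List.map_ofFn, iterBracket_cons,
      koszulSign_extendPerm d b τ x, mul_smul, List.ofFn_succ, iterBracket_cons,
      ← ih (bracket_mem hA (hx 0).1) fun i => hx i.succ]
    rfl

theorem wordDegree_ofFn {H : Type*} {n : ℕ} (x : Fin n → H) (d : Fin n → ℤ) :
    wordDegree (List.ofFn fun i => (x i, d i)) = ∑ i, d i := by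
  rw [wordDegree, List.map_ofFn, List.sum_ofFn]; rfl

theorem jacobiShuffles_eq {n k : ℕ} (hk : k ≤ n) :
    jacobiShuffles n k = initialShuffles n k (n - k) := by
  ext σ
  simp only [jacobiShuffles, Finset.mem_filter, Finset.mem_univ, true_and, mem_initialShuffles]
  refine and_congr_right fun _ => ⟨fun h => ⟨fun i j hi hij _ => h i j hi hij, fun i hi => ?_⟩,
    fun h i j hi hij => h.1 i j hi hij ?_⟩
  · have := i.2
    omega
  · have := j.2
    omega

/-- The derived brackets of a Maurer–Cartan element `Δ` without component in `C^*(M, L)` form an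
`L_∞`-algebra. -/
theorem isLInfinity_of_derived [CharZero K] {Δ : GradedCochain K (L × M) (L × M)}
    (hΔ : Δ ∈ cochainGrading K (L × M) (L × M) 1) (hΔΔ : bracket Δ Δ = 0) (hpΔ : proj Δ = 0)
    {l : ∀ k : ℕ, MultilinearMap K (fun _ : Fin k => GradedCochain K M L) (GradedCochain K M L)}
    (hl : ∀ k, 1 ≤ k → ∀ x, l k x = derived Δ (List.ofFn fun i => incl (x i))) :
    IsLInfinity (cochainGrading K M L) l := by
  refine ⟨isInternal_cochainGrading K M L, fun n hn d x hx => ?_, fun n hn d x hx σ => ?_,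
    fun n hn d x hx => ?_⟩
  · rw [hl n hn, derived]
    have e : (List.ofFn fun i => incl (x i))
        = (List.ofFn fun i => (incl (x i), d i)).map Prod.fst := by
      rw [List.map_ofFn]; rfl
    rw [e, ← wordDegree_ofFn (fun i => incl (x i)) d, add_comm]
    refine proj_mem (iterBracket_mem hΔ fun z hz => ?_)
    obtain ⟨i, rfl⟩ := (List.mem_ofFn' _ _).1 hz
    exact incl_mem (hx i)
  · rw [hl n hn, hl n hn, derived, derived,
      iterBracket_perm hΔ (x := fun i => incl (x i)) fun i => ⟨incl_mem (hx i), _, rfl⟩]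
    simp only [Units.smul_def, map_zsmul]
  · set G : List (GradedCochain K (L × M) (L × M) × ℤ) →
        List (GradedCochain K (L × M) (L × M) × ℤ) → GradedCochain K M L := fun I J =>
      derived Δ (incl (derived Δ (I.map Prod.fst)) :: J.map Prod.fst)
    set w : Fin n → GradedCochain K (L × M) (L × M) × ℤ := fun i => (incl (x i), d i)
    have hlw : ∀ z ∈ List.ofFn w, IsLetter z := by
      intro z hz
      obtain ⟨i, rfl⟩ := (List.mem_ofFn' _ _).1 hz
      exact ⟨incl_mem (hx i), _, rfl⟩
    have total := splitSum_derived hΔ hΔΔ hlw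
    -- The splittings are grouped by the length of the first word. Length `0` must be separated, as
    -- the `L_∞` identities contain no term with `l 0`.
    rw [← sum_shuffleSum, List.length_ofFn, Finset.sum_range_succ'] at total
    have h₀ : shuffleSum letterSign (List.ofFn w) 0 (n - 0) (fun I J _ => G I J) = 0 := by
      rw [shuffleSum_congr (G' := fun _ _ _ => 0), shuffleSum_zero]
      · simp
      · intro I J r hI _ _
        rw [List.eq_nil_of_length_eq_zero hI]
        simp only [G, List.map_nil]
        rw [derived, derived, iterBracket_cons]
        change proj (iterBracket (bracket Δ (incl (proj Δ))) _) = 0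
        -- The derived bracket of the empty word is `PΔ`, the curvature, which vanishes by
        -- hypothesis.
        rw [hpΔ, map_zero, map_zero, iterBracket_zero, map_zero]
    rw [h₀, add_zero, Finset.sum_range] at total
    rw [← total]
    refine Finset.sum_congr rfl fun i _ => ?_
    have hi := i.2
    rw [jacobiShuffles_eq (by omega), ← sum_initialShuffles letterSign w (by omega)]
    refine Finset.sum_congr rfl fun σ _ => ?_
    congr 1
    rw [hl _ (by omega), hl _ (by omega)]
    congr 1
    rw [List.ofFn_succ]
    simp only [Fin.cons_zero, Fin.cons_succ]
    congr 1
    · congr 2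
      refine List.ext_getElem (by
        simp only [List.length_map, List.length_take, List.length_ofFn]
        omega) fun j h₁ h₂ => ?_
      simp only [List.getElem_ofFn, List.getElem_map, List.getElem_take, w]
    · refine List.ext_getElem (by
        simp only [List.length_map, List.length_take, List.length_drop, List.length_ofFn]
        omega) fun j h₁ h₂ => ?_
      simp only [List.getElem_ofFn, List.getElem_map, List.getElem_take, List.getElem_drop, w]

end DerivedLInfinity

/-! ### The twisted semidirect product -/

section Semidirect

variable {K L M : Type*} [Field K] [AddCommGroup L] [Module K L] [AddCommGroup M] [Module K M]
  {S : LieTripleSystem K L} {ρ : Representation M S}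

/-- The element `π + θ + H` of `C^1(L ⊕ M, L ⊕ M)`. -/
def twistedSemidirect (ω : ThreeCocycle ρ) : Cochain K (L × M) (L × M) 1 :=
  semidirect ρ + ω.toCochain

theorem twistedSemidirect_val (ω : ThreeCocycle ρ) (X : Fin 1 → (L × M) × (L × M)) (z : L × M) :
    (twistedSemidirect ω).1 X z = (S.bracket (X 0).1.1 (X 0).2.1 z.1,
      ρ.θ (X 0).2.1 z.1 (X 0).1.2 - ρ.θ (X 0).1.1 z.1 (X 0).2.2 + ρ.D (X 0).1.1 (X 0).2.1 z.2
        + ω.H (X 0).1.1 (X 0).2.1 z.1) := by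
  simp [twistedSemidirect, Cochain.add_val, semidirect, ThreeCocycle.toCochain, ofTrilinear,
    Cochain.mk_val]

/-- The fundamental identity for the `H`-twisted bracket on `L ⊕ M`. Its `L`-component is the
identity in `L`; its `M`-component combines the cocycle condition with the two representation
axioms. -/
theorem twistedSemidirect_fundamental (ω : ThreeCocycle ρ) (X Y : (L × M) × (L × M))
    (z : L × M) :
    (twistedSemidirect ω).1 (fun _ => X) ((twistedSemidirect ω).1 (fun _ => Y) z)
      = (twistedSemidirect ω).1 (fun _ => Y) ((twistedSemidirect ω).1 (fun _ => X) z)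
        + ((twistedSemidirect ω).1 (fun _ => ((twistedSemidirect ω).1 (fun _ => X) Y.1, Y.2)) z
        + (twistedSemidirect ω).1 (fun _ => (Y.1, (twistedSemidirect ω).1 (fun _ => X) Y.2)) z) := by
  obtain ⟨⟨x, a⟩, y, b⟩ := X
  obtain ⟨⟨p, c⟩, q, d⟩ := Y
  obtain ⟨r, m⟩ := z
  simp only [twistedSemidirect_val]
  ext
  · simp only [Prod.fst_add, S.fundamental x y p q r]
    abel
  -- The `M`-component is compared separately in each `M`-entry. The cocycle identity `h` accounts
  -- for the terms without such an entry, `h₁` to `h₄` for those in `a`, `b`, `c`, `d`. Two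
  -- identities are needed for `m`, on which `D(p, q) = θ(q, p) - θ(p, q)` acts.
  · have h := ω.closed x y p q r
    have h₁ := ρ.rep_bracket y p q r a
    have h₂ := ρ.rep_bracket x p q r b
    have h₃ := ρ.rep_deriv x y q r c
    have h₄ := ρ.rep_deriv x y p r d
    have h₅ := ρ.rep_deriv x y p q m
    have h₆ := ρ.rep_deriv x y q p m
    simp only [Representation.D, Prod.snd_add, LinearMap.sub_apply, LinearMap.flip_apply, map_add,
      map_sub] at h h₁ h₂ h₃ h₄ h₅ h₆ ⊢
    linear_combination (norm := module) h - h₁ + h₂ - h₃ + h₄ + h₅ - h₆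

/-- In degree 1 the square `f ∘ f` is the defect in the fundamental identity of the ternary
operation `f`. -/
theorem circFun_one_one {V : Type*} [AddCommGroup V] [Module K V] (f : Cochain K V V 1)
    (X : Fin (1 + 1) → V × V) (z : V) : circFun f.1 f.1 X z
      = -f.1 (fun _ => X 0) (f.1 (fun _ => X 1) z) + (f.1 (fun _ => X 1) (f.1 (fun _ => X 0) z)
        + (f.1 (fun _ => (f.1 (fun _ => X 0) (X 1).1, (X 1).2)) z
        + f.1 (fun _ => ((X 1).1, f.1 (fun _ => X 0) (X 1).2)) z)) := by
  have h₁ : ∀ v, toWord f.1 [v] = f.1 fun _ => v := fun v => toWord_eq _ _ rfl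
  have h₀ : toWord f.1 [] = 0 := toWord_hasLength _ _ (by simp)
  have h₂ : ∀ v w, toWord f.1 [v, w] = 0 := fun v w => toWord_hasLength _ _ (by simp)
  have e : List.ofFn X = [X 0, X 1] := by
    simp [List.ofFn_succ]
  rw [← wordCirc_toWord f.2, e]
  simp [wordCirc_cons, wordCirc_nil, contract, h₀, h₁, h₂]

theorem bracket_twistedSemidirect (ω : ThreeCocycle ρ) :
    bracket (DirectSum.lof K ℕ (Cochain K (L × M) (L × M)) 1 (twistedSemidirect ω))
      (DirectSum.lof K ℕ (Cochain K (L × M) (L × M)) 1 (twistedSemidirect ω)) = 0 := by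
  have : circ 1 1 (twistedSemidirect ω) (twistedSemidirect ω) = 0 := by
    refine Cochain.ext fun X z => ?_
    change circFun _ _ X z = 0
    rw [circFun_one_one, twistedSemidirect_fundamental ω (X 0) (X 1) z]
    abel
  rw [bracket_lof, this, map_zero, smul_zero, sub_zero]

end Semidirect

/-! ### The automorphism `(x, u) ↦ (x + T u, u)` -/

section Shear

variable {K L M : Type*} [Field K] [AddCommGroup L] [Module K L] [AddCommGroup M] [Module K M]

/-- The automorphism `(x, u) ↦ (x + T u, u)` of `L ⊕ M`. -/
def shear (T : M →ₗ[K] L) : (L × M) ≃ₗ[K] (L × M) where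
  toFun v := (v.1 + T v.2, v.2)
  invFun v := (v.1 - T v.2, v.2)
  map_add' v w := by ext <;> simp; abel
  map_smul' a v := by ext <;> simp
  left_inv v := by simp
  right_inv v := by simp

/-- The shears form an abelian group with `shear T ∘ shear T' = shear (T + T')`, so twisting by `T`
and then by `T'` is twisting by `T + T'`. -/
theorem conj_shear (T T' : M →ₗ[K] L) (F : GradedCochain K (L × M) (L × M)) :
    conj (shear T') (conj (shear T) F) = conj (shear (T + T')) F := by
  refine DFinsupp.ext fun n => Cochain.ext fun X z => ?_
  have h : ∀ (e : (L × M) ≃ₗ[K] (L × M)) (G : GradedCochain K (L × M) (L × M)),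
    conj e G n = conjHom e n (G n) := fun e G => DirectSum.lmap_apply _ _ _
  have e : ∀ v : L × M, shear T (shear T' v) = shear (T + T') v := fun v => by
    ext
    · change v.1 + T' v.2 + T v.2 = v.1 + (T v.2 + T' v.2)
      abel
    · rfl
  have e' : ∀ v : L × M, (shear T').symm ((shear T).symm v) = (shear (T + T')).symm v := fun v => by
    rw [LinearEquiv.eq_symm_apply, ← e, LinearEquiv.apply_symm_apply, LinearEquiv.apply_symm_apply]
  simp only [h, conjHom_val, e, e']

/-- The bracket of an element of `C^1` with `T`. -/
def adHom (T : M →ₗ[K] L) (f : Cochain K (L × M) (L × M) 1) : Cochain K (L × M) (L × M) 1 :=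
  circ 1 0 f (inclHom 0 (ofLinear T)) - circ 0 1 (inclHom 0 (ofLinear T)) f

/-- `T` has degree 0, so no sign appears and bracketing with it preserves `C^1`. -/
theorem bracket_ofHom (T : M →ₗ[K] L) (f : Cochain K (L × M) (L × M) 1) :
    bracket (DirectSum.lof K ℕ (Cochain K (L × M) (L × M)) 1 f) (incl (ofHom T))
      = DirectSum.lof K ℕ (Cochain K (L × M) (L × M)) 1 (adHom T f) := by
  rw [ofHom, incl_lof, bracket_lof, adHom, map_sub]
  simp

theorem adHom_val (T : M →ₗ[K] L) (f : Cochain K (L × M) (L × M) 1) (x y z : L × M) :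
    (adHom T f).1 (fun _ => (x, y)) z = f.1 (fun _ => (x, y)) (T z.2, 0)
      + f.1 (fun _ => ((T x.2, 0), y)) z + f.1 (fun _ => (x, (T y.2, 0))) z
      - (T (f.1 (fun _ => (x, y)) z).2, 0) := by
  have h₁ : ∀ v, toWord f.1 [v] = f.1 fun _ => v := fun v => toWord_eq _ _ rfl
  have h₀ : toWord f.1 [] = 0 := toWord_hasLength _ _ (by simp)
  have h₃ : toWord (inclHom 0 (ofLinear T)).1 [] = fun z => (T z.2, 0) :=
    toWord_eq _ Fin.elim0 rfl
  have h₄ : ∀ v, toWord (inclHom 0 (ofLinear T)).1 [v] = 0 :=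
    fun v => toWord_hasLength _ _ (by simp)
  change circFun f.1 (inclHom 0 (ofLinear T)).1 (fun _ : Fin (1 + 0) => (x, y)) z
    - circFun (inclHom 0 (ofLinear T)).1 f.1 (fun _ : Fin (0 + 1) => (x, y)) z = _
  rw [← wordCirc_toWord f.2, ← wordCirc_toWord (inclHom 0 (ofLinear T)).2]
  have e : List.ofFn (fun _ : Fin (1 + 0) => (x, y)) = [(x, y)] := rfl
  rw [e]
  simp [wordCirc_cons, wordCirc_nil, contract, h₀, h₁, h₃, h₄]
  abel

/-- The shear is `exp τ = 1 + τ` with `τ (x, u) = (T u, 0)` and `τ² = 0`, and conjugation by it is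
the exponential of `[·, T]`. A ternary map has three inputs and one output, each of which can take
`τ` at most once, so the series stops after the fourth power, with coefficient `1/4!`. -/
theorem conjHom_shear [CharZero K] (T : M →ₗ[K] L) (f : Cochain K (L × M) (L × M) 1) :
    conjHom (shear T) 1 f = f + adHom T f + (2 : K)⁻¹ • adHom T (adHom T f)
      + (6 : K)⁻¹ • adHom T (adHom T (adHom T f))
      + (24 : K)⁻¹ • adHom T (adHom T (adHom T (adHom T f))) := by
  have up : ∀ v w : (L × M) × (L × M), Function.update (fun _ : Fin 1 => v) 0 w = fun _ => w :=
    fun v w => funext fun i => by rw [Subsingleton.elim i 0, Function.update_self]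
  have a₁ : ∀ x x' y z, f.1 (fun _ => (x + x', y)) z
      = f.1 (fun _ => (x, y)) z + f.1 (fun _ => (x', y)) z := fun x x' y z => by
    simpa only [up, one_smul] using f.2.lin_fst (fun _ => (x, y)) 0 z 1 x x' y
  have a₂ : ∀ x y y' z, f.1 (fun _ => (x, y + y')) z
      = f.1 (fun _ => (x, y)) z + f.1 (fun _ => (x, y')) z := fun x y y' z => by
    simpa only [up, one_smul] using f.2.lin_snd (fun _ => (x, y)) 0 z 1 x y y'
  have a₃ : ∀ X z z', f.1 X (z + z') = f.1 X z + f.1 X z' := fun X z z' => by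
    simpa only [one_smul] using f.2.lin_last X 1 z z'
  have z₁ : ∀ y z, f.1 (fun _ => (0, y)) z = 0 := fun y z => by simpa using a₁ 0 0 y z
  have z₂ : ∀ x z, f.1 (fun _ => (x, 0)) z = 0 := fun x z => by simpa using a₂ x 0 0 z
  have z₃ : ∀ X, f.1 X 0 = 0 := fun X => f.2.map_zero X
  refine Cochain.ext fun X z => ?_
  obtain ⟨x, y, rfl⟩ : ∃ x y, X = fun _ => (x, y) :=
    ⟨(X 0).1, (X 0).2, funext fun i => by rw [Subsingleton.elim i 0]⟩
  let τ : (L × M) →ₗ[K] (L × M) := LinearMap.inl K L M ∘ₗ T ∘ₗ LinearMap.snd K L M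
  have e : ∀ v : L × M, shear T v = v + τ v := fun v => by ext <;> simp [shear, τ]
  have e' : ∀ v : L × M, (shear T).symm v = v - τ v := fun v => by ext <;> simp [shear, τ]
  have ad : ∀ (g : Cochain K (L × M) (L × M) 1) x y z, (adHom T g).1 (fun _ => (x, y)) z
      = g.1 (fun _ => (x, y)) (τ z) + g.1 (fun _ => (τ x, y)) z + g.1 (fun _ => (x, τ y)) z
        - τ (g.1 (fun _ => (x, y)) z) := adHom_val T
  have sq : ∀ v, τ (τ v) = 0 := fun v => by ext <;> simp [τ]
  rw [conjHom_val]
  -- Only linearity of `τ` and `τ² = 0` matter from here on. Both sides expand into values of `f`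
  -- with `τ` placed on some inputs and possibly on the output, and the coefficients are compared.
  generalize τ = τ at *
  simp only [Cochain.add_val, Cochain.smul_val, Pi.add_apply, Pi.smul_apply, ad, e, e',
    map_add, map_sub, a₁, a₂, a₃, sq, z₁, z₂, z₃, map_zero]
  module

end Shear

/-! ### The twisted maps as derived brackets -/

section TwistedMaps

variable {K L M : Type*} [Field K] [AddCommGroup L] [Module K L] [AddCommGroup M] [Module K M]

theorem conj_iterBracket {V : Type*} [AddCommGroup V] [Module K V] (e : V ≃ₗ[K] V)
    (A : GradedCochain K V V) (w : List (GradedCochain K V V)) :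
    conj e (iterBracket A w) = iterBracket (conj e A) (w.map (conj e)) := by
  induction w generalizing A with
  | nil => rfl
  | cons x w ih => rw [List.map_cons, iterBracket_cons, iterBracket_cons, ih, conj_bracket]

theorem iterBracket_map_smul {V : Type*} [AddCommGroup V] [Module K V] (a : K)
    (A : GradedCochain K V V) (w : List (GradedCochain K V V)) :
    iterBracket A (w.map (a • ·)) = a ^ w.length • iterBracket A w := by
  induction w generalizing A with
  | nil => simp [iterBracket]
  | cons x w ih =>
    rw [List.map_cons, iterBracket_cons, iterBracket_cons, map_smul, iterBracket_smul, ih,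
      smul_smul, List.length_cons, pow_succ']

/-- The projection evaluates on `M`, which the scaling fixes, and reads off the `L`-component, which
the inverse scaling multiplies by `t⁻¹`. -/
theorem proj_conj_scaleEquiv (t : Kˣ) (F : GradedCochain K (L × M) (L × M)) :
    proj (conj (scaleEquiv t) F) = (↑t⁻¹ : K) • proj F := by
  have : proj ∘ₗ conj (scaleEquiv (L := L) (M := M) t) = (↑t⁻¹ : K) • proj := by
    refine DirectSum.linearMap_ext K fun n => LinearMap.ext fun f => ?_
    simp only [LinearMap.comp_apply, LinearMap.smul_apply, conj, DirectSum.lmap_lof, proj_lof,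
      ← map_smul]
    congr 1
    refine Cochain.ext fun X z => ?_
    have e : ∀ u : M, scaleEquiv t ((0 : L), u) = (0, u) := fun u => by simp [scaleEquiv]
    change ((scaleEquiv t).symm (f.1 (fun i => (scaleEquiv t (0, (X i).1),
      scaleEquiv t (0, (X i).2))) (scaleEquiv t (0, z)))).1 = _
    simp only [e]
    rfl
  exact LinearMap.congr_fun this F

/-- An element of weight `r` has only one nonvanishing derived bracket. -/
theorem derived_eq_zero_of_weight [CharZero K] {A : GradedCochain K (L × M) (L × M)} {r : ℕ}
    (hA : ∀ t : Kˣ, conj (scaleEquiv t) A = (t : K) ^ r • A) {n : ℕ} (hn : n ≠ r + 1)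
    (x : Fin n → GradedCochain K M L) : derived A (List.ofFn fun i => incl (x i)) = 0 := by
  -- A single scaling suffices, since distinct powers of `2` are distinct in characteristic 0.
  let t : Kˣ := Units.mk0 2 two_ne_zero
  have ht : (t : K) = 2 := rfl
  set w := List.ofFn fun i => incl (x i) with hw
  have e : w.map (conj (scaleEquiv t)) = w.map ((↑t⁻¹ : K) • ·) := by
    simp only [hw, List.map_ofFn]
    congr 1
    funext i
    exact conj_incl t _
  -- With `n` letters of weight -1 the iterated bracket has weight `r - n`, while its projection has
  -- weight -1. It therefore vanishes unless `n = r + 1`.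
  have h := proj_conj_scaleEquiv t (iterBracket A w)
  rw [conj_iterBracket, e, iterBracket_map_smul, hA, iterBracket_smul, map_smul, map_smul,
    smul_smul, ← sub_eq_zero, ← sub_smul] at h
  refine (smul_eq_zero.1 h).resolve_left fun h0 => hn ?_
  rw [hw, List.length_ofFn, Units.val_inv_eq_inv_val, ht, inv_pow, sub_eq_zero] at h0
  field_simp at h0
  have h1 : (2 : ℕ) ^ (r + 1) = 2 ^ n := by
    rw [pow_succ]
    exact_mod_cast (by linear_combination h0 : (2 : K) ^ r * 2 = 2 ^ n)
  exact (Nat.pow_right_injective le_rfl h1).symm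

variable {S : LieTripleSystem K L} {ρ : Representation M S}

theorem structureMaps_eq_zero (ω : ThreeCocycle ρ) {m : ℕ} (hm : 5 ≤ m) :
    structureMaps ω m = 0 := by
  obtain ⟨k, rfl⟩ := Nat.exists_eq_add_of_le' hm
  rfl

/-- The weights 2 of `π + θ` and 3 of `H` leave only the arities 3 and 4. Thus the separately
defined maps `l₃`, `l₄` and zeros are all derived brackets of one element, also in arity `0`. -/
theorem structureMaps_eq_derived [CharZero K] (ω : ThreeCocycle ρ) {m : ℕ}
    (y : Fin m → GradedCochain K M L) : structureMaps ω m y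
      = derived (DirectSum.lof K ℕ (Cochain K (L × M) (L × M)) 1 (twistedSemidirect ω))
        (List.ofFn fun i => incl (y i)) := by
  have h₁ := fun h => derived_eq_zero_of_weight (conj_semidirect ρ) (n := m) h y
  have h₂ := fun h => derived_eq_zero_of_weight (conj_toCochain ω) (n := m) h y
  rw [derived, twistedSemidirect, map_add, iterBracket_add, map_add]
  rw [derived] at h₁ h₂
  by_cases h3 : m = 3
  · subst h3
    rw [h₂ (by norm_num), add_zero]
    simp only [List.ofFn_succ, List.ofFn_zero, iterBracket, List.foldl_cons, List.foldl_nil]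
    rfl
  by_cases h4 : m = 4
  · subst h4
    rw [h₁ (by norm_num), zero_add]
    simp only [List.ofFn_succ, List.ofFn_zero, iterBracket, List.foldl_cons, List.foldl_nil]
    rfl
  rw [h₁ h3, h₂ h4, add_zero]
  match m, h3, h4 with
  | 0, _, _ => rfl
  | 1, _, _ => rfl
  | 2, _, _ => rfl
  | k + 5, _, _ => rfl

/-- The structure maps vanish from arity 5 on, so five terms suffice for every `k`. -/
theorem twistedMaps_apply (ω : ThreeCocycle ρ) (T : M →ₗ[K] L) {k : ℕ}
    (x : Fin k → GradedCochain K M L) : twistedMaps ω T k x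
      = ∑ n ∈ Finset.range 5, (n.factorial : K)⁻¹ •
        structureMaps ω (n + k) (Fin.append (fun _ => ofHom T) x) := by
  rw [twistedMaps, twist, finsum_eq_sum_of_support_subset (s := Finset.range 5),
    sum_apply]
  · refine Finset.sum_congr rfl fun n _ => ?_
    rw [smul_apply, MultilinearMap.currySum_apply, MultilinearMap.domDomCongr_apply]
    congr 2
    funext i
    induction i using Fin.addCases <;> simp
  · intro n hn
    rw [Finset.mem_coe, Finset.mem_range]
    by_contra h
    refine hn ?_
    refine MultilinearMap.ext fun y => ?_
    beta_reduce
    rw [smul_apply, MultilinearMap.currySum_apply, MultilinearMap.domDomCongr_apply,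
      structureMaps_eq_zero ω (by omega)]
    simp

theorem twistedMaps_eq_zero (ω : ThreeCocycle ρ) (T : M →ₗ[K] L) {k : ℕ} (hk : 5 ≤ k) :
    twistedMaps ω T k = 0 := by
  refine MultilinearMap.ext fun x => ?_
  rw [twistedMaps_apply, Finset.sum_eq_zero fun n _ => ?_]
  · rfl
  · rw [structureMaps_eq_zero ω (by omega), zero_apply, smul_zero]

theorem iterBracket_replicate (T : M →ₗ[K] L) (f : Cochain K (L × M) (L × M) 1) (n : ℕ) :
    iterBracket (DirectSum.lof K ℕ (Cochain K (L × M) (L × M)) 1 f)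
      (List.replicate n (incl (ofHom T)))
      = DirectSum.lof K ℕ (Cochain K (L × M) (L × M)) 1 ((adHom T)^[n] f) := by
  induction n generalizing f with
  | zero => rfl
  | succ n ih =>
    rw [List.replicate_succ, iterBracket_cons, bracket_ofHom, ih, Function.iterate_succ_apply]

/-- The `n` copies of `T` come first in the left-nested bracket, so they only replace `Δ` by its
`n`-fold bracket with `T`. Summed with the coefficients `1/n!` this is the conjugate of `Δ` by the
shear. -/
theorem twistedMaps_eq_derived [CharZero K] (ω : ThreeCocycle ρ) (T : M →ₗ[K] L) {k : ℕ}
    (x : Fin k → GradedCochain K M L) : twistedMaps ω T k x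
      = derived (DirectSum.lof K ℕ (Cochain K (L × M) (L × M)) 1
          (conjHom (shear T) 1 (twistedSemidirect ω))) (List.ofFn fun i => incl (x i)) := by
  have h : ∀ n, structureMaps ω (n + k) (Fin.append (fun _ => ofHom T) x)
      = derived (DirectSum.lof K ℕ (Cochain K (L × M) (L × M)) 1
          ((adHom T)^[n] (twistedSemidirect ω))) (List.ofFn fun i => incl (x i)) := by
    intro n
    have e : (fun i => incl (Fin.append (fun _ : Fin n => ofHom T) x i))
        = Fin.append (fun _ : Fin n => incl (ofHom T)) fun i => incl (x i) := by
      funext i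
      induction i using Fin.addCases <;> simp
    rw [structureMaps_eq_derived, e, List.ofFn_fin_append, List.ofFn_const, derived,
      iterBracket_append, iterBracket_replicate, derived]
  simp only [twistedMaps_apply, h, Finset.sum_range_succ, Finset.sum_range_zero, conjHom_shear,
    derived, map_add, map_smul, iterBracket_add, iterBracket_smul, Function.iterate_succ,
    Function.iterate_zero, Function.comp_apply, id_eq]
  norm_num [Nat.factorial]

/-- The shear carries `M` to the graph of `T`. The projection of the conjugate is the difference of
the two sides of the Reynolds identity; it vanishes when the graph is closed under the twisted
bracket. -/
theorem proj_conj_shear_eq_zero (ω : ThreeCocycle ρ) (T : M →ₗ[K] L) :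
    proj (conj (shear T) (DirectSum.lof K ℕ (Cochain K (L × M) (L × M)) 1 (twistedSemidirect ω)))
      = 0 ↔ IsGeneralizedReynolds ω T := by
  rw [conj, DirectSum.lmap_lof, proj_lof,
    map_eq_zero_iff (DirectSum.lof K ℕ (Cochain K M L) 1) (DirectSum.of_injective 1)]
  have h : ∀ (X : Fin 1 → M × M) w,
      (projHom 1 (conjHom (shear T) 1 (twistedSemidirect ω))).1 X w
        = S.bracket (T (X 0).1) (T (X 0).2) (T w) - T (ρ.D (T (X 0).1) (T (X 0).2) w
          + ρ.θ (T (X 0).2) (T w) (X 0).1 - ρ.θ (T (X 0).1) (T w) (X 0).2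
          + ω.H (T (X 0).1) (T (X 0).2) (T w)) := by
    intro X w
    have e : ∀ u : M, shear T ((0 : L), u) = (T u, u) := fun u => by simp [shear]
    change ((shear T).symm ((twistedSemidirect ω).1 (fun i => (shear T (0, (X i).1),
      shear T (0, (X i).2))) (shear T (0, w)))).1 = _
    simp only [e, twistedSemidirect_val]
    change _ - T _ = _
    congr 2
    dsimp only
    abel
  constructor
  · intro h0 u v w
    have := h (fun _ => (u, v)) w
    rw [h0] at this
    exact (sub_eq_zero.1 this.symm)
  · intro hT
    exact Cochain.ext fun X w => by rw [h, hT, sub_self]; rfl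

theorem isLInfinity_twistedMaps [CharZero K] {ω : ThreeCocycle ρ} {T : M →ₗ[K] L}
    (hT : IsGeneralizedReynolds ω T) : IsLInfinity (cochainGrading K M L) (twistedMaps ω T) := by
  have e : conj (shear T)
      (DirectSum.lof K ℕ (Cochain K (L × M) (L × M)) 1 (twistedSemidirect ω))
      = DirectSum.lof K ℕ _ 1 (conjHom (shear T) 1 (twistedSemidirect ω)) := DirectSum.lmap_lof _ _ _
  refine isLInfinity_of_derived (mem_cochainGrading_natCast.2 ⟨_, rfl⟩) ?_ ?_
    fun k _ x => twistedMaps_eq_derived ω T x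
  · rw [← e, ← conj_bracket, bracket_twistedSemidirect, map_zero]
  · rw [← e, proj_conj_shear_eq_zero]
    exact hT

theorem twistedMaps_ofHom [CharZero K] (ω : ThreeCocycle ρ) (T T' : M →ₗ[K] L) (k : ℕ) :
    twistedMaps ω T k (fun _ => ofHom T')
      = proj (DirectSum.lof K ℕ (Cochain K (L × M) (L × M)) 1
          ((adHom T')^[k] (conjHom (shear T) 1 (twistedSemidirect ω)))) := by
  rw [twistedMaps_eq_derived, List.ofFn_const, derived, iterBracket_replicate]

/-- The Maurer–Cartan expression of the twisted maps. -/
theorem sum_twistedMaps_ofHom [CharZero K] {ω : ThreeCocycle ρ} {T : M →ₗ[K] L}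
    (hT : IsGeneralizedReynolds ω T) (T' : M →ₗ[K] L) :
    ∑ n ∈ Finset.range 4, ((n + 1).factorial : K)⁻¹ • twistedMaps ω T (n + 1) (fun _ => ofHom T')
      = proj (conj (shear (T + T'))
          (DirectSum.lof K ℕ (Cochain K (L × M) (L × M)) 1 (twistedSemidirect ω))) := by
  have h := (proj_conj_shear_eq_zero ω T).2 hT
  rw [← conj_shear]
  simp only [conj, DirectSum.lmap_lof] at h ⊢
  -- The exponential series of `T'` is applied to `Δ_T`. Its constant term projects to `0` by `h`,
  -- and the other four terms form the Maurer–Cartan expression.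
  rw [conjHom_shear T']
  simp only [map_add, map_smul, h, zero_add, twistedMaps_ofHom, Finset.sum_range_succ,
    Finset.sum_range_zero, Function.iterate_succ, Function.iterate_zero, Function.comp_apply, id_eq]
  norm_num [Nat.factorial]

/-- The degree and finiteness conditions hold automatically, as `T'` has degree 0 and the twisted
maps vanish from arity 5 on. -/
theorem isMaurerCartan_ofHom_iff (ω : ThreeCocycle ρ) (T T' : M →ₗ[K] L) :
    IsMaurerCartan (cochainGrading K M L) (twistedMaps ω T) (ofHom T') ↔
      ∑ n ∈ Finset.range 4, ((n + 1).factorial : K)⁻¹ •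
        twistedMaps ω T (n + 1) (fun _ => ofHom T') = 0 := by
  have h0 : ∀ n, n ∉ Finset.range 4 → twistedMaps ω T (n + 1) (fun _ => ofHom T') = 0 := by
    intro n hn
    rw [Finset.mem_range] at hn
    rw [twistedMaps_eq_zero ω T (by omega), zero_apply]
  have hs : ∑ᶠ n : ℕ, ((n + 1).factorial : K)⁻¹ • twistedMaps ω T (n + 1) (fun _ => ofHom T')
      = ∑ n ∈ Finset.range 4, ((n + 1).factorial : K)⁻¹ •
        twistedMaps ω T (n + 1) (fun _ => ofHom T') := by
    refine finsum_eq_sum_of_support_subset _ fun n hn => ?_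
    by_contra h
    exact hn (by simp only [h0 n h, smul_zero])
  rw [IsMaurerCartan, hs]
  refine ⟨fun h => h.2.2, fun h => ⟨⟨_, rfl⟩, (Finset.range 4).finite_toSet.subset ?_, h⟩⟩
  intro n hn
  by_contra h
  exact hn (h0 n h)

end TwistedMaps

end LieTriple

/-! ### The proposition -/

theorem mainTheorem11 {K L M : Type*} [Field K] [CharZero K] [AddCommGroup L] [Module K L]
    [AddCommGroup M] [Module K M] (S : LieTriple.LieTripleSystem K L)
    (ρ : LieTriple.Representation M S) (ω : LieTriple.ThreeCocycle ρ) (T : M →ₗ[K] L)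
    (hT : LieTriple.IsGeneralizedReynolds ω T) :
    LieTriple.IsLInfinity (LieTriple.cochainGrading K M L) (LieTriple.twistedMaps ω T) ∧
    (∀ P, LieTriple.twistedMaps ω T 1 ![P]
      = (2 : K)⁻¹ • LieTriple.l₃ ρ ![LieTriple.ofHom T, LieTriple.ofHom T, P]
      + (6 : K)⁻¹ • LieTriple.l₄ ω
          ![LieTriple.ofHom T, LieTriple.ofHom T, LieTriple.ofHom T, P]) ∧
    (∀ P Q, LieTriple.twistedMaps ω T 2 ![P, Q]
      = LieTriple.l₃ ρ ![LieTriple.ofHom T, P, Q]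
      + (2 : K)⁻¹ • LieTriple.l₄ ω ![LieTriple.ofHom T, LieTriple.ofHom T, P, Q]) ∧
    (∀ P Q R, LieTriple.twistedMaps ω T 3 ![P, Q, R]
      = LieTriple.l₃ ρ ![P, Q, R] + LieTriple.l₄ ω ![LieTriple.ofHom T, P, Q, R]) ∧
    (∀ P Q R U, LieTriple.twistedMaps ω T 4 ![P, Q, R, U] = LieTriple.l₄ ω ![P, Q, R, U]) ∧
    (∀ k, 5 ≤ k → LieTriple.twistedMaps ω T k = 0) ∧
    ∀ T' : M →ₗ[K] L,
      (LieTriple.IsGeneralizedReynolds ω (T + T') ↔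
        LieTriple.IsMaurerCartan (LieTriple.cochainGrading K M L) (LieTriple.twistedMaps ω T)
          (LieTriple.ofHom T')) ∧
      (LieTriple.IsMaurerCartan (LieTriple.cochainGrading K M L) (LieTriple.twistedMaps ω T)
          (LieTriple.ofHom T') ↔
        LieTriple.twistedMaps ω T 1 ![LieTriple.ofHom T']
          + (2 : K)⁻¹ • LieTriple.twistedMaps ω T 2 ![LieTriple.ofHom T', LieTriple.ofHom T']
          + (6 : K)⁻¹ • LieTriple.twistedMaps ω T 3
              ![LieTriple.ofHom T', LieTriple.ofHom T', LieTriple.ofHom T']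
          + (24 : K)⁻¹ • LieTriple.twistedMaps ω T 4
              ![LieTriple.ofHom T', LieTriple.ofHom T', LieTriple.ofHom T', LieTriple.ofHom T']
          = 0) := by
  have e0 : ∀ k (x : Fin k → LieTriple.GradedCochain K M L), LieTriple.twistedMaps ω T k x = _ :=
    fun k x => LieTriple.twistedMaps_apply ω T x
  -- The numerical coefficients are written as factorials to match those of the twist.
  have hfac : (2 : K)⁻¹ = ((Nat.factorial 2 : ℕ) : K)⁻¹ ∧ (6 : K)⁻¹ = ((Nat.factorial 3 : ℕ) : K)⁻¹
      ∧ (24 : K)⁻¹ = ((Nat.factorial 4 : ℕ) : K)⁻¹ := by norm_num [Nat.factorial]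
  obtain ⟨f₂, f₃, f₄⟩ := hfac
  refine ⟨LieTriple.isLInfinity_twistedMaps hT, fun P => ?_, fun P Q => ?_, fun P Q R => ?_,
    fun P Q R U => ?_, fun k hk => LieTriple.twistedMaps_eq_zero ω T hk, fun T' => ⟨?_, ?_⟩⟩
  -- Of the five terms only those of total arity 3 and 4 survive, here `n = 2` and `n = 3`. For the
  -- higher twisted maps these values of `n` shift down.
  · have a : ∀ n, n = 0 ∨ n = 1 ∨ n = 4 → ∀ x, LieTriple.structureMaps ω (n + 1) x = 0 := by
      rintro n (rfl | rfl | rfl) x <;> rfl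
    have b : LieTriple.structureMaps ω (2 + 1) (Fin.append (fun _ => LieTriple.ofHom T) ![P])
        = LieTriple.l₃ ρ ![LieTriple.ofHom T, LieTriple.ofHom T, P] :=
      congrArg (LieTriple.l₃ ρ) (funext fun i => by fin_cases i <;> rfl)
    have c : LieTriple.structureMaps ω (3 + 1) (Fin.append (fun _ => LieTriple.ofHom T) ![P])
        = LieTriple.l₄ ω ![LieTriple.ofHom T, LieTriple.ofHom T, LieTriple.ofHom T, P] :=
      congrArg (LieTriple.l₄ ω) (funext fun i => by fin_cases i <;> rfl)
    rw [e0, f₂, f₃]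
    simp only [Finset.sum_range_succ, Finset.sum_range_zero, b, c]
    rw [a 0 (by simp), a 1 (by simp), a 4 (by simp)]
    simp only [smul_zero, zero_add, add_zero]
  · have a : ∀ n, n = 0 ∨ n = 3 ∨ n = 4 → ∀ x, LieTriple.structureMaps ω (n + 2) x = 0 := by
      rintro n (rfl | rfl | rfl) x <;> rfl
    have b : LieTriple.structureMaps ω (1 + 2) (Fin.append (fun _ => LieTriple.ofHom T) ![P, Q])
        = LieTriple.l₃ ρ ![LieTriple.ofHom T, P, Q] :=
      congrArg (LieTriple.l₃ ρ) (funext fun i => by fin_cases i <;> rfl)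
    have c : LieTriple.structureMaps ω (2 + 2) (Fin.append (fun _ => LieTriple.ofHom T) ![P, Q])
        = LieTriple.l₄ ω ![LieTriple.ofHom T, LieTriple.ofHom T, P, Q] :=
      congrArg (LieTriple.l₄ ω) (funext fun i => by fin_cases i <;> rfl)
    rw [e0, f₂]
    simp only [Finset.sum_range_succ, Finset.sum_range_zero, b, c]
    rw [a 0 (by simp), a 3 (by simp), a 4 (by simp)]
    simp only [smul_zero, zero_add, add_zero, Nat.factorial_one, Nat.cast_one, inv_one, one_smul]
  · have a : ∀ n, n = 2 ∨ n = 3 ∨ n = 4 → ∀ x, LieTriple.structureMaps ω (n + 3) x = 0 := by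
      rintro n (rfl | rfl | rfl) x <;> rfl
    have b : LieTriple.structureMaps ω (0 + 3) (Fin.append (fun _ => LieTriple.ofHom T) ![P, Q, R])
        = LieTriple.l₃ ρ ![P, Q, R] :=
      congrArg (LieTriple.l₃ ρ) (funext fun i => by fin_cases i <;> rfl)
    have c : LieTriple.structureMaps ω (1 + 3) (Fin.append (fun _ => LieTriple.ofHom T) ![P, Q, R])
        = LieTriple.l₄ ω ![LieTriple.ofHom T, P, Q, R] :=
      congrArg (LieTriple.l₄ ω) (funext fun i => by fin_cases i <;> rfl)
    rw [e0]
    simp only [Finset.sum_range_succ, Finset.sum_range_zero, b, c]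
    rw [a 2 (by simp), a 3 (by simp), a 4 (by simp)]
    simp only [smul_zero, zero_add, add_zero, Nat.factorial_zero, Nat.factorial_one, Nat.cast_one,
      inv_one, one_smul]
  · have a : ∀ n, n = 1 ∨ n = 2 ∨ n = 3 ∨ n = 4 → ∀ x,
        LieTriple.structureMaps ω (n + 4) x = 0 := by
      rintro n (rfl | rfl | rfl | rfl) x <;> rfl
    have c : LieTriple.structureMaps ω (0 + 4)
        (Fin.append (fun _ => LieTriple.ofHom T) ![P, Q, R, U]) = LieTriple.l₄ ω ![P, Q, R, U] :=
      congrArg (LieTriple.l₄ ω) (funext fun i => by fin_cases i <;> rfl)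
    rw [e0]
    simp only [Finset.sum_range_succ, Finset.sum_range_zero, c]
    rw [a 1 (by simp), a 2 (by simp), a 3 (by simp), a 4 (by simp)]
    simp only [smul_zero, zero_add, add_zero, Nat.factorial_zero, Nat.cast_one, inv_one, one_smul]
  · rw [LieTriple.isMaurerCartan_ofHom_iff, LieTriple.sum_twistedMaps_ofHom hT,
      LieTriple.proj_conj_shear_eq_zero]
  · rw [LieTriple.isMaurerCartan_ofHom_iff]
    have v₁ : ![LieTriple.ofHom (K := K) T'] = fun _ => LieTriple.ofHom T' :=
      funext fun i => by fin_cases i; rfl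
    have v₂ : ![LieTriple.ofHom (K := K) T', LieTriple.ofHom T'] = fun _ => LieTriple.ofHom T' :=
      funext fun i => by fin_cases i <;> rfl
    have v₃ : ![LieTriple.ofHom (K := K) T', LieTriple.ofHom T', LieTriple.ofHom T']
        = fun _ => LieTriple.ofHom T' := funext fun i => by fin_cases i <;> rfl
    have v₄ : ![LieTriple.ofHom (K := K) T', LieTriple.ofHom T', LieTriple.ofHom T',
        LieTriple.ofHom T'] = fun _ => LieTriple.ofHom T' := funext fun i => by fin_cases i <;> rfl
    rw [v₄, v₃, v₂, v₁, f₂, f₃, f₄]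
    simp only [Finset.sum_range_succ, Finset.sum_range_zero, zero_add, Nat.factorial_one,
      Nat.cast_one, inv_one, one_smul]
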